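/- Let $\gamma\in(1,\frac43)$. For $y>0$, $\rho>0$, $\omega\in\mathbb R$ put $$G(y;\rho,\omega)=\gamma\rho^{\gamma-1}-y^2\omega^2,\qquad h(\rho,\omega)=2\omega^2+(\gamma-1)\omega-\frac{4\pi\rho\omega}{4-3\gamma}+(\gamma-1)(2-\gamma),$$ and consider the self-similar Euler--Poisson system $$\rho'=\frac{y\rho\,h(\rho,\omega)}{G(y;\rho,\omega)},\qquad \omega'=\frac{4-3\gamma-3\omega}{y}-\frac{y\,\omega\,h(\rho,\omega)}{G(y;\rho,\omega)}.\tag{1}$$ Let $y_f=\frac{\sqrt\gamma}{2-\gamma}\big(\frac{4-3\gamma}{2\pi}\big)^{\frac{\gamma-1}{2}}$ and $y_F=\frac{3}{4-3\gamma}\sqrt{\frac{\gamma}{(6\pi)^{\gamma-1}}}$. For $y_*\in[y_f,y_F]$, the LPH-type (Larson--Penston--Hunter-type) solution $(\rho(\cdot;y_*),\omega(\cdot;y_*))$ with sonic point $y_*$ is the real-analytic solution near $y_*$ of (1) (multiplied by $G$) whose Taylor coefficients of order zero and one at $y_*$ satisfy $\rho_0>0$, $G(y_*;\rho_0,\omega_0)=0$,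 $h(\rho_0,\omega_0)=0$ and $\rho_1=\rho_0R_1/y_*$, $\omega_1=W_1/y_*$, where $$R_1=\frac{(9-7\gamma)\omega_0^2-8\omega_0^3-\sqrt{\omega_0^3\,\sigma(\omega_0)}}{2\omega_0^3(\gamma+1)},\qquad W_1=4-3\gamma-3\omega_0-\omega_0R_1,$$ $$\sigma(\omega_0)=-4(4-3\gamma)(\gamma+1)(\gamma-1)(2-\gamma)+(57-114\gamma+73\gamma^2-12\gamma^3)\omega_0-8(3\gamma^2-15\gamma+14)\omega_0^2+8(5-3\gamma)\omega_0^3 .$$ Its sonic time is $$s(y_*)=\inf\{a\in(0,y_*)\;:\;(\rho,\omega)(\cdot;y_*)\text{ extends to a solution of (1) on }(a,y_*]\text{ with }G>0\text{ on }(a,y_*)\},$$ and $(\rho,\omega)(\cdot;y_*)$ also denotes the maximal extension to $(s(y_*),y_*]$. Its critical time is $$y_c(y_*)=\inf\{y\in(s(y_*),y_*)\;:\;\omega(\tilde y;y_*)>\tfrac{4-3\gamma}{3}\text{ for all }\tilde y\in(y,y_*)\}.$$ Let $$Y=\{y_*\in[y_f,y_F)\;:\;\text{for all }\tilde y_*\in[y_*,y_F)\text{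 there is }y\in(s(\tilde y_*),\tilde y_*)\text{ with }\omega(y;\tilde y_*)=\tfrac{4-3\gamma}{3}\},\qquad \bar y_*=\inf Y .$$ Then $Y\neq\emptyset$ and $s(\bar y_*)=y_c(\bar y_*)=0$. That is, the LPH-type solution with sonic point $\bar y_*$ exists and extends to a solution of (1) on all of $(0,\bar y_*]$ with $G>0$ on $(0,\bar y_*)$ (there is no second sonic point), and $\omega(y;\bar y_*)>\frac{4-3\gamma}{3}$ for all $y\in(0,\bar y_*)$. -/

import Mathlib

open Set Filter Topology

noncomputable section

namespace SelfSimilarEP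

/-- The sonic function `G(y; ρ, ω) = γ ρ^(γ-1) - y² ω²`; the flow is subsonic where it is
positive and a sonic point is a zero of it. -/
def G (γ y ρ ω : ℝ) : ℝ := γ * ρ ^ (γ - 1) - y ^ 2 * ω ^ 2

/-- `h(ρ, ω) = 2ω² + (γ-1)ω - 4πρω/(4-3γ) + (γ-1)(2-γ)`. -/
def h (γ ρ ω : ℝ) : ℝ :=
  2 * ω ^ 2 + (γ - 1) * ω - 4 * Real.pi * ρ * ω / (4 - 3 * γ) + (γ - 1) * (2 - γ)

/-- The constant relative velocity of the Friedman solution. -/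
def omegaF (γ : ℝ) : ℝ := (4 - 3 * γ) / 3

/-- Sonic point of the far-field solution. -/
def yf (γ : ℝ) : ℝ :=
  Real.sqrt γ / (2 - γ) * ((4 - 3 * γ) / (2 * Real.pi)) ^ ((γ - 1) / 2)

/-- Sonic point of the Friedman solution. -/
def yF (γ : ℝ) : ℝ :=
  3 / (4 - 3 * γ) * Real.sqrt (γ / (6 * Real.pi) ^ (γ - 1))

/-- The polynomial `s(ω₀)` for which `ω₀³ s(ω₀)` is the discriminant of the quadratic equation
of the rescaled first Taylor coefficient `R = y_* ρ₁ / ρ₀`. -/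
def branchPoly (γ ω₀ : ℝ) : ℝ :=
  -4 * (4 - 3 * γ) * (γ + 1) * (γ - 1) * (2 - γ)
    + (57 - 114 * γ + 73 * γ ^ 2 - 12 * γ ^ 3) * ω₀
    - 8 * (3 * γ ^ 2 - 15 * γ + 14) * ω₀ ^ 2
    + 8 * (5 - 3 * γ) * ω₀ ^ 3

/-- The Larson-Penston-Hunter branch of `R = y_* ρ₁ / ρ₀` (the smaller root). -/
def R₁ (γ ω₀ : ℝ) : ℝ :=
  ((9 - 7 * γ) * ω₀ ^ 2 - 8 * ω₀ ^ 3 - Real.sqrt (ω₀ ^ 3 * branchPoly γ ω₀))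
    / (2 * ω₀ ^ 3 * (γ + 1))

/-- The Larson-Penston-Hunter branch of `W = y_* ω₁`. -/
def W₁ (γ ω₀ : ℝ) : ℝ := 4 - 3 * γ - 3 * ω₀ - ω₀ * R₁ γ ω₀

/-- `(ρ, ω)` is a local solution of Larson-Penston-Hunter type at the sonic point `ys`:
both functions are the sums of convergent power series about `ys`; the zeroth order coefficients
(with positive density) satisfy `G = h = 0`; the first order coefficients are those of the branch
`(R₁, W₁)`; and, near `ys`, the series satisfy the self-similar Euler-Poisson system multiplied
by `G`, i.e. the coefficients of every order satisfy the recursion obtained by inserting the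
series into the system. -/
structure IsLPHAt (γ ys : ℝ) (ρ ω : ℝ → ℝ) : Prop where
  analytic_rho : AnalyticAt ℝ ρ ys
  analytic_omega : AnalyticAt ℝ ω ys
  rho_pos : 0 < ρ ys
  sonic : G γ ys (ρ ys) (ω ys) = 0
  h_eq_zero : h γ (ρ ys) (ω ys) = 0
  rho_one : deriv ρ ys = ρ ys * R₁ γ (ω ys) / ys
  omega_one : deriv ω ys = W₁ γ (ω ys) / ys
  eq_rho : ∀ᶠ y in 𝓝 ys,
    G γ y (ρ y) (ω y) * deriv ρ y = y * ρ y * h γ (ρ y) (ω y)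
  eq_omega : ∀ᶠ y in 𝓝 ys,
    G γ y (ρ y) (ω y) * deriv ω y =
      (4 - 3 * γ - 3 * ω y) / y * G γ y (ρ y) (ω y) - y * ω y * h γ (ρ y) (ω y)

/-- The local LPH-type solution at `ys` extends, as the pair `(ρ, ω)`, to a solution of the
self-similar Euler-Poisson system on `(a, ys]` which is subsonic on `(a, ys)`. -/
structure IsLPHSolutionOn (γ ys a : ℝ) (ρ ω : ℝ → ℝ) : Prop extends IsLPHAt γ ys ρ ω where
  hasDeriv_rho : ∀ y ∈ Ioo a ys,
    HasDerivAt ρ (y * ρ y * h γ (ρ y) (ω y) / G γ y (ρ y) (ω y)) y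
  hasDeriv_omega : ∀ y ∈ Ioo a ys,
    HasDerivAt ω ((4 - 3 * γ - 3 * ω y) / y
      - y * ω y * h γ (ρ y) (ω y) / G γ y (ρ y) (ω y)) y
  subsonic : ∀ y ∈ Ioo a ys, 0 < G γ y (ρ y) (ω y)

/-- The sonic time `s(ys)`: the infimum of the `a ∈ (0, ys)` for which the LPH-type solution
extends onto `(a, ys]` and stays subsonic to the left of `ys`. -/
def sonicTime (γ ys : ℝ) : ℝ :=
  sInf {a : ℝ | a ∈ Ioo 0 ys ∧ ∃ ρ ω : ℝ → ℝ, IsLPHSolutionOn γ ys a ρ ω}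

/-- `(ρ, ω)` is, on `(s(ys), ys]`, the maximal subsonic LPH-type solution
`(ρ(·; ys), ω(·; ys))`. -/
def IsMaximalLPHSolution (γ ys : ℝ) (ρ ω : ℝ → ℝ) : Prop :=
  IsLPHSolutionOn γ ys (sonicTime γ ys) ρ ω

/-- The fundamental set `Y`: all `ys ∈ [y_f, y_F)` such that for every `yt ∈ [ys, y_F)` the
relative velocity `ω(·; yt)` attains the Friedman value in `(s(yt), yt)`. -/
def fundamentalSet (γ : ℝ) : Set ℝ :=
  {ys : ℝ | ys ∈ Ico (yf γ) (yF γ) ∧ ∀ yt ∈ Ico ys (yF γ),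
    ∃ ρ ω : ℝ → ℝ, IsMaximalLPHSolution γ yt ρ ω ∧
      ∃ y ∈ Ioo (sonicTime γ yt) yt, ω y = omegaF γ}

/-- The critical value `ȳ_* = inf Y`. -/
def criticalValue (γ : ℝ) : ℝ := sInf (fundamentalSet γ)

/-- The critical time `y_c(ys)`: the infimum of the `y ∈ (s(ys), ys)` such that `ω(·; ys)` is
larger than the Friedman value on `(y, ys)`. -/
def criticalTime (γ ys : ℝ) : ℝ :=
  sInf {y : ℝ | y ∈ Ioo (sonicTime γ ys) ys ∧
    ∃ ρ ω : ℝ → ℝ, IsMaximalLPHSolution γ ys ρ ω ∧ ∀ z ∈ Ioo y ys, omegaF γ < ω z}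

end SelfSimilarEP

end

/-! The proof is a shooting argument in the sonic point, carried out in variables that make the
system autonomous. With `τ = log (ys / y)`, `w = 1/ω`, `v = -y ω'/ω` and `m = G/(y ω)²`, a flow
becomes a curve with `v̇ = q(v,w)/m - B(v,w)`, `ẇ = -w v`, `ṁ = -(1+m) E(v,w)`, where `q`, `B`, `E`
are the polynomials `sonicPoly`, `driftPoly`, `machRate`. A sonic point is `m = 0`, `w = p`, `q(v,p)
= 0`; the LPH branch is the smaller root of `q(·,p)`, where `q_v < 0`. The centre `y = 0` is `τ =
∞`. The sonic position is strictly increasing in `p`, and `[yf, yF]` corresponds to `p` from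
`1/(2-γ)` (far-field) to `3/(4-3γ)` (Friedman).

Local theory. Near `m = 0` the curve is a power series found by the implicit function theorem in an
algebra of absolutely summable series (`exists_sonicCurve_family`); it exists on a common interval
and is Lipschitz in `p`. An energy estimate for the damped singular system gives uniqueness
(`IsSonicCurve.eqOn`), and Gronwall's inequality gives continuous dependence on longer intervals
(`IsSonicCurve.eventually_exists_near`).

Shooting. While `v < 0` and `(4-3γ) w ≤ 3`, `E ≤ -2`, so `m` grows, no second sonic point can form,
and the curve stays bounded on bounded times. Hence it continues until `v = 0` or `(4-3γ) w = 3`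
(`exists_sonicCurve_or_exit`). Crossing the Friedman value with `v < 0` is an open condition on `p`
and holds at and near the Friedman end. Let `p` be the infimum of the parameters above which
everything crosses. At this `p` neither exit can occur: leaving through `v = 0` is transversal, so
neighbours of `p` would not cross; leaving through the Friedman value would make `p` and its
neighbours cross; leaving through both at once contradicts uniqueness, because that state lies on
the Friedman solution. So the curve is global with `(4-3γ) w < 3`. If `p` is the far-field endpoint,
the curve is explicit and global.

Translation. A sonic curve yields an LPH flow (`IsSonicCurve.isLPHSolutionOn`) and every LPH flow
comes from one near its sonic point (`IsLPHSolutionOn.exists_sonicCurve`). Uniqueness then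
identifies `criticalValue` with `sonicPoint γ p`. -/

noncomputable section

namespace SelfSimilarEP

/-! ### The Wiener algebra of absolutely summable power series. -/

open PowerSeries in
/-- The power series with absolutely summable coefficients, as a subalgebra. -/
def wienerSubalgebra : Subalgebra ℝ (PowerSeries ℝ) where
  carrier := {f | Summable fun n => ‖coeff n f‖}
  mul_mem' {f g} hf hg := by
    have := summable_norm_sum_mul_antidiagonal_of_summable_norm hf hg
    simpa only [mem_ofPred_eq, PowerSeries.coeff_mul] using this
  add_mem' {f g} hf hg := by
    refine Summable.of_nonneg_of_le (fun _ => norm_nonneg _) (fun n => ?_) (hf.add hg)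
    rw [map_add]
    exact norm_add_le _ _
  algebraMap_mem' r := by
    refine summable_of_ne_finset_zero (s := {0}) fun n hn => ?_
    have hn' : n ≠ 0 := by simpa using hn
    rw [PowerSeries.algebraMap_apply, PowerSeries.coeff_C, if_neg hn', norm_zero]

/-- The Wiener algebra of power series with absolutely summable coefficients. -/
abbrev Wiener : Type := wienerSubalgebra

namespace Wiener

/-- The `n`-th coefficient. -/
def co (f : Wiener) (n : ℕ) : ℝ := PowerSeries.coeff n (f : PowerSeries ℝ)

lemma summable_co (f : Wiener) : Summable fun n => ‖f.co n‖ := f.2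

@[ext] lemma ext_co {f g : Wiener} (hfg : ∀ n, f.co n = g.co n) : f = g :=
  Subtype.ext (PowerSeries.ext hfg)

@[simp] lemma co_add (f g : Wiener) (n : ℕ) : (f + g).co n = f.co n + g.co n := by simp [co]

@[simp] lemma co_smul (c : ℝ) (f : Wiener) (n : ℕ) : (c • f).co n = c * f.co n := by simp [co]

@[simp] lemma co_neg (f : Wiener) (n : ℕ) : (-f).co n = -f.co n := by simp [co]

@[simp] lemma co_sub (f g : Wiener) (n : ℕ) : (f - g).co n = f.co n - g.co n := by simp [co]

@[simp] lemma co_zero (n : ℕ) : (0 : Wiener).co n = 0 := by simp [co]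

lemma co_mul (f g : Wiener) (n : ℕ) :
    (f * g).co n = ∑ kl ∈ Finset.HasAntidiagonal.antidiagonal n, f.co kl.1 * g.co kl.2 := by
  simp [co, PowerSeries.coeff_mul]

lemma co_one (n : ℕ) : (1 : Wiener).co n = if n = 0 then 1 else 0 := by
  simp [co, PowerSeries.coeff_one]

/-- The element with given absolutely summable coefficients. -/
def mk (c : ℕ → ℝ) (hc : Summable fun n => ‖c n‖) : Wiener :=
  ⟨PowerSeries.mk c, by
    change Summable fun n => ‖PowerSeries.coeff n (PowerSeries.mk c)‖
    simpa only [PowerSeries.coeff_mk] using hc⟩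

@[simp] lemma co_mk (c : ℕ → ℝ) (hc : Summable fun n => ‖c n‖) (n : ℕ) : (mk c hc).co n = c n := by
  simp [co, mk]

instance : Norm Wiener := ⟨fun f => ∑' n, ‖f.co n‖⟩

lemma norm_def (f : Wiener) : ‖f‖ = ∑' n, ‖f.co n‖ := rfl

lemma norm_co_le (f : Wiener) (n : ℕ) : ‖f.co n‖ ≤ ‖f‖ :=
  f.summable_co.le_tsum n fun _ _ => norm_nonneg _

lemma normCore : NormedSpace.Core ℝ Wiener where
  norm_nonneg f := tsum_nonneg fun _ => norm_nonneg _
  norm_smul c f := by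
    simp only [norm_def, co_smul, norm_mul, tsum_mul_left]
  norm_triangle f g := by
    rw [norm_def, norm_def, norm_def, ← f.summable_co.tsum_add g.summable_co]
    refine (f + g).summable_co.tsum_le_tsum (fun n => ?_) (f.summable_co.add g.summable_co)
    rw [co_add]
    exact norm_add_le _ _
  norm_eq_zero_iff f := by
    refine ⟨fun hf => ext_co fun n => ?_, fun hf => by simp [hf, norm_def]⟩
    have := f.norm_co_le n
    rw [hf] at this
    simpa using norm_le_zero_iff.1 this

instance : NormedAddCommGroup Wiener := NormedAddCommGroup.ofCore normCore

lemma norm_mul_le' (f g : Wiener) : ‖f * g‖ ≤ ‖f‖ * ‖g‖ := by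
  have hs := summable_norm_sum_mul_antidiagonal_of_summable_norm f.summable_co.norm
    g.summable_co.norm
  rw [norm_def, norm_def, norm_def,
    tsum_mul_tsum_eq_tsum_sum_antidiagonal_of_summable_norm f.summable_co.norm g.summable_co.norm]
  refine (f * g).summable_co.tsum_le_tsum (fun n => ?_) hs.of_norm
  rw [co_mul]
  refine (norm_sum_le _ _).trans (Finset.sum_le_sum fun kl _ => ?_)
  rw [norm_mul]

instance : NormedCommRing Wiener :=
  { (inferInstance : NormedAddCommGroup Wiener), (inferInstance : CommRing Wiener) with
    norm_mul_le := norm_mul_le' }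

instance : NormedAlgebra ℝ Wiener where
  norm_smul_le c f := (normCore.norm_smul c f).le

lemma memℓp (f : Wiener) : Memℓp f.co 1 := by
  rw [memℓp_gen_iff (by norm_num)]
  simpa using f.summable_co

/-- The coefficients as an isometric equivalence with `ℓ¹`. -/
def toLp : Wiener ≃ₗᵢ[ℝ] lp (fun _ : ℕ => ℝ) 1 where
  toFun f := ⟨f.co, f.memℓp⟩
  invFun a := mk a (by simpa using (memℓp_gen_iff (by norm_num)).1 a.2)
  left_inv f := by ext n; simp
  right_inv a := by ext n; simp
  map_add' f g := by ext n; exact co_add f g n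
  map_smul' c f := by ext n; exact co_smul c f n
  norm_map' f := by
    rw [lp.norm_eq_tsum_rpow (by norm_num)]
    simp [norm_def]

/-- Completeness is what the implicit function theorem and the inversion of bounded bijections
require. -/
instance : CompleteSpace Wiener :=
  (toLp.toIsometryEquiv.isometry.isUniformInducing.completeSpace_congr
    toLp.surjective).2 inferInstance

/-- The bounded operator multiplying the `n`-th coefficient by `c n`. -/
def diag (c : ℕ → ℝ) (C : ℝ) (hc : ∀ n, ‖c n‖ ≤ C) : Wiener →L[ℝ] Wiener :=
  LinearMap.mkContinuous
    { toFun := fun f => mk (fun n => c n * f.co n) (by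
        refine Summable.of_nonneg_of_le (fun _ => norm_nonneg _) (fun n => ?_)
          (f.summable_co.mul_left C)
        rw [norm_mul]
        exact mul_le_mul_of_nonneg_right (hc n) (norm_nonneg _))
      map_add' := fun f g => by ext n; simp; ring
      map_smul' := fun r f => by ext n; simp; ring }
    C (fun f => by
      rw [norm_def, norm_def, ← tsum_mul_left]
      refine Summable.tsum_le_tsum (fun n => ?_) (summable_co _) (f.summable_co.mul_left C)
      simp only [LinearMap.coe_mk, AddHom.coe_mk, co_mk, norm_mul]
      exact mul_le_mul_of_nonneg_right (hc n) (norm_nonneg _))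

@[simp] lemma co_diag (c : ℕ → ℝ) (C : ℝ) (hc : ∀ n, ‖c n‖ ≤ C) (f : Wiener) (n : ℕ) :
    (diag c C hc f).co n = c n * f.co n := by
  simp [diag]

/-- The sum of the series at `x`. -/
def ev (f : Wiener) (x : ℝ) : ℝ := ∑' n, f.co n * x ^ n

lemma summable_ev (f : Wiener) {x : ℝ} (hx : |x| ≤ 1) : Summable fun n => ‖f.co n * x ^ n‖ := by
  refine Summable.of_nonneg_of_le (fun _ => norm_nonneg _) (fun n => ?_) f.summable_co
  rw [norm_mul, norm_pow, Real.norm_eq_abs x]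
  exact mul_le_of_le_one_right (norm_nonneg _) (pow_le_one₀ (abs_nonneg _) hx)

lemma ev_add (f g : Wiener) {x : ℝ} (hx : |x| ≤ 1) : (f + g).ev x = f.ev x + g.ev x := by
  rw [ev, ev, ev, ← (f.summable_ev hx).of_norm.tsum_add (g.summable_ev hx).of_norm]
  simp [add_mul]

lemma ev_smul (c : ℝ) (f : Wiener) (x : ℝ) : (c • f).ev x = c * f.ev x := by
  simp [ev, ← tsum_mul_left, mul_assoc]

lemma ev_neg (f : Wiener) (x : ℝ) : (-f).ev x = -f.ev x := by
  simpa using ev_smul (-1) f x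

lemma ev_sub (f g : Wiener) {x : ℝ} (hx : |x| ≤ 1) : (f - g).ev x = f.ev x - g.ev x := by
  rw [sub_eq_add_neg, ev_add _ _ hx, ev_neg, sub_eq_add_neg]

lemma ev_mul (f g : Wiener) {x : ℝ} (hx : |x| ≤ 1) : (f * g).ev x = f.ev x * g.ev x := by
  rw [ev, ev, ev, tsum_mul_tsum_eq_tsum_sum_antidiagonal_of_summable_norm (f.summable_ev hx)
    (g.summable_ev hx)]
  refine tsum_congr fun n => ?_
  rw [co_mul, Finset.sum_mul]
  refine Finset.sum_congr rfl fun kl hkl => ?_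
  rw [← Finset.HasAntidiagonal.mem_antidiagonal.1 hkl, pow_add]
  ring

lemma ev_one (x : ℝ) : (1 : Wiener).ev x = 1 := by
  rw [ev, tsum_eq_single 0 fun n hn => by simp [co_one, hn]]
  simp [co_one]

lemma ev_zero_right (f : Wiener) : f.ev 0 = f.co 0 := by
  rw [ev, tsum_eq_single 0 fun n hn => by simp [hn]]
  simp

lemma abs_ev_le (f : Wiener) {x : ℝ} (hx : |x| ≤ 1) : |f.ev x| ≤ ‖f‖ := by
  refine (norm_tsum_le_tsum_norm (f.summable_ev hx)).trans ?_
  refine (f.summable_ev hx).tsum_le_tsum (fun n => ?_) f.summable_co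
  rw [norm_mul, norm_pow, Real.norm_eq_abs x]
  exact mul_le_of_le_one_right (norm_nonneg _) (pow_le_one₀ (abs_nonneg _) hx)

/-- Here `g` plays the role of `x f'`. Its coefficients `n fₙ` are summable because `g` belongs to
the algebra, and they dominate the termwise derivatives on `(-1, 1)`. -/
lemma hasDerivAt_ev {f g : Wiener} (hfg : ∀ n : ℕ, g.co n = n * f.co n) {x : ℝ} (hx : |x| < 1) :
    ∃ d, HasDerivAt f.ev d x ∧ x * d = g.ev x := by
  refine ⟨∑' n : ℕ, f.co n * (n * x ^ (n - 1)), ?_, ?_⟩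
  · refine hasDerivAt_tsum_of_isPreconnected (t := Ioo (-1) 1) (y₀ := 0)
      (g := fun n x => f.co n * x ^ n) (g' := fun n x => f.co n * (n * x ^ (n - 1)))
      g.summable_co isOpen_Ioo isPreconnected_Ioo
      (fun n y _ => (hasDerivAt_pow n y).const_mul _) (fun n y hy => ?_) (by simp)
      (f.summable_ev (by simp)).of_norm (abs_lt.1 hx)
    rw [hfg, norm_mul, norm_mul, norm_mul, norm_pow, mul_comm ‖(n : ℝ)‖, ← mul_assoc]
    have hy1 : ‖y‖ ≤ 1 := abs_le.2 ⟨hy.1.le, hy.2.le⟩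
    have := mul_le_of_le_one_right (mul_nonneg (norm_nonneg (f.co n)) (norm_nonneg (n : ℝ)))
      (pow_le_one₀ (n := n - 1) (norm_nonneg _) hy1)
    linarith [mul_comm ‖(n : ℝ)‖ ‖f.co n‖]
  · rw [ev, ← tsum_mul_left]
    refine tsum_congr fun n => ?_
    rw [hfg]
    rcases n with _ | n
    · simp
    · simp only [Nat.add_sub_cancel]
      ring

lemma hasFPowerSeriesOnBall_ev (f : Wiener) :
    HasFPowerSeriesOnBall f.ev (FormalMultilinearSeries.ofScalars ℝ f.co) 0 1 where
  r_le := by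
    have := (FormalMultilinearSeries.ofScalars ℝ f.co).le_radius_of_summable (r := 1) (by
      simpa [FormalMultilinearSeries.ofScalars_norm] using f.summable_co)
    simpa using this
  r_pos := one_pos
  hasSum {y} hy := by
    have hy' : |y| ≤ 1 := by
      have : ‖y‖₊ < 1 := by simpa [edist_zero_right, enorm] using hy
      exact (NNReal.coe_lt_coe.2 this).le
    simpa [FormalMultilinearSeries.ofScalars_apply_eq, ev, mul_comm] using
      (f.summable_ev hy').of_norm.hasSum

lemma analyticAt_ev (f : Wiener) {x : ℝ} (hx : |x| < 1) : AnalyticAt ℝ f.ev x := by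
  refine f.hasFPowerSeriesOnBall_ev.analyticAt_of_mem ?_
  have : ‖x‖₊ < 1 := NNReal.coe_lt_coe.1 hx
  simpa [edist_zero_right, enorm] using this

end Wiener

/-! ### The autonomous system in the variables `v`, `w`, `m`. -/

section Polynomials

variable {R : Type*} [CommRing R] [Algebra ℝ R]

/-- The logarithmic slope `S = y ρ' / ρ` in terms of `v = S + 3 - (4 - 3γ) w` and `w = 1 / ω`. -/
def slope (γ : ℝ) (v w : R) : R := v + (4 - 3 * γ) • w - 3

/-- The quadratic polynomial in the slope whose roots are the admissible slopes at a sonic point. -/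
def sonicPoly (γ : ℝ) (v w : R) : R :=
  (γ + 1) • slope γ v w ^ 2 + slope γ v w * (8 - (9 - 7 * γ) • w)
    + (3 - (4 - 3 * γ) • w) * (2 - ((γ - 1) * (2 - γ)) • w ^ 2)

/-- The regular part of the equation of `v`. -/
def driftPoly (γ : ℝ) (v w : R) : R :=
  slope γ v w * ((4 - 3 * γ) • w - 1 - (γ - 1) • slope γ v w) - (4 - 3 * γ) • (w * v)

/-- The logarithmic derivative in `log y` of `1 + m = γ ρ ^ (γ - 1) w² / y²`. -/
def machRate (γ : ℝ) (v w : R) : R := (γ + 1) • slope γ v w + 4 - (2 * (4 - 3 * γ)) • w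

end Polynomials

/-- The derivative of `sonicPoly` in `v`. -/
def sonicPolyDeriv (γ v w : ℝ) : ℝ :=
  2 * (γ + 1) * slope γ v w + (8 - (9 - 7 * γ) * w)

/-- A solution, in the variable `τ = log (ys / y)`, of the self-similar system written for
`v = y ρ' / ρ + 3 - (4 - 3γ) w`, `w = 1 / ω` and `m = G / (y ω)²`, issuing at `τ = 0` from the
sonic point with `w = p` along the branch of smaller slope. -/
structure IsSonicCurve (γ p T : ℝ) (v w m : ℝ → ℝ) : Prop where
  analytic_v : AnalyticAt ℝ v 0
  analytic_w : AnalyticAt ℝ w 0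
  analytic_m : AnalyticAt ℝ m 0
  root : sonicPoly γ (v 0) p = 0
  root_lt : sonicPolyDeriv γ (v 0) p < 0
  rate_neg : machRate γ (v 0) p < 0
  w_zero : w 0 = p
  m_zero : m 0 = 0
  m_pos : ∀ τ ∈ Ioo 0 T, 0 < m τ
  deriv_v : ∀ τ ∈ Ioo 0 T,
    HasDerivAt v (sonicPoly γ (v τ) (w τ) / m τ - driftPoly γ (v τ) (w τ)) τ
  deriv_w : ∀ τ ∈ Ioo 0 T, HasDerivAt w (-(w τ * v τ)) τ
  deriv_m : ∀ τ ∈ Ioo 0 T, HasDerivAt m (-((1 + m τ) * machRate γ (v τ) (w τ))) τ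

/-! ### Evaluation, averaging and resolvent operators on the Wiener algebra. -/

namespace Wiener

/-- Evaluation as an algebra homomorphism. -/
def evHom (x : ℝ) (hx : |x| ≤ 1) : Wiener →ₐ[ℝ] ℝ :=
  AlgHom.ofLinearMap
    { toFun := fun f => f.ev x
      map_add' := fun f g => ev_add f g hx
      map_smul' := fun c f => by simp [ev_smul] }
    (ev_one x) (fun f g => ev_mul f g hx)

@[simp] lemma evHom_apply (x : ℝ) (hx : |x| ≤ 1) (f : Wiener) : evHom x hx f = f.ev x := rfl

/-- The series `x`. -/
def X : Wiener := mk (fun n => if n = 1 then 1 else 0)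
  (summable_of_ne_finset_zero (s := {1}) fun n hn => by
    have : n ≠ 1 := by simpa using hn
    simp [this])

lemma ev_X (x : ℝ) : X.ev x = x := by
  rw [ev, tsum_eq_single 1 fun n hn => by simp [X, hn]]
  simp [X]

lemma X_mul_co_zero (f : Wiener) : (X * f).co 0 = 0 := by
  simp [co_mul, X]

lemma X_mul_co_succ (f : Wiener) (n : ℕ) : (X * f).co (n + 1) = f.co n := by
  rw [co_mul, Finset.sum_eq_single (1, n)]
  · simp [X]
  · rintro ⟨k, l⟩ hkl hne
    have hk : k ≠ 1 := by
      rintro rfl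
      have := Finset.HasAntidiagonal.mem_antidiagonal.1 hkl
      apply hne
      simp only [Prod.mk.injEq, true_and]
      simp only at this
      omega
    simp [X, hk]
  · intro hn
    exact absurd (Finset.HasAntidiagonal.mem_antidiagonal.2 (by simp [add_comm])) hn

/-- The averaging operator `f ↦ x⁻¹ ∫₀ˣ f`. -/
def avg : Wiener →L[ℝ] Wiener := diag (fun n => ((n : ℝ) + 1)⁻¹) 1 fun n => by
  rw [norm_inv, Real.norm_of_nonneg (by positivity)]
  exact inv_le_one_of_one_le₀ (by linarith [n.cast_nonneg (α := ℝ)])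

/-- The inverse of `x d/dx - l` for `l < 0`. -/
def resolvent (l : ℝ) (hl : l < 0) : Wiener →L[ℝ] Wiener :=
  diag (fun n => ((n : ℝ) - l)⁻¹) (-l)⁻¹ fun n => by
    have := n.cast_nonneg (α := ℝ)
    rw [norm_inv, Real.norm_of_nonneg (by linarith)]
    exact inv_anti₀ (by linarith) (by linarith)

lemma avg_one : avg 1 = 1 := by
  ext n
  rcases n with _ | n <;> simp [avg, co_one]

/-- `X * avg f` is the primitive of `f` vanishing at `0`, and `n` times the `n`-th coefficient
represents `x d/dx`. -/
lemma euler_X_mul_avg (f : Wiener) (n : ℕ) : n * (X * avg f).co n = (X * f).co n := by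
  rcases n with _ | n
  · simp [X_mul_co_zero]
  · have : (n : ℝ) + 1 ≠ 0 := by positivity
    simp only [X_mul_co_succ, avg, co_diag]
    push_cast
    field_simp

/-- Applying `x d/dx - l` to the fixed point equation turns it into `x f' = g`. The bounded form is
the one to which the implicit function theorem applies. -/
lemma euler_resolvent {l : ℝ} (hl : l < 0) {f g : Wiener} (h : f = resolvent l hl (g - l • f))
    (n : ℕ) : g.co n = n * f.co n := by
  have h1 : f.co n = ((n : ℝ) - l)⁻¹ * (g.co n - l * f.co n) := by
    conv_lhs => rw [h]
    simp only [resolvent, co_diag, co_sub, co_smul]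
  have := n.cast_nonneg (α := ℝ)
  have h2 : (n : ℝ) - l ≠ 0 := by linarith
  field_simp at h1
  linarith

end Wiener

open Wiener

/-! ### Local existence at the sonic point by the implicit function theorem. -/

/-- The power series formulation of the system near a sonic point, in the variable `x` with
`τ = r x`; the fourth unknown is `r x / m`. -/
def sonicMap (γ l : ℝ) (hl : l < 0) (u : (ℝ × ℝ) × Wiener × Wiener × Wiener × Wiener) :
    Wiener × Wiener × Wiener × Wiener :=
  -- The parameters are `u.1 = (r, p)` and the unknowns `(v, w, m, k)`. Vanishing of the components
  -- means: `x v' = k (q - m B)`; `w = p - r ∫ w v`; `m = -r ∫ (1+m) E`; and `k` times the mean of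
  -- `(1+m) E` is `-1`. With `k = r x / m` the singular quotient disappears, and the map is smooth
  -- also at `r = 0`.
  (u.2.1 - resolvent l hl (u.2.2.2.2 * (sonicPoly γ u.2.1 u.2.2.1
      - u.2.2.2.1 * driftPoly γ u.2.1 u.2.2.1) - l • u.2.1),
   u.2.2.1 - u.1.2 • (1 : Wiener) + u.1.1 • (X * avg (u.2.2.1 * u.2.1)),
   u.2.2.2.1 + u.1.1 • (X * avg ((1 + u.2.2.2.1) * machRate γ u.2.1 u.2.2.1)),
   u.2.2.2.2 * avg ((1 + u.2.2.2.1) * machRate γ u.2.1 u.2.2.1) + 1)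

lemma contDiff_sonicMap (γ l : ℝ) (hl : l < 0) : ContDiff ℝ 1 (sonicMap γ l hl) := by
  unfold sonicMap sonicPoly driftPoly machRate slope
  fun_prop

section Derivatives

variable {A : Type*} [NormedCommRing A] [NormedAlgebra ℝ A] {v w : ℝ → A} {v' w' : A} {t : ℝ}

lemma hasDerivAt_slope (γ : ℝ) (hv : HasDerivAt v v' t) (hw : HasDerivAt w w' t) :
    HasDerivAt (fun t => slope γ (v t) (w t)) (v' + (4 - 3 * γ) • w') t :=
  (hv.add (hw.const_smul (4 - 3 * γ))).sub_const 3

lemma hasDerivAt_machRate (γ : ℝ) (hv : HasDerivAt v v' t) (hw : HasDerivAt w w' t) :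
    HasDerivAt (fun t => machRate γ (v t) (w t))
      ((γ + 1) • (v' + (4 - 3 * γ) • w') - (2 * (4 - 3 * γ)) • w') t :=
  (((hasDerivAt_slope γ hv hw).const_smul (γ + 1)).add_const 4).sub
    (hw.const_smul (2 * (4 - 3 * γ)))

lemma hasDerivAt_sonicPoly (γ : ℝ) (hv : HasDerivAt v v' t) (hw : HasDerivAt w w' t) :
    HasDerivAt (fun t => sonicPoly γ (v t) (w t))
      ((γ + 1) • (2 * slope γ (v t) (w t) * (v' + (4 - 3 * γ) • w'))
        + ((v' + (4 - 3 * γ) • w') * (8 - (9 - 7 * γ) • w t)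
          + slope γ (v t) (w t) * -((9 - 7 * γ) • w'))
        + (-((4 - 3 * γ) • w') * (2 - ((γ - 1) * (2 - γ)) • w t ^ 2)
          + (3 - (4 - 3 * γ) • w t) * -(((γ - 1) * (2 - γ)) • (2 * w t * w')))) t := by
  have hS := hasDerivAt_slope γ hv hw
  have h1 := (hS.pow 2).const_smul (γ + 1)
  have h2 := hS.mul ((hw.const_smul (9 - 7 * γ)).const_sub 8)
  have h3 := ((hw.const_smul (4 - 3 * γ)).const_sub 3).mul
    (((hw.pow 2).const_smul ((γ - 1) * (2 - γ))).const_sub 2)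
  convert! (h1.add h2).add h3 using 1
  simp

lemma hasDerivAt_driftPoly (γ : ℝ) (hv : HasDerivAt v v' t) (hw : HasDerivAt w w' t) :
    HasDerivAt (fun t => driftPoly γ (v t) (w t))
      ((v' + (4 - 3 * γ) • w') * ((4 - 3 * γ) • w t - 1 - (γ - 1) • slope γ (v t) (w t))
        + slope γ (v t) (w t) * ((4 - 3 * γ) • w' - (γ - 1) • (v' + (4 - 3 * γ) • w'))
        - (4 - 3 * γ) • (w' * v t + w t * v')) t := by
  have hS := hasDerivAt_slope γ hv hw
  exact (hS.mul (((hw.const_smul (4 - 3 * γ)).sub_const 1).sub (hS.const_smul (γ - 1)))).sub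
    ((hw.mul hv).const_smul (4 - 3 * γ))

end Derivatives

section AlgHom

variable {R R' : Type*} [CommRing R] [Algebra ℝ R] [CommRing R'] [Algebra ℝ R']
  (f : R →ₐ[ℝ] R') (γ : ℝ) (v w : R)

/-- These compatibilities serve two homomorphisms: evaluation of a series at a point, and the
inclusion of the constants into the Wiener algebra. -/
lemma map_slope : f (slope γ v w) = slope γ (f v) (f w) := by
  simp only [slope, map_sub, map_add, map_smul, map_ofNat]

lemma map_sonicPoly : f (sonicPoly γ v w) = sonicPoly γ (f v) (f w) := by
  simp only [sonicPoly, ← map_slope, map_sub, map_add, map_smul, map_ofNat, map_mul, map_pow]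

lemma map_driftPoly : f (driftPoly γ v w) = driftPoly γ (f v) (f w) := by
  simp only [driftPoly, ← map_slope, map_sub, map_smul, map_mul, map_one]

lemma map_machRate : f (machRate γ v w) = machRate γ (f v) (f w) := by
  simp only [machRate, ← map_slope, map_sub, map_add, map_smul, map_ofNat]

end AlgHom

/-- The partial differential of `sonicMap` at the trivial solution. -/
lemma fderiv_sonicMap (γ l : ℝ) (hl : l < 0) {v₀ p₀ : ℝ} (hq : sonicPoly γ v₀ p₀ = 0)
    (hE : machRate γ v₀ p₀ ≠ 0) (hlq : l = -(machRate γ v₀ p₀)⁻¹ * sonicPolyDeriv γ v₀ p₀) :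
    ∃ c₁ c₂ c₃ c₄ : ℝ, ∀ δ : Wiener × Wiener × Wiener × Wiener,
      fderiv ℝ (sonicMap γ l hl)
        ((0, p₀), v₀ • 1, p₀ • 1, 0, (-(machRate γ v₀ p₀)⁻¹) • 1) (0, δ) =
      (δ.1 - resolvent l hl (c₁ • δ.2.1 + c₂ • δ.2.2.1), δ.2.1, δ.2.2.1,
        machRate γ v₀ p₀ • δ.2.2.2 + avg (c₃ • δ.1 + c₄ • δ.2.1 - δ.2.2.1)) := by
  set E := machRate γ v₀ p₀ with hEdef
  set k := -E⁻¹ with hk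
  set S := slope γ v₀ p₀ with hS
  have hkE : k * E = -1 := by rw [hk]; field_simp
  -- The constants are `k ∂_w q`, `-k B`, `k ∂_v E` and `k ∂_w E` at the base point, with `k =
  -- -1/E`.
  refine ⟨k * (sonicPolyDeriv γ v₀ p₀ * (4 - 3 * γ) - (9 - 7 * γ) * S
      - (4 - 3 * γ) * (2 - (γ - 1) * (2 - γ) * p₀ ^ 2)
      - (3 - (4 - 3 * γ) * p₀) * (2 * ((γ - 1) * (2 - γ)) * p₀)),
    -(k * driftPoly γ v₀ p₀), k * (γ + 1), k * ((γ + 1) * (4 - 3 * γ) - 2 * (4 - 3 * γ)), ?_⟩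
  rintro ⟨δv, δw, δm, δk⟩
  -- The differential is read off as a directional derivative along an affine line, where the
  -- one-variable product rules apply.
  set c : ℝ → (ℝ × ℝ) × Wiener × Wiener × Wiener × Wiener := fun t =>
    ((0, p₀), v₀ • 1 + t • δv, p₀ • 1 + t • δw, t • δm, k • 1 + t • δk) with hc
  have hlin : ∀ a d : Wiener, HasDerivAt (fun t : ℝ => a + t • d) d 0 := fun a d => by
    simpa using ((hasDerivAt_id (0 : ℝ)).smul_const d).const_add a
  have hv := hlin (v₀ • 1) δv
  have hw := hlin (p₀ • 1) δw
  have hm : HasDerivAt (fun t : ℝ => t • δm) δm 0 := by simpa using hlin 0 δm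
  have hκ := hlin (k • 1) δk
  have hc0 : c 0 = ((0, p₀), v₀ • 1, p₀ • 1, 0, k • 1) := by simp [hc]
  have hcd : HasDerivAt c (0, δv, δw, δm, δk) 0 :=
    (hasDerivAt_const _ _).prodMk (hv.prodMk (hw.prodMk (hm.prodMk hκ)))
  have hchain : HasDerivAt (fun t => sonicMap γ l hl (c t))
      (fderiv ℝ (sonicMap γ l hl) (c 0) (0, δv, δw, δm, δk)) 0 :=
    (((contDiff_sonicMap γ l hl).differentiable one_ne_zero) (c 0)).hasFDerivAt.comp_hasDerivAt
      (0 : ℝ) hcd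
  rw [hc0] at hchain
  have hQ := hasDerivAt_sonicPoly γ hv hw
  have hB := hasDerivAt_driftPoly γ hv hw
  have hM := hasDerivAt_machRate γ hv hw
  have hg := (hm.const_add 1).mul hM
  have e1 := hv.sub ((resolvent l hl).hasFDerivAt.comp_hasDerivAt (0 : ℝ)
    ((hκ.mul (hQ.sub (hm.mul hB))).sub (hv.const_smul l)))
  have e4 := (hκ.mul ((avg).hasFDerivAt.comp_hasDerivAt (0 : ℝ) hg)).add_const 1
  have e2 : HasDerivAt (fun t => (sonicMap γ l hl (c t)).2.1) δw 0 := by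
    simpa [sonicMap, hc] using hw.sub_const (p₀ • (1 : Wiener))
  have e3 : HasDerivAt (fun t => (sonicMap γ l hl (c t)).2.2.1) δm 0 := by
    simpa [sonicMap, hc] using hm
  have hexp := e1.prodMk (e2.prodMk (e3.prodMk e4))
  rw [hchain.unique hexp]
  have hone : ∀ r : ℝ, r • (1 : Wiener) = Algebra.ofId ℝ Wiener r := fun r =>
    (Algebra.algebraMap_eq_smul_one r).symm
  have hSw : slope γ (v₀ • (1 : Wiener)) (p₀ • 1) = S • 1 := by
    simp only [hone, ← map_slope, ← hS]
  have hQw : sonicPoly γ (v₀ • (1 : Wiener)) (p₀ • 1) = 0 := by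
    rw [hone, hone, ← map_sonicPoly, hq, map_zero]
  have hBw : driftPoly γ (v₀ • (1 : Wiener)) (p₀ • 1) = driftPoly γ v₀ p₀ • 1 := by
    simp only [hone, ← map_driftPoly]
  have hMw : machRate γ (v₀ • (1 : Wiener)) (p₀ • 1) = E • 1 := by
    simp only [hone, ← map_machRate, ← hEdef]
  simp only [zero_smul, add_zero, Pi.sub_apply, Pi.mul_apply, Function.comp_apply, hSw, hQw, hMw,
    hBw]
  refine Prod.ext ?_ (Prod.ext rfl (Prod.ext rfl ?_))
  · simp only [sub_right_inj]
    congr 1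
    -- The choice `l = k q_v` cancels `δv` inside the resolvent, which makes the differential
    -- triangular.
    rw [hlq, sonicPolyDeriv, ← hS]
    simp only [Algebra.smul_def, mul_one, map_sub, map_add, map_mul, map_ofNat, map_one, map_neg,
      map_pow]
    ring
  · have hc : ∀ x : Wiener, (k • (1 : Wiener)) * avg x = avg (k • x) := fun x => by
      rw [map_smul, smul_mul_assoc, one_mul]
    dsimp only
    rw [hc, one_mul, map_smul avg E, avg_one, mul_smul_comm E δk, mul_one δk]
    refine congrArg (fun z => E • δk + avg z) ?_
    have hkE' : algebraMap ℝ Wiener k * algebraMap ℝ Wiener E = -1 := by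
      rw [← map_mul, hkE, map_neg, map_one]
    simp only [Algebra.smul_def, mul_one, map_sub, map_add, map_mul, map_ofNat, map_one]
    linear_combination δm * hkE'

/-- The differential is triangular, with the identity on the diagonal in three slots and the nonzero
scalar `machRate γ v₀ p₀` in the fourth, so it is inverted by back substitution. -/
lemma isInvertible_fderiv_sonicMap (γ l : ℝ) (hl : l < 0) {v₀ p₀ : ℝ}
    (hq : sonicPoly γ v₀ p₀ = 0) (hE : machRate γ v₀ p₀ ≠ 0)
    (hlq : l = -(machRate γ v₀ p₀)⁻¹ * sonicPolyDeriv γ v₀ p₀) :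
    (fderiv ℝ (sonicMap γ l hl) ((0, p₀), v₀ • 1, p₀ • 1, 0, (-(machRate γ v₀ p₀)⁻¹) • 1) ∘L
      .inr ℝ (ℝ × ℝ) (Wiener × Wiener × Wiener × Wiener)).IsInvertible := by
  obtain ⟨c₁, c₂, c₃, c₄, hc⟩ := fderiv_sonicMap γ l hl hq hE hlq
  set D := fderiv ℝ (sonicMap γ l hl) ((0, p₀), v₀ • 1, p₀ • 1, 0, (-(machRate γ v₀ p₀)⁻¹) • 1) ∘L
      .inr ℝ (ℝ × ℝ) (Wiener × Wiener × Wiener × Wiener) with hD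
  have hD' : ∀ δ, D δ = (δ.1 - resolvent l hl (c₁ • δ.2.1 + c₂ • δ.2.2.1), δ.2.1, δ.2.2.1,
        machRate γ v₀ p₀ • δ.2.2.2 + avg (c₃ • δ.1 + c₄ • δ.2.1 - δ.2.2.1)) := fun δ => by
    rw [← hc δ]; rfl
  have hinj : D.ker = ⊥ := by
    refine (Submodule.eq_bot_iff _).2 fun δ hδ => ?_
    obtain ⟨a, b, c, d⟩ := δ
    have h0 : D (a, b, c, d) = 0 := hδ
    rw [hD'] at h0
    simp only [Prod.mk_eq_zero] at h0
    obtain ⟨h1, rfl, rfl, h4⟩ := h0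
    have ha : a = 0 := by simpa using h1
    subst ha
    have hd : d = 0 := by simpa [hE] using h4
    simp [hd]
  have hsurj : D.range = ⊤ := by
    refine LinearMap.range_eq_top.2 fun z => ?_
    obtain ⟨a, b, c, d⟩ := z
    refine ⟨(a + resolvent l hl (c₁ • b + c₂ • c), b, c, (machRate γ v₀ p₀)⁻¹ • (d -
      avg (c₃ • (a + resolvent l hl (c₁ • b + c₂ • c)) + c₄ • b - c))), ?_⟩
    change D _ = _
    rw [hD']
    simp [smul_smul, hE]
  exact ⟨ContinuousLinearEquiv.ofBijective D hinj hsurj, ContinuousLinearMap.ext fun δ => rfl⟩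

open Wiener

lemma resolvent_smul_one {l : ℝ} (hl : l < 0) (c : ℝ) :
    Wiener.resolvent l hl (c • (1 : Wiener)) = (c * (-l)⁻¹) • 1 := by
  ext n
  rcases n with _ | n <;> simp [Wiener.resolvent, co_one, mul_comm]

/-- At `r = 0` the rescaled curve collapses to its initial point; this constant solution is where
the implicit function theorem starts. -/
lemma sonicMap_base (γ l : ℝ) (hl : l < 0) {v₀ p₀ : ℝ} (hq : sonicPoly γ v₀ p₀ = 0)
    (hE : machRate γ v₀ p₀ ≠ 0) :
    sonicMap γ l hl ((0, p₀), v₀ • 1, p₀ • 1, 0, (-(machRate γ v₀ p₀)⁻¹) • 1) = 0 := by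
  have hone : ∀ r : ℝ, r • (1 : Wiener) = Algebra.ofId ℝ Wiener r := fun r =>
    (Algebra.algebraMap_eq_smul_one r).symm
  have hQw : sonicPoly γ (v₀ • (1 : Wiener)) (p₀ • 1) = 0 := by
    rw [hone, hone, ← map_sonicPoly, hq, map_zero]
  have hMw : machRate γ (v₀ • (1 : Wiener)) (p₀ • 1) = machRate γ v₀ p₀ • 1 := by
    simp only [hone, ← map_machRate]
  have hl' : (-l)⁻¹ * l = -1 := by
    have := hl.ne
    field_simp
  simp only [sonicMap, hQw, hMw, zero_mul, mul_zero, zero_sub, add_zero, one_mul,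
    zero_smul, sub_self, Prod.mk_eq_zero, map_smul, avg_one, true_and]
  constructor
  · rw [← neg_smul, smul_smul, resolvent_smul_one, ← sub_smul]
    rw [show v₀ - -l * v₀ * (-l)⁻¹ = v₀ * (1 + (-l)⁻¹ * l) by ring, hl']
    simp
  · rw [smul_mul_smul_comm, one_mul, neg_mul, inv_mul_cancel₀ hE]
    simp

/-- A zero of `sonicMap` with parameter `r > 0` provides a sonic curve on `(0, r)`. -/
lemma isSonicCurve_of_sonicMap_eq_zero {γ l : ℝ} (hl : l < 0) {r p : ℝ} (hr : 0 < r)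
    {v w m k : Wiener} (h0 : sonicMap γ l hl ((r, p), v, w, m, k) = 0)
    (hk : ∀ x, |x| ≤ 1 → 0 < k.ev x) (hqv : sonicPolyDeriv γ (v.ev 0) p < 0)
    (hE : machRate γ (v.ev 0) p < 0) :
    IsSonicCurve γ p r (fun τ => v.ev (τ / r)) (fun τ => w.ev (τ / r)) (fun τ => m.ev (τ / r)) := by
  simp only [sonicMap, Prod.mk_eq_zero] at h0
  obtain ⟨h1, h2, h3, h4⟩ := h0
  have hv := euler_resolvent hl (sub_eq_zero.1 h1)
  have hw : w = p • 1 - r • (X * avg (w * v)) := by linear_combination h2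
  have hm : m = -(r • (X * avg ((1 + m) * machRate γ v w))) := by linear_combination h3
  have hw' : ∀ n : ℕ, (-(r • (X * (w * v)))).co n = n * w.co n := fun n => by
    conv_rhs => rw [hw, co_sub, co_smul, co_smul, co_one, mul_sub, mul_left_comm (n : ℝ) r,
      euler_X_mul_avg]
    rcases n with _ | n <;> simp
  have hm' : ∀ n : ℕ, (-(r • (X * ((1 + m) * machRate γ v w)))).co n = n * m.co n := fun n => by
    conv_rhs => rw [hm, co_neg, co_smul, mul_neg, mul_left_comm (n : ℝ) r, euler_X_mul_avg]
    rw [co_neg, co_smul]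
  -- With `A` the mean of `(1+m) E`, the third component says `m = -r x A` and the fourth `k A =
  -- -1`.
  have hkm : ∀ x, |x| ≤ 1 → k.ev x * m.ev x = r * x := fun x hx => by
    have e4 := congrArg (evHom x hx) h4
    have e3 := congrArg (evHom x hx) h3
    simp only [map_add, map_mul, map_one, map_zero, map_smul, smul_eq_mul] at e4 e3
    simp only [evHom_apply, ev_X] at e4 e3
    linear_combination k.ev x * e3 - r * x * e4
  have hanal : ∀ f : Wiener, AnalyticAt ℝ (fun τ => f.ev (τ / r)) 0 := fun f => by
    have : AnalyticAt ℝ (fun τ : ℝ => τ / r) 0 := analyticAt_id.div_const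
    refine AnalyticAt.comp (g := f.ev) (f := fun τ : ℝ => τ / r) ?_ this
    simpa using f.analyticAt_ev (x := 0) (by simp)
  have hw0 : w.ev 0 = p := by
    rw [hw, ev_sub _ _ (by simp), ev_smul, ev_smul, ev_mul _ _ (by simp), ev_X, ev_one]
    ring
  have hm0 : m.ev 0 = 0 := by
    rw [hm, ev_neg, ev_smul, ev_mul _ _ (by simp), ev_X]
    ring
  have hx : ∀ τ ∈ Ioo 0 r, 0 < τ / r ∧ |τ / r| < 1 := fun τ hτ => by
    have : 0 < τ / r := div_pos hτ.1 hr
    exact ⟨this, by rw [abs_of_pos this]; exact (div_lt_one hr).2 hτ.2⟩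
  have hmpos : ∀ τ ∈ Ioo 0 r, 0 < m.ev (τ / r) := fun τ hτ => by
    have h := hkm (τ / r) (hx τ hτ).2.le
    have h' := hk (τ / r) (hx τ hτ).2.le
    have := mul_pos hr (hx τ hτ).1
    rw [← h] at this
    exact pos_of_mul_pos_right this h'.le
  have hder : ∀ {f g : Wiener}, (∀ n : ℕ, g.co n = n * f.co n) → ∀ τ ∈ Ioo 0 r,
      ∃ d, HasDerivAt (fun τ => f.ev (τ / r)) d τ ∧ τ * d = g.ev (τ / r) := fun {f g} hfg τ hτ => by
    obtain ⟨d, hd, hd'⟩ := hasDerivAt_ev hfg (hx τ hτ).2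
    refine ⟨d * (1 / r), ?_, ?_⟩
    · exact HasDerivAt.comp (h₂ := f.ev) (h := fun τ : ℝ => τ / r) τ hd
        ((hasDerivAt_id τ).div_const r)
    · rw [← hd']; ring
  refine ⟨hanal v, hanal w, hanal m, ?_, by simpa using hqv, by simpa using hE, by simpa using hw0,
    by simpa using hm0, hmpos, fun τ hτ => ?_, fun τ hτ => ?_, fun τ hτ => ?_⟩
  · have e := hv 0
    rw [← ev_zero_right, ← evHom_apply 0 (by simp)] at e
    simp only [map_mul, map_sub, map_sonicPoly, map_driftPoly, evHom_apply, hw0, hm0] at e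
    have := (hk 0 (by simp)).ne'
    simpa [this] using e
  · obtain ⟨d, hd, hd'⟩ := hder hv τ hτ
    convert hd using 1
    have hx' := (hx τ hτ).2.le
    rw [← evHom_apply _ hx'] at hd'
    simp only [map_mul, map_sub, map_sonicPoly, map_driftPoly, evHom_apply] at hd'
    have hkm' := hkm _ hx'
    rw [mul_div_cancel₀ _ hr.ne'] at hkm'
    have hmp := (hmpos τ hτ).ne'
    have hτ0 := hτ.1.ne'
    apply mul_left_cancel₀ hτ0
    rw [hd']
    generalize m.ev (τ / r) = μ at *
    generalize k.ev (τ / r) = κ at *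
    rw [← hkm']
    field_simp
  · obtain ⟨d, hd, hd'⟩ := hder hw' τ hτ
    convert hd using 1
    have hx' := (hx τ hτ).2.le
    apply mul_left_cancel₀ hτ.1.ne'
    rw [hd', ev_neg, ev_smul, ev_mul _ _ hx', ev_mul _ _ hx', ev_X]
    have := hr.ne'
    field_simp
  · obtain ⟨d, hd, hd'⟩ := hder hm' τ hτ
    convert hd using 1
    have hx' := (hx τ hτ).2.le
    apply mul_left_cancel₀ hτ.1.ne'
    rw [← evHom_apply _ hx'] at hd'
    simp only [map_neg, map_smul, map_mul, map_add, map_one, map_machRate, smul_eq_mul] at hd'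
    simp only [evHom_apply, ev_X] at hd'
    rw [hd']
    have := hr.ne'
    field_simp

/-- Local existence of sonic curves, on a common interval and with Lipschitz dependence on the
parameter. -/
theorem exists_sonicCurve_family {γ p₀ v₀ : ℝ} (hq : sonicPoly γ v₀ p₀ = 0)
    (hqv : sonicPolyDeriv γ v₀ p₀ < 0) (hE : machRate γ v₀ p₀ < 0) {ε : ℝ} (hε : 0 < ε) :
    ∃ r > 0, ∃ δ > 0, ∃ C : ℝ, ∃ V W M : ℝ → ℝ → ℝ, ∀ p, |p - p₀| < δ →
      IsSonicCurve γ p r (V p) (W p) (M p) ∧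
      (∀ τ ∈ Ico 0 r, |V p τ - v₀| < ε ∧ |W p τ - p₀| < ε) ∧
      ∀ p', |p' - p₀| < δ → ∀ τ ∈ Ico 0 r, |V p τ - V p' τ| ≤ C * |p - p'| ∧
        |W p τ - W p' τ| ≤ C * |p - p'| ∧ |M p τ - M p' τ| ≤ C * |p - p'| := by
  set E := machRate γ v₀ p₀ with hEdef
  set l := -E⁻¹ * sonicPolyDeriv γ v₀ p₀ with hlq
  have hk₀ : 0 < -E⁻¹ := by simpa using hE
  have hl : l < 0 := mul_neg_of_pos_of_neg hk₀ hqv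
  set u₀ : Wiener × Wiener × Wiener × Wiener := (v₀ • 1, p₀ • 1, 0, (-E⁻¹) • 1) with hu₀
  have hstrict := ((contDiff_sonicMap γ l hl).contDiffAt (x := ((0, p₀), u₀))).hasStrictFDerivAt
    one_ne_zero
  have hinv := isInvertible_fderiv_sonicMap γ l hl hq hE.ne hlq
  set ψ := hstrict.implicitFunctionOfProdDomain hinv with hψ
  have hbase : sonicMap γ l hl ((0, p₀), u₀) = 0 := sonicMap_base γ l hl hq hE.ne
  have ev1 := hstrict.eventually_apply_implicitFunctionOfProdDomain hinv
  have ev2 := hstrict.tendsto_implicitFunctionOfProdDomain hinv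
  -- Strict differentiability of the implicit function provides the Lipschitz constant in `p`.
  obtain ⟨K, U, hU, hLip⟩ :=
    (hstrict.hasStrictFDerivAt_implicitFunctionOfProdDomain hinv).exists_lipschitzOnWith
  simp only [← hψ, hbase] at ev1 ev2 hLip hU
  have hopen : IsOpen {z : ℝ × ℝ | sonicPolyDeriv γ z.1 z.2 < 0 ∧ machRate γ z.1 z.2 < 0} := by
    have h1 : Continuous fun z : ℝ × ℝ => sonicPolyDeriv γ z.1 z.2 := by
      unfold sonicPolyDeriv slope; fun_prop
    have h2 : Continuous fun z : ℝ × ℝ => machRate γ z.1 z.2 := by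
      unfold machRate slope; fun_prop
    exact (isOpen_lt h1 continuous_const).inter (isOpen_lt h2 continuous_const)
  obtain ⟨ε₁, hε₁, hball⟩ := Metric.isOpen_iff.1 hopen (v₀, p₀) ⟨hqv, hE⟩
  set η := min ε (min ε₁ (-E⁻¹)) with hη
  have hηpos : 0 < η := lt_min hε (lt_min hε₁ hk₀)
  obtain ⟨d, hd, hdU⟩ := Metric.eventually_nhds_iff_ball.1
    ((ev1.and (ev2.eventually (Metric.ball_mem_nhds _ hηpos))).and hU)
  -- Fixing the positive first parameter `d / 2` for every nearby `p` gives all the curves the same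
  -- interval of existence.
  have hmem : ∀ p, |p - p₀| < min d ε₁ → ((d / 2, p) : ℝ × ℝ) ∈ Metric.ball ((0 : ℝ), p₀) d := by
    intro p hp
    rw [Metric.mem_ball, Prod.dist_eq, max_lt_iff, Real.dist_eq, Real.dist_eq]
    refine ⟨?_, hp.trans_le (min_le_left _ _)⟩
    rw [sub_zero, abs_of_pos (half_pos hd)]
    exact half_lt_self hd
  refine ⟨d / 2, half_pos hd, min d ε₁, lt_min hd hε₁, K,
    fun p τ => (ψ (d / 2, p)).1.ev (τ / (d / 2)),
    fun p τ => (ψ (d / 2, p)).2.1.ev (τ / (d / 2)),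
    fun p τ => (ψ (d / 2, p)).2.2.1.ev (τ / (d / 2)), fun p hp => ?_⟩
  obtain ⟨⟨hz, hnear⟩, hpU⟩ := hdU _ (hmem p hp)
  have hnorm : ‖ψ (d / 2, p) - u₀‖ < η := by rwa [← dist_eq_norm]
  have hxle : ∀ τ ∈ Ico 0 (d / 2), |τ / (d / 2)| ≤ 1 := fun τ hτ => by
    rw [abs_of_nonneg (div_nonneg hτ.1 (half_pos hd).le)]
    exact (div_le_one (half_pos hd)).2 hτ.2.le
  have hclose : ∀ (f : Wiener) (c x : ℝ), |x| ≤ 1 → ‖f - c • 1‖ < η → |f.ev x - c| < η := by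
    intro f c x hx hf
    have := (f - c • 1).abs_ev_le hx
    rw [ev_sub _ _ hx, ev_smul, ev_one, mul_one] at this
    exact this.trans_lt hf
  have n1 : ‖(ψ (d / 2, p)).1 - v₀ • 1‖ < η := (norm_fst_le (ψ (d / 2, p) - u₀)).trans_lt hnorm
  have n2' := (norm_snd_le (ψ (d / 2, p) - u₀)).trans_lt hnorm
  have n2 : ‖(ψ (d / 2, p)).2.1 - p₀ • 1‖ < η := (norm_fst_le (ψ (d / 2, p) - u₀).2).trans_lt n2'
  have n3' := (norm_snd_le (ψ (d / 2, p) - u₀).2).trans_lt n2'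
  have n4 : ‖(ψ (d / 2, p)).2.2.2 - (-E⁻¹) • 1‖ < η :=
    (norm_snd_le (ψ (d / 2, p) - u₀).2.2).trans_lt n3'
  have hneg : ((ψ (d / 2, p)).1.ev 0, p) ∈
      {z : ℝ × ℝ | sonicPolyDeriv γ z.1 z.2 < 0 ∧ machRate γ z.1 z.2 < 0} := by
    apply hball
    rw [Metric.mem_ball, Prod.dist_eq, max_lt_iff, Real.dist_eq, Real.dist_eq]
    exact ⟨(hclose _ _ 0 (by simp) n1).trans_le ((min_le_right _ _).trans (min_le_left _ _)),
      hp.trans_le (min_le_right _ _)⟩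
  refine ⟨isSonicCurve_of_sonicMap_eq_zero hl (half_pos hd) hz (fun x hx => ?_) hneg.1 hneg.2,
    fun τ hτ => ⟨?_, ?_⟩, fun p' hp' τ hτ => ?_⟩
  · have := abs_lt.1 ((hclose _ _ x hx n4).trans_le ((min_le_right _ _).trans (min_le_right _ _)))
    exact (by linarith [this.1] : 0 < (ψ (d / 2, p)).2.2.2.ev x)
  · exact (hclose _ _ _ (hxle τ hτ) n1).trans_le (min_le_left _ _)
  · exact (hclose _ _ _ (hxle τ hτ) n2).trans_le (min_le_left _ _)
  · have hL := hLip.dist_le_mul _ hpU _ (hdU _ (hmem p' hp')).2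
    rw [dist_eq_norm, Prod.dist_eq, dist_self, max_eq_right dist_nonneg, Real.dist_eq] at hL
    have hdiff : ∀ f g : Wiener, ‖f - g‖ ≤ K * |p - p'| →
        |f.ev (τ / (d / 2)) - g.ev (τ / (d / 2))| ≤ K * |p - p'| := fun f g hfg => by
      rw [← ev_sub _ _ (hxle τ hτ)]
      exact ((f - g).abs_ev_le (hxle τ hτ)).trans hfg
    set D := ψ (d / 2, p) - ψ (d / 2, p') with hD
    have hD2 := (norm_snd_le D).trans hL
    have hD3 := (norm_snd_le D.2).trans hD2
    exact ⟨hdiff _ _ ((norm_fst_le D).trans hL), hdiff _ _ ((norm_fst_le D.2).trans hD2),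
      hdiff _ _ ((norm_fst_le D.2.2).trans hD3)⟩

/-! ### Uniqueness of curves issuing from a sonic point. -/

/-- A function on `(0, η)` tending to `0` at `0` and obeying `e' ≤ L e` is nonpositive. -/
lemma nonpos_of_deriv_le_mul {e e' : ℝ → ℝ} {L η : ℝ}
    (hd : ∀ τ ∈ Ioo 0 η, HasDerivAt e (e' τ) τ) (hle : ∀ τ ∈ Ioo 0 η, e' τ ≤ L * e τ)
    (h0 : Tendsto e (𝓝[>] 0) (𝓝 0)) : ∀ τ ∈ Ioo 0 η, e τ ≤ 0 := by
  intro τ hτ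
  have hder : ∀ t ∈ Ioo 0 η, HasDerivAt (fun t => e t * Real.exp (-L * t))
      (e' t * Real.exp (-L * t) + e t * (Real.exp (-L * t) * -L)) t := fun t ht => by
    have := ((hasDerivAt_id t).const_mul (-L)).exp
    simp only [id, mul_one] at this
    exact (hd t ht).mul this
  have hanti : AntitoneOn (fun t => e t * Real.exp (-L * t)) (Ioo 0 η) := by
    refine antitoneOn_of_deriv_nonpos (convex_Ioo 0 η)
      (fun t ht => (hder t ht).continuousAt.continuousWithinAt)
      (fun t ht => (hder t (interior_subset ht)).differentiableAt.differentiableWithinAt)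
      (fun t ht => ?_)
    have ht' := interior_subset ht
    rw [(hder t ht').deriv]
    nlinarith [hle t ht', Real.exp_pos (-L * t)]
  have hlim : Tendsto (fun t => e t * Real.exp (-L * t)) (𝓝[>] 0) (𝓝 0) := by
    have h1 : Tendsto (fun t : ℝ => Real.exp (-L * t)) (𝓝[>] 0) (𝓝 (Real.exp (-L * 0))) :=
      ((by fun_prop : Continuous fun t : ℝ => Real.exp (-L * t)).tendsto 0).mono_left
        nhdsWithin_le_nhds
    simpa using h0.mul h1
  have hev : ∀ᶠ t in 𝓝[>] (0 : ℝ), e τ * Real.exp (-L * τ) ≤ e t * Real.exp (-L * t) := by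
    filter_upwards [Ioo_mem_nhdsGT hτ.1] with t ht
    exact hanti ⟨ht.1, ht.2.trans hτ.2⟩ hτ ht.2.le
  exact nonpos_of_mul_nonpos_left (ge_of_tendsto hlim hev) (Real.exp_pos _)

/-- Uniqueness for a linear system with a singular, strictly damped first equation. -/
lemma eq_zero_of_singular_damping {s u d s' u' d' A B₁ B₂ m : ℝ → ℝ} {c μ C η : ℝ}
    (hc : 0 < c) (hμ : 0 < μ) (hC : 0 ≤ C)
    (hs : ∀ τ ∈ Ioo 0 η, HasDerivAt s (s' τ) τ) (hu : ∀ τ ∈ Ioo 0 η, HasDerivAt u (u' τ) τ)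
    (hd : ∀ τ ∈ Ioo 0 η, HasDerivAt d (d' τ) τ)
    (hm : ∀ τ ∈ Ioo 0 η, c * τ ≤ m τ)
    (hse : ∀ τ ∈ Ioo 0 η, m τ * s' τ = A τ * s τ + B₁ τ * u τ + B₂ τ * d τ)
    (hA : ∀ τ ∈ Ioo 0 η, A τ ≤ -μ) (hB₁ : ∀ τ ∈ Ioo 0 η, |B₁ τ| ≤ C)
    (hB₂ : ∀ τ ∈ Ioo 0 η, |B₂ τ| ≤ C)
    (hu' : ∀ τ ∈ Ioo 0 η, |u' τ| ≤ C * (|s τ| + |u τ| + |d τ|))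
    (hd' : ∀ τ ∈ Ioo 0 η, |d' τ| ≤ C * (|s τ| + |u τ| + |d τ|))
    (hs0 : Tendsto s (𝓝[>] 0) (𝓝 0))
    (hg0 : Tendsto (fun τ => (u τ ^ 2 + d τ ^ 2) / τ) (𝓝[>] 0) (𝓝 0)) :
    ∀ τ ∈ Ioo 0 η, s τ = 0 ∧ u τ = 0 ∧ d τ = 0 := by
  set K := C ^ 2 / (2 * μ * c) with hK
  have hK0 : 0 ≤ K := by positivity
  -- Damping controls `s s'` only by a multiple of `(u² + d²)/τ`, since `m ≥ c τ`. This dictates the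
  -- weight `1/τ`, whose own derivative contributes the useful term `-(u² + d²)/τ²`.
  have key : ∀ τ ∈ Ioo 0 η, s τ ^ 2 + (u τ ^ 2 + d τ ^ 2) / τ ≤ 0 := by
    refine nonpos_of_deriv_le_mul (L := 2 * K + 4 * C + 2 * C ^ 2)
      (e' := fun τ => 2 * s τ * s' τ + ((2 * u τ * u' τ + 2 * d τ * d' τ) * τ
        - (u τ ^ 2 + d τ ^ 2) * 1) / τ ^ 2) (fun τ hτ => ?_) (fun τ hτ => ?_) ?_
    · have h1 := (hs τ hτ).pow 2
      have h2 := (((hu τ hτ).pow 2).add ((hd τ hτ).pow 2)).div (hasDerivAt_id τ) hτ.1.ne'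
      convert! h1.add h2 using 1
      simp
    · have hτ0 := hτ.1
      set X := |u τ| + |d τ| with hX
      set g := u τ ^ 2 + d τ ^ 2 with hg
      have hXg : X ^ 2 ≤ 2 * g := by
        rw [hX, hg, ← sq_abs (u τ), ← sq_abs (d τ)]
        nlinarith [sq_nonneg (|u τ| - |d τ|)]
      have hX0 : 0 ≤ X := by positivity
      have hg0 : 0 ≤ g := by positivity
      -- the damped component
      have hms : m τ * (s τ * s' τ) ≤ C ^ 2 / (2 * μ) * g := by
        have e1 : m τ * (s τ * s' τ) = A τ * s τ ^ 2 + s τ * (B₁ τ * u τ + B₂ τ * d τ) := by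
          linear_combination s τ * hse τ hτ
        have e2 : |B₁ τ * u τ + B₂ τ * d τ| ≤ C * X := by
          refine (abs_add_le _ _).trans ?_
          rw [abs_mul, abs_mul, hX, mul_add]
          gcongr
          · exact hB₁ τ hτ
          · exact hB₂ τ hτ
        have e3 : s τ * (B₁ τ * u τ + B₂ τ * d τ) ≤ |s τ| * (C * X) :=
          (le_abs_self _).trans (by rw [abs_mul]; gcongr)
        have e4 : A τ * s τ ^ 2 ≤ -μ * |s τ| ^ 2 := by
          rw [sq_abs]; exact mul_le_mul_of_nonneg_right (hA τ hτ) (sq_nonneg _)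
        have e5 : |s τ| * (C * X) ≤ μ * |s τ| ^ 2 + C ^ 2 * X ^ 2 / (4 * μ) := by
          have : μ * |s τ| ^ 2 + C ^ 2 * X ^ 2 / (4 * μ) - |s τ| * (C * X)
              = (2 * μ * |s τ| - C * X) ^ 2 / (4 * μ) := by field_simp; ring
          have h' : 0 ≤ (2 * μ * |s τ| - C * X) ^ 2 / (4 * μ) := by positivity
          linarith
        have e6 : C ^ 2 * X ^ 2 / (4 * μ) ≤ C ^ 2 / (2 * μ) * g := by
          rw [div_mul_eq_mul_div, div_le_div_iff₀ (by positivity) (by positivity)]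
          have : C ^ 2 * X ^ 2 ≤ C ^ 2 * (2 * g) := by gcongr
          nlinarith
        linarith
      have hss : s τ * s' τ ≤ K * (g / τ) := by
        have hmτ := hm τ hτ
        have hcτ : 0 < c * τ := mul_pos hc hτ0
        by_cases hneg : s τ * s' τ ≤ 0
        · exact hneg.trans (by positivity)
        · have : c * τ * (s τ * s' τ) ≤ C ^ 2 / (2 * μ) * g :=
            (mul_le_mul_of_nonneg_right hmτ (not_le.1 hneg).le).trans hms
          rw [← le_div_iff₀' hcτ] at this
          refine this.trans (le_of_eq ?_)
          rw [hK]; field_simp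
      have hud : u τ * u' τ + d τ * d' τ ≤ X * (C * (|s τ| + X)) := by
        have a1 : u τ * u' τ ≤ |u τ| * (C * (|s τ| + X)) := by
          refine (le_abs_self _).trans ?_
          rw [abs_mul]
          gcongr
          have := hu' τ hτ
          rwa [add_assoc] at this
        have a2 : d τ * d' τ ≤ |d τ| * (C * (|s τ| + X)) := by
          refine (le_abs_self _).trans ?_
          rw [abs_mul]
          gcongr
          have := hd' τ hτ
          rwa [add_assoc] at this
        rw [hX, add_mul, ← hX]
        linarith
      -- Young's inequality is tuned so that `g / τ ^ 2` appears with coefficient one, the amount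
      -- absorbed by the derivative of the weight.
      have hcross : 2 * (X * (C * (|s τ| + X))) / τ ≤ g / τ ^ 2 + 2 * C ^ 2 * s τ ^ 2
          + 4 * C * (g / τ) := by
        have b1 : 2 * C * |s τ| * (X / τ) ≤ (X / τ) ^ 2 / 2 + 2 * C ^ 2 * s τ ^ 2 := by
          rw [← sq_abs (s τ)]
          nlinarith [sq_nonneg (X / τ - 2 * C * |s τ|)]
        have b2 : (X / τ) ^ 2 / 2 ≤ g / τ ^ 2 := by
          rw [div_pow, div_div, div_le_div_iff₀ (by positivity) (by positivity)]
          nlinarith [sq_nonneg τ]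
        have b3 : 2 * C * (X ^ 2 / τ) ≤ 4 * C * (g / τ) := by
          have : X ^ 2 / τ ≤ 2 * g / τ := by gcongr
          have := mul_le_mul_of_nonneg_left this (by positivity : 0 ≤ 2 * C)
          refine this.trans (le_of_eq ?_)
          ring
        have : 2 * (X * (C * (|s τ| + X))) / τ = 2 * C * |s τ| * (X / τ) + 2 * C * (X ^ 2 / τ) := by
          ring
        linarith
      have hfin : ((2 * u τ * u' τ + 2 * d τ * d' τ) * τ - g * 1) / τ ^ 2
          = 2 * (u τ * u' τ + d τ * d' τ) / τ - g / τ ^ 2 := by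
        field_simp
      have hdiv : 2 * (u τ * u' τ + d τ * d' τ) / τ ≤ 2 * (X * (C * (|s τ| + X))) / τ := by
        gcongr
      have hgτ : 0 ≤ g / τ := by positivity
      rw [hfin]
      nlinarith [mul_nonneg hC (sq_nonneg (s τ)), mul_nonneg hK0 (sq_nonneg (s τ)),
        mul_nonneg (sq_nonneg C) hgτ]
    · simpa using (hs0.pow 2).add hg0
  intro τ hτ
  have h := key τ hτ
  have h1 : 0 ≤ (u τ ^ 2 + d τ ^ 2) / τ := div_nonneg (by positivity) hτ.1.le
  have h2 : s τ ^ 2 = 0 := le_antisymm (by linarith) (sq_nonneg _)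
  have h3 : (u τ ^ 2 + d τ ^ 2) / τ = 0 := le_antisymm (by nlinarith [sq_nonneg (s τ)]) h1
  rw [div_eq_zero_iff, or_iff_left hτ.1.ne'] at h3
  exact ⟨pow_eq_zero_iff two_ne_zero |>.1 h2,
    pow_eq_zero_iff two_ne_zero |>.1 (by nlinarith [sq_nonneg (u τ), sq_nonneg (d τ)]),
    pow_eq_zero_iff two_ne_zero |>.1 (by nlinarith [sq_nonneg (u τ), sq_nonneg (d τ)])⟩

/-- Uniqueness for an ordinary differential equation whose field is locally Lipschitz along one
of the solutions. -/
lemma eqOn_Ioo_of_locally_lipschitz {E : Type*} [NormedAddCommGroup E] [NormedSpace ℝ E]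
    {F : ℝ → E → E} {f g : ℝ → E} {a b t₀ : ℝ} (ht₀ : t₀ ∈ Ioo a b)
    (hf : ∀ t ∈ Ioo a b, HasDerivAt f (F t (f t)) t)
    (hg : ∀ t ∈ Ioo a b, HasDerivAt g (F t (g t)) t)
    (hF : ∀ t ∈ Ioo a b, ∃ K, ∃ U ∈ 𝓝 (f t), ∀ᶠ t' in 𝓝 t, LipschitzOnWith K (F t') U)
    (h0 : f t₀ = g t₀) : EqOn f g (Ioo a b) := by
  have hloc : ∀ t ∈ Ioo a b, f t = g t → f =ᶠ[𝓝 t] g := fun t ht hfg => by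
    obtain ⟨K, U, hU, hK⟩ := hF t ht
    have hI := Ioo_mem_nhds ht.1 ht.2
    refine ODE_solution_unique_of_eventually (s := fun _ => U) hK ?_ ?_ hfg
    · filter_upwards [hI, (hf t ht).continuousAt.eventually_mem hU] with t' h1 h2
      exact ⟨hf t' h1, h2⟩
    · filter_upwards [hI, (hg t ht).continuousAt.eventually_mem (hfg ▸ hU)] with t' h1 h2
      exact ⟨hg t' h1, h2⟩
  -- The set of local agreement is open and relatively closed in the interval, hence everything by
  -- connectedness.
  have hsub : Ioo a b ⊆ {t | f =ᶠ[𝓝 t] g} := by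
    refine isPreconnected_Ioo.subset_of_closure_inter_subset isOpen_setOfPred_eventually_nhds
      ⟨t₀, ht₀, hloc t₀ ht₀ h0⟩ ?_
    rintro t ⟨htc, ht⟩
    refine hloc t ht ?_
    have hcont : ContinuousAt (fun t => f t - g t) t :=
      (hf t ht).continuousAt.sub (hg t ht).continuousAt
    have : f t - g t ∈ closure ({0} : Set E) := by
      refine mem_closure_of_frequently_of_tendsto ?_ hcont.tendsto
      refine (mem_closure_iff_frequently.1 htc).mono fun x hx => ?_
      have : f x = g x := Filter.EventuallyEq.eq_of_nhds hx
      simp [this]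
    rw [closure_singleton] at this
    exact sub_eq_zero.1 this
  exact fun t ht => Filter.EventuallyEq.eq_of_nhds (hsub ht)

lemma eventually_abs_le_add_one {f : ℝ → ℝ} {x : ℝ} (hf : ContinuousAt f x) :
    ∀ᶠ t in 𝓝 x, |f t| ≤ |f x| + 1 :=
  (hf.abs.eventually_lt_const (lt_add_one |f x|)).mono fun _ => le_of_lt

/-- The vector field of the system for `(v, w, m)`. -/
def sonicField (γ : ℝ) (x : ℝ × ℝ × ℝ) : ℝ × ℝ × ℝ :=
  (sonicPoly γ x.1 x.2.1 / x.2.2 - driftPoly γ x.1 x.2.1, -(x.2.1 * x.1),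
    -((1 + x.2.2) * machRate γ x.1 x.2.1))

lemma contDiffAt_sonicField (γ : ℝ) {x : ℝ × ℝ × ℝ} (hx : x.2.2 ≠ 0) :
    ContDiffAt ℝ 2 (sonicField γ) x := by
  unfold sonicField sonicPoly driftPoly machRate slope
  fun_prop (disch := assumption)

/-- A root of the sonic polynomial on the decreasing branch is unique. -/
lemma sonicPoly_root_unique {γ p v₁ v₂ : ℝ} (h₁ : sonicPoly γ v₁ p = 0) (h₂ : sonicPoly γ v₂ p = 0)
    (d₁ : sonicPolyDeriv γ v₁ p < 0) (d₂ : sonicPolyDeriv γ v₂ p < 0) : v₁ = v₂ := by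
  have h : (v₁ - v₂) * (sonicPolyDeriv γ v₁ p + sonicPolyDeriv γ v₂ p) = 0 := by
    simp only [sonicPoly, sonicPolyDeriv, slope, smul_eq_mul] at *
    linear_combination 2 * h₁ - 2 * h₂
  rcases mul_eq_zero.1 h with h | h
  · exact sub_eq_zero.1 h
  · linarith

namespace IsSonicCurve

variable {γ p T : ℝ} {v w m : ℝ → ℝ}

lemma mono {T' : ℝ} (h : IsSonicCurve γ p T v w m) (hT : T' ≤ T) : IsSonicCurve γ p T' v w m :=
  { h with
    m_pos := fun τ hτ => h.m_pos τ ⟨hτ.1, hτ.2.trans_le hT⟩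
    deriv_v := fun τ hτ => h.deriv_v τ ⟨hτ.1, hτ.2.trans_le hT⟩
    deriv_w := fun τ hτ => h.deriv_w τ ⟨hτ.1, hτ.2.trans_le hT⟩
    deriv_m := fun τ hτ => h.deriv_m τ ⟨hτ.1, hτ.2.trans_le hT⟩ }

lemma hasDerivAt (h : IsSonicCurve γ p T v w m) {τ : ℝ} (hτ : τ ∈ Ioo 0 T) :
    HasDerivAt (fun τ => (v τ, w τ, m τ)) (sonicField γ (v τ, w τ, m τ)) τ :=
  (h.deriv_v τ hτ).prodMk ((h.deriv_w τ hτ).prodMk (h.deriv_m τ hτ))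

/-- At the sonic point `ṁ = -E > 0`, so `m` grows at least at half this rate nearby. -/
lemma exists_le_m (h : IsSonicCurve γ p T v w m) (hT : 0 < T) :
    ∃ c > 0, ∀ᶠ τ in 𝓝[>] 0, c * τ ≤ m τ := by
  have hv := h.analytic_v.continuousAt
  have hw := h.analytic_w.continuousAt
  have hm := h.analytic_m.continuousAt
  have hcont : ContinuousAt (fun τ => -((1 + m τ) * machRate γ (v τ) (w τ))) 0 := by
    unfold machRate slope; fun_prop
  set c := -machRate γ (v 0) p / 2 with hc
  have hcpos : 0 < c := by have := h.rate_neg; linarith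
  have hlim : c < -((1 + m 0) * machRate γ (v 0) (w 0)) := by
    rw [h.m_zero, h.w_zero]; linarith
  obtain ⟨η, hη, hηs⟩ := mem_nhdsGT_iff_exists_Ioo_subset.1
    (inter_mem (Ioo_mem_nhdsGT hT)
      (nhdsWithin_le_nhds (hcont.eventually_const_lt hlim)))
  obtain ⟨r, hr, hrs⟩ := Metric.eventually_nhds_iff_ball.1 h.analytic_m.eventually_analyticAt
  refine ⟨c, hcpos, ?_⟩
  filter_upwards [Ioo_mem_nhdsGT (lt_min (show (0 : ℝ) < η from hη) hr)] with τ hτ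
  have hτη : τ < η := hτ.2.trans_le (min_le_left _ _)
  have hτr : τ < r := hτ.2.trans_le (min_le_right _ _)
  have hmono : MonotoneOn (fun t => m t - c * t) (Icc 0 τ) := by
    refine monotoneOn_of_deriv_nonneg (convex_Icc 0 τ) (fun t ht => ?_) (fun t ht => ?_)
      (fun t ht => ?_)
    · have : t ∈ Metric.ball (0 : ℝ) r := by
        rw [Metric.mem_ball, Real.dist_eq, sub_zero, abs_of_nonneg ht.1]
        exact ht.2.trans_lt hτr
      exact ((hrs t this).continuousAt.sub (by fun_prop)).continuousWithinAt
    · rw [interior_Icc] at ht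
      have hd := (h.deriv_m t (hηs ⟨ht.1, ht.2.trans hτη⟩).1).sub ((hasDerivAt_id t).const_mul c)
      exact hd.differentiableAt.differentiableWithinAt
    · rw [interior_Icc] at ht
      obtain ⟨h1, h2⟩ := hηs ⟨ht.1, ht.2.trans hτη⟩
      have hd := (h.deriv_m t h1).sub ((hasDerivAt_id t).const_mul c)
      have hd' : deriv (fun t => m t - c * t) t = _ := hd.deriv
      rw [hd']
      have h2' : c < -((1 + m t) * machRate γ (v t) (w t)) := h2
      linarith
  have := hmono ⟨le_rfl, hτ.1.le⟩ ⟨hτ.1.le, le_rfl⟩ hτ.1.le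
  simp only [h.m_zero] at this
  linarith

/-- The difference of two curves solves a linear system whose first equation is singular, with
damping coefficient tending to `q_v < 0`. Both curves start at the same root because the branch `q_v
< 0` contains only one. -/
lemma eventually_eq {T' : ℝ} {v' w' m' : ℝ → ℝ} (h : IsSonicCurve γ p T v w m)
    (h' : IsSonicCurve γ p T' v' w' m') (hT : 0 < T) (hT' : 0 < T') :
    ∀ᶠ τ in 𝓝[>] 0, v τ = v' τ ∧ w τ = w' τ ∧ m τ = m' τ := by
  obtain ⟨c, hc, hcm⟩ := h.exists_le_m hT
  have hv := h.analytic_v.continuousAt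
  have hw := h.analytic_w.continuousAt
  have hm := h.analytic_m.continuousAt
  have hv' := h'.analytic_v.continuousAt
  have hw' := h'.analytic_w.continuousAt
  have hm' := h'.analytic_m.continuousAt
  have hdv' : ContinuousAt (deriv v') 0 := h'.analytic_v.deriv.continuousAt
  have hv0 : v 0 = v' 0 := sonicPoly_root_unique h.root h'.root h.root_lt h'.root_lt
  set a := 4 - 3 * γ with ha
  set k := 9 - 7 * γ with hk
  set b := (γ - 1) * (2 - γ) with hb
  -- `A` and `B₁` are the divided differences of `q - m B` in `v` and in `w`. `B₂` collects the
  -- factor of `m - m'`, obtained by replacing `q(v', w')` by `m' (deriv v' + B(v', w'))`.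
  set A : ℝ → ℝ := fun τ => (γ + 1) * (slope γ (v τ) (w τ) + slope γ (v' τ) (w τ))
    + (8 - k * w τ) - m τ * ((a * w τ - 1) - (γ - 1) * (slope γ (v τ) (w τ) + slope γ (v' τ) (w τ))
      - a * w τ) with hA
  set B₁ : ℝ → ℝ := fun τ => (γ + 1) * a * (slope γ (v' τ) (w τ) + slope γ (v' τ) (w' τ))
    + a * (8 - k * w τ) - k * slope γ (v' τ) (w' τ) - a * (2 - b * w τ ^ 2)
    - (3 - a * w' τ) * b * (w τ + w' τ)
    - m τ * (a * (a * w τ - 1) + a * slope γ (v' τ) (w' τ)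
      - (γ - 1) * a * (slope γ (v' τ) (w τ) + slope γ (v' τ) (w' τ)) - a * v' τ) with hB₁
  set B₂ : ℝ → ℝ := fun τ => -driftPoly γ (v' τ) (w' τ) - deriv v' τ with hB₂
  have hAc : ContinuousAt A 0 := by
    rw [hA]; unfold slope; fun_prop
  have hB₁c : ContinuousAt B₁ 0 := by
    rw [hB₁]; unfold slope; fun_prop
  have hB₂c : ContinuousAt B₂ 0 := by
    rw [hB₂]; unfold driftPoly slope; fun_prop
  have hEc : ContinuousAt (fun τ => machRate γ (v τ) (w τ)) 0 := by
    unfold machRate slope; fun_prop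
  have hA0 : A 0 = sonicPolyDeriv γ (v 0) p := by
    simp only [hA, h.m_zero, h.w_zero, ← hv0, sonicPolyDeriv]
    ring
  set μ := -sonicPolyDeriv γ (v 0) p / 2 with hμ
  have hμpos : 0 < μ := by have := h.root_lt; linarith
  set C := (|B₁ 0| + 1) + (|B₂ 0| + 1) + (|w 0| + 1) + (|v' 0| + 1) + (|machRate γ (v 0) (w 0)| + 1)
    + (|m' 0| + 2) * (|γ + 1| + |(γ - 1) * a|) with hC
  have hC0 : 0 ≤ C := by positivity
  have hAlt : A 0 < -μ := by rw [hA0]; have := h.root_lt; linarith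
  have hev : ∀ᶠ τ in 𝓝[>] (0 : ℝ), τ ∈ Ioo 0 (min T T') ∧ c * τ ≤ m τ ∧ A τ ≤ -μ ∧
      |B₁ τ| ≤ |B₁ 0| + 1 ∧ |B₂ τ| ≤ |B₂ 0| + 1 ∧ |w τ| ≤ |w 0| + 1 ∧ |v' τ| ≤ |v' 0| + 1 ∧
      |machRate γ (v τ) (w τ)| ≤ |machRate γ (v 0) (w 0)| + 1 ∧ |m' τ| ≤ |m' 0| + 1 := by
    have hn := nhdsWithin_le_nhds (a := (0 : ℝ)) (s := Ioi 0)
    filter_upwards [Ioo_mem_nhdsGT (lt_min hT hT'), hcm, hn (hAc.eventually_lt_const hAlt),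
      hn (eventually_abs_le_add_one hB₁c), hn (eventually_abs_le_add_one hB₂c),
      hn (eventually_abs_le_add_one hw), hn (eventually_abs_le_add_one hv'),
      hn (eventually_abs_le_add_one hEc), hn (eventually_abs_le_add_one hm')] with
      τ t1 t2 t3 t4 t5 t6 t7 t8 t9
    exact ⟨t1, t2, le_of_lt t3, t4, t5, t6, t7, t8, t9⟩
  obtain ⟨η, hη, hηs⟩ := mem_nhdsGT_iff_exists_Ioo_subset.1 hev
  have hT1 : ∀ τ ∈ Ioo 0 η, τ ∈ Ioo 0 T := fun τ hτ =>
    ⟨hτ.1, (hηs hτ).1.2.trans_le (min_le_left _ _)⟩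
  have hT2 : ∀ τ ∈ Ioo 0 η, τ ∈ Ioo 0 T' := fun τ hτ =>
    ⟨hτ.1, (hηs hτ).1.2.trans_le (min_le_right _ _)⟩
  -- The difference is `O(τ)`, so its square beats the weight `1/τ`.
  have hquot : ∀ {f g : ℝ → ℝ}, AnalyticAt ℝ f 0 → AnalyticAt ℝ g 0 → f 0 = g 0 →
      Tendsto (fun τ => (f τ - g τ) ^ 2 / τ) (𝓝[>] 0) (𝓝 0) := fun {f g} hf hg hfg => by
    have hd := (hf.sub hg).differentiableAt.hasDerivAt
    have h1 := (hasDerivAt_iff_tendsto_slope.1 hd).mono_left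
      (nhdsWithin_mono (0 : ℝ) (fun x (hx : 0 < x) => hx.ne'))
    have h2 : Tendsto (f - g) (𝓝[>] 0) (𝓝 ((f - g) 0)) :=
      hd.continuousAt.tendsto.mono_left nhdsWithin_le_nhds
    have h3 := h1.mul h2
    have h0 : (f - g) 0 = 0 := by simp [hfg]
    rw [h0, mul_zero] at h3
    refine h3.congr fun τ => ?_
    simp only [slope_def_field, h0, Pi.sub_apply]
    ring
  have hzero := eq_zero_of_singular_damping (s := fun τ => v τ - v' τ) (u := fun τ => w τ - w' τ)
    (d := fun τ => m τ - m' τ) (A := A) (B₁ := B₁) (B₂ := B₂) (m := m) hc hμpos hC0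
    (fun τ hτ => (h.deriv_v τ (hT1 τ hτ)).sub (h'.deriv_v τ (hT2 τ hτ)))
    (fun τ hτ => (h.deriv_w τ (hT1 τ hτ)).sub (h'.deriv_w τ (hT2 τ hτ)))
    (fun τ hτ => (h.deriv_m τ (hT1 τ hτ)).sub (h'.deriv_m τ (hT2 τ hτ)))
    (fun τ hτ => (hηs hτ).2.1) (fun τ hτ => ?_) (fun τ hτ => (hηs hτ).2.2.1)
    (fun τ hτ => (hηs hτ).2.2.2.1.trans ?_) (fun τ hτ => (hηs hτ).2.2.2.2.1.trans ?_)
    (fun τ hτ => ?_) (fun τ hτ => ?_) ?_ ?_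
  · filter_upwards [Ioo_mem_nhdsGT hη] with τ hτ
    obtain ⟨z1, z2, z3⟩ := hzero τ hτ
    exact ⟨sub_eq_zero.1 z1, sub_eq_zero.1 z2, sub_eq_zero.1 z3⟩
  · have hm1 := (h.m_pos τ (hT1 τ hτ)).ne'
    have hm2 := (h'.m_pos τ (hT2 τ hτ)).ne'
    simp only [hB₂, (h'.deriv_v τ (hT2 τ hτ)).deriv, hA, hB₁]
    simp only [sonicPoly, driftPoly, slope, smul_eq_mul, ← ha, ← hk, ← hb]
    field_simp
    ring
  · rw [hC]; have : 0 ≤ (|m' 0| + 2) * (|γ + 1| + |(γ - 1) * a|) := by positivity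
    linarith [abs_nonneg (B₂ 0), abs_nonneg (w 0), abs_nonneg (v' 0),
      abs_nonneg (machRate γ (v 0) (w 0))]
  · rw [hC]; have : 0 ≤ (|m' 0| + 2) * (|γ + 1| + |(γ - 1) * a|) := by positivity
    linarith [abs_nonneg (B₁ 0), abs_nonneg (w 0), abs_nonneg (v' 0),
      abs_nonneg (machRate γ (v 0) (w 0))]
  · obtain ⟨-, -, -, -, -, t6, t7, -, -⟩ := hηs hτ
    have e : -(w τ * v τ) - -(w' τ * v' τ) = -(w τ * (v τ - v' τ)) - v' τ * (w τ - w' τ) := by ring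
    rw [e]
    refine (abs_sub _ _).trans ?_
    rw [abs_neg, abs_mul, abs_mul]
    have hc1 : |w τ| ≤ C := t6.trans (by
      rw [hC]; have : 0 ≤ (|m' 0| + 2) * (|γ + 1| + |(γ - 1) * a|) := by positivity
      linarith [abs_nonneg (B₁ 0), abs_nonneg (B₂ 0), abs_nonneg (v' 0),
        abs_nonneg (machRate γ (v 0) (w 0))])
    have hc2 : |v' τ| ≤ C := t7.trans (by
      rw [hC]; have : 0 ≤ (|m' 0| + 2) * (|γ + 1| + |(γ - 1) * a|) := by positivity
      linarith [abs_nonneg (B₁ 0), abs_nonneg (B₂ 0), abs_nonneg (w 0),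
        abs_nonneg (machRate γ (v 0) (w 0))])
    have := mul_le_mul_of_nonneg_right hc1 (abs_nonneg (v τ - v' τ))
    have := mul_le_mul_of_nonneg_right hc2 (abs_nonneg (w τ - w' τ))
    have := mul_nonneg hC0 (abs_nonneg (m τ - m' τ))
    linarith
  · obtain ⟨-, -, -, -, -, -, -, t8, t9⟩ := hηs hτ
    have e : -((1 + m τ) * machRate γ (v τ) (w τ)) - -((1 + m' τ) * machRate γ (v' τ) (w' τ))
        = -(machRate γ (v τ) (w τ) * (m τ - m' τ)) - (1 + m' τ) * ((γ + 1) * (v τ - v' τ)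
          + (γ - 1) * a * (w τ - w' τ)) := by
      simp only [machRate, slope, smul_eq_mul, ← ha]
      ring
    rw [e]
    refine (abs_sub _ _).trans ?_
    rw [abs_neg, abs_mul, abs_mul]
    have hc1 : |machRate γ (v τ) (w τ)| ≤ C := t8.trans (by
      rw [hC]; have : 0 ≤ (|m' 0| + 2) * (|γ + 1| + |(γ - 1) * a|) := by positivity
      linarith [abs_nonneg (B₁ 0), abs_nonneg (B₂ 0), abs_nonneg (v' 0), abs_nonneg (w 0)])
    have hm2 : |1 + m' τ| ≤ |m' 0| + 2 := (abs_add_le _ _).trans (by rw [abs_one]; linarith)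
    have hlin : |(γ + 1) * (v τ - v' τ) + (γ - 1) * a * (w τ - w' τ)| ≤
        (|γ + 1| + |(γ - 1) * a|) * (|v τ - v' τ| + |w τ - w' τ|) := by
      refine (abs_add_le _ _).trans ?_
      rw [abs_mul, abs_mul ((γ - 1) * a)]
      nlinarith [mul_nonneg (abs_nonneg (γ + 1)) (abs_nonneg (w τ - w' τ)),
        mul_nonneg (abs_nonneg ((γ - 1) * a)) (abs_nonneg (v τ - v' τ))]
    have hprod := mul_le_mul hm2 hlin (abs_nonneg _) (by positivity)
    have hc3 : (|m' 0| + 2) * (|γ + 1| + |(γ - 1) * a|) ≤ C := by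
      rw [hC]
      linarith [abs_nonneg (B₁ 0), abs_nonneg (B₂ 0), abs_nonneg (v' 0), abs_nonneg (w 0),
        abs_nonneg (machRate γ (v 0) (w 0))]
    have := mul_le_mul_of_nonneg_right hc1 (abs_nonneg (m τ - m' τ))
    have := mul_le_mul_of_nonneg_right hc3
      (by positivity : 0 ≤ |v τ - v' τ| + |w τ - w' τ|)
    linarith
  · have : Tendsto (fun τ => v τ - v' τ) (𝓝[>] 0) (𝓝 (v 0 - v' 0)) :=
      (hv.sub hv').tendsto.mono_left nhdsWithin_le_nhds
    simpa [hv0] using this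
  · have h1 := hquot h.analytic_w h'.analytic_w (h.w_zero.trans h'.w_zero.symm)
    have h2 := hquot h.analytic_m h'.analytic_m (h.m_zero.trans h'.m_zero.symm)
    simpa [add_div] using h1.add h2

/-- Uniqueness of sonic curves. -/
theorem eqOn {T' : ℝ} {v' w' m' : ℝ → ℝ} (h : IsSonicCurve γ p T v w m)
    (h' : IsSonicCurve γ p T' v' w' m') :
    ∀ τ ∈ Ioo 0 (min T T'), v τ = v' τ ∧ w τ = w' τ ∧ m τ = m' τ := by
  intro τ hτ
  have hT : 0 < min T T' := hτ.1.trans hτ.2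
  have hTl := hT.trans_le (min_le_left T T')
  have hTr := hT.trans_le (min_le_right T T')
  obtain ⟨t₀, ht₀, ht₀'⟩ := ((h.eventually_eq h' hTl hTr).and (Ioo_mem_nhdsGT hT)).exists
  have h1 : ∀ t ∈ Ioo 0 (min T T'), t ∈ Ioo 0 T := fun t ht =>
    ⟨ht.1, ht.2.trans_le (min_le_left _ _)⟩
  have h2 : ∀ t ∈ Ioo 0 (min T T'), t ∈ Ioo 0 T' := fun t ht =>
    ⟨ht.1, ht.2.trans_le (min_le_right _ _)⟩
  have := eqOn_Ioo_of_locally_lipschitz (F := fun _ => sonicField γ) ht₀'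
    (fun t ht => h.hasDerivAt (h1 t ht)) (fun t ht => h'.hasDerivAt (h2 t ht)) (fun t ht => ?_)
    (by simp [ht₀]) hτ
  · simpa using this
  · obtain ⟨K, U, hU, hK⟩ := ((contDiffAt_sonicField γ (x := (v t, w t, m t))
      (h.m_pos t (h1 t ht)).ne').of_le one_le_two).exists_lipschitzOnWith
    exact ⟨K, U, hU, Eventually.of_forall fun _ => hK⟩

end IsSonicCurve

/-! ### Continuation of curves and continuous dependence on the parameter. -/

/-- A bounded, globally Lipschitz field has solutions on every interval. -/
lemma exists_hasDerivAt_of_lipschitz_of_bounded {E : Type*} [NormedAddCommGroup E]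
    [NormedSpace ℝ E] [CompleteSpace E] {f : E → E} {K L : NNReal} (hK : LipschitzWith K f)
    (hL : ∀ x, ‖f x‖ ≤ L) (x₀ : E) (t₀ T : ℝ) :
    ∃ α : ℝ → E, α t₀ = x₀ ∧ ∀ t ∈ Icc t₀ T, HasDerivAt α (f (α t)) t := by
  set S : NNReal := ⟨|T - t₀| + 1, by positivity⟩ with hS
  have hSr : (S : ℝ) = |T - t₀| + 1 := rfl
  have hS0 : (0 : ℝ) < S := by rw [hSr]; positivity
  have hmem : t₀ ∈ Icc (t₀ - S) (t₀ + S) := ⟨by linarith, by linarith⟩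
  -- A ball of radius `L * S` cannot be left in time `S` at speed at most `L`, so the interval needs
  -- no shrinking.
  have hpl : IsPicardLindelof (fun _ => f)
      (⟨t₀, hmem⟩ : Icc (t₀ - (S : ℝ)) (t₀ + S)) x₀ (L * S) 0 L K :=
    { lipschitzOnWith := fun _ _ => hK.lipschitzOnWith
      continuousOn := fun _ _ => continuousOn_const
      norm_le := fun _ _ x _ => hL x
      mul_max_le := by simp }
  obtain ⟨α, hα, hd⟩ := hpl.exists_eq_forall_mem_Icc_hasDerivWithinAt₀
  refine ⟨α, hα, fun t ht => ?_⟩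
  have h1 : t₀ - S < t := by linarith [ht.1]
  have h2 : t < t₀ + S := by
    have := le_abs_self (T - t₀)
    rw [hSr]; linarith [ht.2]
  exact (hd t ⟨h1.le, h2.le⟩).hasDerivAt (Icc_mem_nhds h1 h2)

lemma hasDerivAt_ite_le {E : Type*} [NormedAddCommGroup E] [NormedSpace ℝ E] {f g : ℝ → E}
    {d : E} {c : ℝ} (hf : HasDerivAt f d c) (hg : HasDerivAt g d c) (h : f c = g c) :
    HasDerivAt (fun t => if t ≤ c then f t else g t) d c := by
  have h1 : HasDerivWithinAt (fun t => if t ≤ c then f t else g t) d (Iic c) c :=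
    hf.hasDerivWithinAt.congr (fun t ht => if_pos ht) (if_pos le_rfl)
  have h2 : HasDerivWithinAt (fun t => if t ≤ c then f t else g t) d (Ici c) c := by
    refine hg.hasDerivWithinAt.congr (fun t ht => ?_) (by simp [h])
    rcases eq_or_lt_of_le (show c ≤ t from ht) with rfl | hlt
    · simp [h]
    · exact if_neg (not_le.2 hlt)
  have := h1.union h2
  rwa [Iic_union_Ici, hasDerivWithinAt_univ] at this

lemma hasDerivAt_ite_of_lt {E : Type*} [NormedAddCommGroup E] [NormedSpace ℝ E] {f g : ℝ → E}
    {d : E} {c t : ℝ} (ht : t < c) (hf : HasDerivAt f d t) :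
    HasDerivAt (fun t => if t ≤ c then f t else g t) d t :=
  hf.congr_of_eventuallyEq ((eventually_lt_nhds ht).mono fun _ h => if_pos (le_of_lt h))

lemma hasDerivAt_ite_of_gt {E : Type*} [NormedAddCommGroup E] [NormedSpace ℝ E] {f g : ℝ → E}
    {d : E} {c t : ℝ} (ht : c < t) (hg : HasDerivAt g d t) :
    HasDerivAt (fun t => if t ≤ c then f t else g t) d t :=
  hg.congr_of_eventuallyEq ((eventually_gt_nhds ht).mono fun _ h => if_neg (not_le.2 h))

/-- Continuation of a sonic curve by a solution of the regular system. -/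
lemma IsSonicCurve.glue {γ p r c T : ℝ} {v w m : ℝ → ℝ} (h : IsSonicCurve γ p r v w m)
    (hc : c ∈ Ioo 0 r) {α : ℝ → ℝ × ℝ × ℝ}
    (hα : ∀ t ∈ Ico c T, HasDerivAt α (sonicField γ (α t)) t)
    (hpos : ∀ t ∈ Ico c T, 0 < (α t).2.2) (h0 : α c = (v c, w c, m c)) :
    IsSonicCurve γ p T (fun t => if t ≤ c then v t else (α t).1)
      (fun t => if t ≤ c then w t else (α t).2.1) (fun t => if t ≤ c then m t else (α t).2.2) := by
  have hev : ∀ f g : ℝ → ℝ, (fun t => if t ≤ c then f t else g t) =ᶠ[𝓝 0] f := fun f g =>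
    (eventually_lt_nhds hc.1).mono fun _ h => if_pos (le_of_lt h)
  have hd : ∀ t ∈ Ico c T, HasDerivAt (fun t => (α t).1) (sonicField γ (α t)).1 t ∧
      HasDerivAt (fun t => (α t).2.1) (sonicField γ (α t)).2.1 t ∧
      HasDerivAt (fun t => (α t).2.2) (sonicField γ (α t)).2.2 t := fun t ht => by
    have h1 := (hα t ht)
    have h2 : HasDerivAt (fun t => (α t).2) (sonicField γ (α t)).2 t := h1.snd
    exact ⟨h1.fst, h2.fst, h2.snd⟩
  have e1 : (α c).1 = v c := by rw [h0]
  have e2 : (α c).2.1 = w c := by rw [h0]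
  have e3 : (α c).2.2 = m c := by rw [h0]
  have hcases : ∀ τ ∈ Ioo 0 T, (τ < c ∧ τ ∈ Ioo 0 r) ∨ (τ = c ∧ c ∈ Ico c T) ∨
      (c < τ ∧ τ ∈ Ico c T) := fun τ hτ => by
    rcases lt_trichotomy τ c with h | h | h
    · exact Or.inl ⟨h, hτ.1, h.trans hc.2⟩
    · exact Or.inr (Or.inl ⟨h, le_rfl, h ▸ hτ.2⟩)
    · exact Or.inr (Or.inr ⟨h, h.le, hτ.2⟩)
  refine ⟨h.analytic_v.congr (hev _ _).symm, h.analytic_w.congr (hev _ _).symm,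
    h.analytic_m.congr (hev _ _).symm, by rw [if_pos hc.1.le]; exact h.root,
    by rw [if_pos hc.1.le]; exact h.root_lt,
    by rw [if_pos hc.1.le]; exact h.rate_neg,
    by rw [if_pos hc.1.le]; exact h.w_zero, by rw [if_pos hc.1.le]; exact h.m_zero,
    fun τ hτ => ?_, fun τ hτ => ?_, fun τ hτ => ?_, fun τ hτ => ?_⟩
  · rcases hcases τ hτ with ⟨h1, h2⟩ | ⟨rfl, h2⟩ | ⟨h1, h2⟩
    · rw [if_pos h1.le]; exact h.m_pos τ h2
    · rw [if_pos le_rfl]; exact h.m_pos _ hc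
    · rw [if_neg (not_le.2 h1)]; exact hpos τ h2
  · rcases hcases τ hτ with ⟨h1, h2⟩ | ⟨rfl, h2⟩ | ⟨h1, h2⟩
    · simp only [if_pos h1.le]; exact hasDerivAt_ite_of_lt h1 (h.deriv_v τ h2)
    · simp only [if_pos le_rfl]
      refine hasDerivAt_ite_le (h.deriv_v _ hc) ?_ e1.symm
      have := (hd _ h2).1
      simpa only [sonicField, e1, e2, e3] using this
    · simp only [if_neg (not_le.2 h1)]; exact hasDerivAt_ite_of_gt h1 (hd τ h2).1
  · rcases hcases τ hτ with ⟨h1, h2⟩ | ⟨rfl, h2⟩ | ⟨h1, h2⟩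
    · simp only [if_pos h1.le]; exact hasDerivAt_ite_of_lt h1 (h.deriv_w τ h2)
    · simp only [if_pos le_rfl]
      refine hasDerivAt_ite_le (h.deriv_w _ hc) ?_ e2.symm
      have := (hd _ h2).2.1
      simpa only [sonicField, e1, e2, e3] using this
    · simp only [if_neg (not_le.2 h1)]; exact hasDerivAt_ite_of_gt h1 (hd τ h2).2.1
  · rcases hcases τ hτ with ⟨h1, h2⟩ | ⟨rfl, h2⟩ | ⟨h1, h2⟩
    · simp only [if_pos h1.le]; exact hasDerivAt_ite_of_lt h1 (h.deriv_m τ h2)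
    · simp only [if_pos le_rfl]
      refine hasDerivAt_ite_le (h.deriv_m _ hc) ?_ e3.symm
      have := (hd _ h2).2.2
      simpa only [sonicField, e1, e2, e3] using this
    · simp only [if_neg (not_le.2 h1)]; exact hasDerivAt_ite_of_gt h1 (hd τ h2).2.2

/-- The componentwise projection onto a box. -/
def boxProj {l u : ℝ × ℝ × ℝ} (h : l ≤ u) (x : ℝ × ℝ × ℝ) : ℝ × ℝ × ℝ :=
  (projIcc l.1 u.1 h.1 x.1, projIcc l.2.1 u.2.1 h.2.1 x.2.1, projIcc l.2.2 u.2.2 h.2.2 x.2.2)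

lemma boxProj_mem {l u : ℝ × ℝ × ℝ} (h : l ≤ u) (x : ℝ × ℝ × ℝ) : boxProj h x ∈ Icc l u :=
  ⟨⟨(projIcc _ _ h.1 _).2.1, (projIcc _ _ h.2.1 _).2.1, (projIcc _ _ h.2.2 _).2.1⟩,
    ⟨(projIcc _ _ h.1 _).2.2, (projIcc _ _ h.2.1 _).2.2, (projIcc _ _ h.2.2 _).2.2⟩⟩

lemma boxProj_of_mem {l u x : ℝ × ℝ × ℝ} (h : l ≤ u) (hx : x ∈ Icc l u) : boxProj h x = x := by
  have h1 := projIcc_of_mem h.1 (x := x.1) ⟨hx.1.1, hx.2.1⟩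
  have h2 := projIcc_of_mem h.2.1 (x := x.2.1) ⟨hx.1.2.1, hx.2.2.1⟩
  have h3 := projIcc_of_mem h.2.2 (x := x.2.2) ⟨hx.1.2.2, hx.2.2.2⟩
  simp only [boxProj, h1, h2, h3]

lemma lipschitzWith_boxProj {l u : ℝ × ℝ × ℝ} (h : l ≤ u) : LipschitzWith 1 (boxProj h) := by
  have key : ∀ {a b : ℝ} (hab : a ≤ b), LipschitzWith 1 fun x => (projIcc a b hab x : ℝ) :=
    fun hab => by
      simpa [Function.comp_def] using (LipschitzWith.subtype_val _).comp (LipschitzWith.projIcc hab)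
  have h1 := (key h.1).comp (LipschitzWith.prod_fst (α := ℝ) (β := ℝ × ℝ))
  have h2 := (key h.2.1).comp ((LipschitzWith.prod_fst (α := ℝ) (β := ℝ)).comp
    (LipschitzWith.prod_snd (α := ℝ) (β := ℝ × ℝ)))
  have h3 := (key h.2.2).comp ((LipschitzWith.prod_snd (α := ℝ) (β := ℝ)).comp
    (LipschitzWith.prod_snd (α := ℝ) (β := ℝ × ℝ)))
  simpa [Function.comp_def] using! h1.prodMk (h2.prodMk h3)

/-- The field, made bounded and globally Lipschitz by projecting onto a box inside `m > 0`. -/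
lemma exists_lipschitz_bounded_boxField (γ : ℝ) {l u : ℝ × ℝ × ℝ} (h : l ≤ u) (hl : 0 < l.2.2) :
    ∃ K L : NNReal, LipschitzWith K (fun x => sonicField γ (boxProj h x)) ∧
      ∀ x, ‖sonicField γ (boxProj h x)‖ ≤ L := by
  have hcd : ContDiffOn ℝ 2 (sonicField γ) (Icc l u) := fun x hx =>
    (contDiffAt_sonicField γ (hl.trans_le hx.1.2.2).ne').contDiffWithinAt
  obtain ⟨K, hK⟩ := hcd.exists_lipschitzOnWith two_ne_zero (convex_Icc l u) isCompact_Icc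
  obtain ⟨L, hL⟩ := isCompact_Icc.exists_bound_of_continuousOn hcd.continuousOn
  refine ⟨K, L.toNNReal, ?_, fun x => (hL _ (boxProj_mem h x)).trans (Real.le_coe_toNNReal L)⟩
  have := hK.comp (lipschitzWith_boxProj h).lipschitzOnWith (s := univ)
    (fun x _ => boxProj_mem h x)
  simpa [lipschitzOnWith_univ, Function.comp_def] using this

/-- Sonic curves depend continuously on the parameter. -/
theorem IsSonicCurve.eventually_exists_near {γ p₀ T T' ε : ℝ} {v w m : ℝ → ℝ}
    (h : IsSonicCurve γ p₀ T v w m) (hT' : 0 < T') (hTT : T' < T) (hε : 0 < ε) :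
    ∀ᶠ p in 𝓝 p₀, ∃ T₁ > T', ∃ v' w' m' : ℝ → ℝ, IsSonicCurve γ p T₁ v' w' m' ∧
      ∀ τ ∈ Ioc 0 T', |v' τ - v τ| < ε ∧ |w' τ - w τ| < ε := by
  obtain ⟨r, hr, δ, hδ, C, V, W, M, hfam⟩ :=
    exists_sonicCurve_family h.root h.root_lt h.rate_neg hε
  set c := min r T' / 2 with hc
  have hmin : 0 < min r T' := lt_min hr hT'
  have hc0 : 0 < c := half_pos hmin
  have hcr : c < r := (half_lt_self hmin).trans_le (min_le_left _ _)
  have hcT : c < T' := (half_lt_self hmin).trans_le (min_le_right _ _)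
  set T₁ := (T' + T) / 2 with hT₁
  have hT₁T : T₁ < T := by linarith
  have hTT₁ : T' < T₁ := by linarith
  set x : ℝ → ℝ × ℝ × ℝ := fun τ => (v τ, w τ, m τ) with hx
  have hsub : Icc c T₁ ⊆ Ioo 0 T := fun τ hτ => ⟨hc0.trans_le hτ.1, hτ.2.trans_lt hT₁T⟩
  have hxd : ∀ τ ∈ Icc c T₁, HasDerivAt x (sonicField γ (x τ)) τ := fun τ hτ =>
    h.hasDerivAt (hsub hτ)
  have hxc : ContinuousOn x (Icc c T₁) := fun τ hτ => (hxd τ hτ).continuousAt.continuousWithinAt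
  obtain ⟨R, hR⟩ := isCompact_Icc.exists_bound_of_continuousOn hxc
  obtain ⟨τm, hτm, hmin'⟩ := isCompact_Icc.exists_isMinOn (nonempty_Icc.2 (hcT.trans hTT₁).le)
    (f := m) (fun τ hτ => (h.deriv_m τ (hsub hτ)).continuousAt.continuousWithinAt)
  set μ := m τm with hμ
  have hμ0 : 0 < μ := h.m_pos _ (hsub hτm)
  have hbd : ∀ τ ∈ Icc c T₁, |v τ| ≤ R ∧ |w τ| ≤ R ∧ |m τ| ≤ R ∧ μ ≤ m τ := fun τ hτ => by
    have h1 := (norm_fst_le (x τ)).trans (hR τ hτ)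
    have h2 := (norm_snd_le (x τ)).trans (hR τ hτ)
    exact ⟨h1, (norm_fst_le (x τ).2).trans h2, (norm_snd_le (x τ).2).trans h2, hmin' hτ⟩
  have hμR : μ ≤ R := by
    obtain ⟨-, -, h3, h4⟩ := hbd τm hτm
    exact h4.trans ((le_abs_self _).trans h3)
  -- The box contains the `min 1 (μ / 2)`-neighbourhood of the reference curve on `[c, T₁]` and
  -- stays away from `m = 0`.
  set l : ℝ × ℝ × ℝ := (-R - 1, -R - 1, μ / 2) with hl
  set u : ℝ × ℝ × ℝ := (R + 1, R + 1, R + 1) with hu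
  have hlu : l ≤ u := ⟨by simp only [hl, hu]; linarith, by simp only [hl, hu]; linarith,
    by simp only [hl, hu]; linarith⟩
  have hmemd : ∀ τ ∈ Icc c T₁, ∀ y : ℝ × ℝ × ℝ, dist y (x τ) < min 1 (μ / 2) → y ∈ Icc l u := by
    intro τ hτ y hy
    obtain ⟨h1, h2, h3, h4⟩ := hbd τ hτ
    rw [Prod.dist_eq, Prod.dist_eq, max_lt_iff, max_lt_iff, Real.dist_eq, Real.dist_eq,
      Real.dist_eq] at hy
    obtain ⟨d1, d2, d3⟩ := hy
    have m1 := min_le_left (1 : ℝ) (μ / 2)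
    have m2 := min_le_right (1 : ℝ) (μ / 2)
    rw [abs_le] at h1 h2 h3
    rw [abs_lt] at d1 d2 d3
    simp only [hx] at d1 d2 d3
    refine ⟨⟨?_, ?_, ?_⟩, ⟨?_, ?_, ?_⟩⟩ <;> simp only [hl, hu] <;>
      linarith [d1.1, d1.2, d2.1, d2.2, d3.1, d3.2]
  obtain ⟨K, L, hK, hL⟩ := exists_lipschitz_bounded_boxField γ hlu (half_pos hμ0)
  have hη : 0 < min ε (min 1 (μ / 2)) := lt_min hε (lt_min one_pos (half_pos hμ0))
  have hxd' : ∀ τ ∈ Icc c T₁, HasDerivAt x (sonicField γ (boxProj hlu (x τ))) τ := fun τ hτ => by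
    rw [boxProj_of_mem hlu (hmemd τ hτ _ (by rw [dist_self]; exact lt_min one_pos (half_pos hμ0)))]
    exact hxd τ hτ
  have hsmall : ∀ᶠ p in 𝓝 p₀, |p - p₀| < δ ∧
      C * |p - p₀| * Real.exp (K * (T₁ - c)) < min ε (min 1 (μ / 2)) ∧ C * |p - p₀| < ε := by
    have h1 : Tendsto (fun p => |p - p₀|) (𝓝 p₀) (𝓝 0) := by
      simpa using ((continuous_id.sub (continuous_const (y := p₀))).abs.tendsto p₀)
    have h2 := h1.const_mul C
    have h3 := h2.mul_const (Real.exp (K * (T₁ - c)))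
    rw [mul_zero] at h2
    rw [mul_zero, zero_mul] at h3
    exact (h1.eventually_lt_const hδ).and ((h3.eventually_lt_const hη).and
      (h2.eventually_lt_const hε))
  filter_upwards [hsmall] with p ⟨hpδ, hpη, hpε⟩
  obtain ⟨hcurve, -, hclose⟩ := hfam p hpδ
  obtain ⟨hcurve₀, -, -⟩ := hfam p₀ (by simpa using hδ)
  have hclose := hclose p₀ (by simpa using hδ)
  -- The given curve is, near its start, the member of the local family at `p₀`, so the Lipschitz
  -- bound compares neighbours with it.
  have hagree : ∀ τ ∈ Ioc 0 c, V p₀ τ = v τ ∧ W p₀ τ = w τ ∧ M p₀ τ = m τ := fun τ hτ =>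
    hcurve₀.eqOn h τ ⟨hτ.1, lt_min (hτ.2.trans_lt hcr) (hτ.2.trans_lt (hcT.trans hTT))⟩
  obtain ⟨α, hα0, hαd⟩ := exists_hasDerivAt_of_lipschitz_of_bounded hK hL (V p c, W p c, M p c) c T₁
  have hdist0 : dist (α c) (x c) ≤ C * |p - p₀| := by
    obtain ⟨h1, h2, h3⟩ := hclose c ⟨hc0.le, hcr⟩
    obtain ⟨e1, e2, e3⟩ := hagree c ⟨hc0, le_rfl⟩
    rw [hα0, Prod.dist_eq, Prod.dist_eq, Real.dist_eq, Real.dist_eq, Real.dist_eq]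
    simp only [hx, ← e1, ← e2, ← e3]
    exact max_le h1 (max_le h2 h3)
  -- Gronwall's inequality is applied to the projected field, which is globally Lipschitz. The
  -- resulting bound keeps `α` inside the box, so there it solves the true system.
  have hgron : ∀ τ ∈ Icc c T₁, dist (α τ) (x τ) < min ε (min 1 (μ / 2)) := fun τ hτ => by
    have h1 := dist_le_of_trajectories_ODE (v := fun _ x => sonicField γ (boxProj hlu x))
      (fun _ => hK)
      (fun τ hτ => (hαd τ hτ).continuousAt.continuousWithinAt)
      (fun τ hτ => (hαd τ (Ico_subset_Icc_self hτ)).hasDerivWithinAt) hxc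
      (fun τ hτ => (hxd' τ (Ico_subset_Icc_self hτ)).hasDerivWithinAt) hdist0 τ hτ
    refine (h1.trans ?_).trans_lt hpη
    have h0 : 0 ≤ C * |p - p₀| := dist_nonneg.trans hdist0
    gcongr
    exact hτ.2
  have hαmem : ∀ τ ∈ Icc c T₁, α τ ∈ Icc l u := fun τ hτ =>
    hmemd τ hτ _ ((hgron τ hτ).trans_le (min_le_right _ _))
  refine ⟨T₁, hTT₁, _, _, _, hcurve.glue ⟨hc0, hcr⟩ (T := T₁) (α := α) (fun τ hτ => ?_)
    (fun τ hτ => ?_) hα0, fun τ hτ => ?_⟩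
  · have := hαd τ (Ico_subset_Icc_self hτ)
    rwa [boxProj_of_mem hlu (hαmem τ (Ico_subset_Icc_self hτ))] at this
  · exact (half_pos hμ0).trans_le (hαmem τ (Ico_subset_Icc_self hτ)).1.2.2
  · by_cases hτc : τ ≤ c
    · simp only [if_pos hτc]
      obtain ⟨h1, h2, -⟩ := hclose τ ⟨hτ.1.le, hτc.trans_lt hcr⟩
      obtain ⟨e1, e2, -⟩ := hagree τ ⟨hτ.1, hτc⟩
      rw [e1] at h1
      rw [e2] at h2
      exact ⟨h1.trans_lt hpε, h2.trans_lt hpε⟩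
    · simp only [if_neg hτc]
      have := (hgron τ ⟨(not_le.1 hτc).le, hτ.2.trans hTT₁.le⟩).trans_le (min_le_left _ _)
      rw [Prod.dist_eq, Prod.dist_eq, max_lt_iff, max_lt_iff, Real.dist_eq, Real.dist_eq] at this
      exact ⟨this.1, this.2.1⟩

/-! ### The lower root of the sonic polynomial over the parameter range. -/

/-- The linear coefficient of `sonicPoly` as a polynomial in `v`. -/
def sonicLin (γ w : ℝ) : ℝ := 2 * (γ + 1) * ((4 - 3 * γ) * w - 3) + 8 - (9 - 7 * γ) * w

/-- The value of `sonicPoly` at `v = 0`. -/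
def sonicConst (γ w : ℝ) : ℝ := ((4 - 3 * γ) * w - 3) * ((γ - 1) * ((2 - γ) * w - 1) * (w + 3))

lemma sonicPoly_eq (γ v w : ℝ) :
    sonicPoly γ v w = (γ + 1) * v ^ 2 + sonicLin γ w * v + sonicConst γ w := by
  simp only [sonicPoly, slope, sonicLin, sonicConst, smul_eq_mul]
  ring

lemma sonicPolyDeriv_eq (γ v w : ℝ) :
    sonicPolyDeriv γ v w = 2 * (γ + 1) * v + sonicLin γ w := by
  simp only [sonicPolyDeriv, slope, sonicLin, smul_eq_mul]
  ring

lemma driftPoly_eq (γ v w : ℝ) :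
    driftPoly γ v w = -((γ - 1) * slope γ v w ^ 2 + slope γ v w
      + (4 - 3 * γ) * w * (3 - (4 - 3 * γ) * w)) := by
  simp only [driftPoly, slope, smul_eq_mul]
  ring

lemma machRate_eq (γ v w : ℝ) :
    machRate γ v w = (γ + 1) * v + (γ - 1) * ((4 - 3 * γ) * w) - 3 * γ + 1 := by
  simp only [machRate, slope, smul_eq_mul]
  ring

/-- The smaller root of `sonicPoly γ · p`. -/
def lowerRoot (γ p : ℝ) : ℝ :=
  (-sonicLin γ p - Real.sqrt (sonicLin γ p ^ 2 - 4 * (γ + 1) * sonicConst γ p)) / (2 * (γ + 1))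

section Parameter

variable {γ p : ℝ}

/-- The factors of the constant term vanish at the far-field and Friedman values and at `-3`;
strictly between the first two the product is negative. -/
lemma sonicConst_neg (h₁ : 1 < γ) (h₂ : γ < 4 / 3) (hp : 1 / (2 - γ) < p)
    (hp' : (4 - 3 * γ) * p < 3) : sonicConst γ p < 0 := by
  have h2γ : 0 < 2 - γ := by linarith
  have hp0 : 0 < p := (one_div_pos.2 h2γ).trans hp
  rw [div_lt_iff₀ h2γ] at hp
  exact mul_neg_of_neg_of_pos (by linarith)
    (mul_pos (mul_pos (by linarith) (by linarith)) (by linarith))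

lemma sonicConst_eq_zero (h₂ : γ < 4 / 3)
    (hp : p = 1 / (2 - γ) ∨ (4 - 3 * γ) * p = 3) : sonicConst γ p = 0 := by
  have h2γ : 2 - γ ≠ 0 := by linarith
  rcases hp with rfl | hp
  · rw [sonicConst, mul_one_div_cancel h2γ]; ring
  · rw [sonicConst, hp]; ring

lemma sonicLin_pos_of_eq (h₁ : 1 < γ) (h₂ : γ < 4 / 3) (hp : (4 - 3 * γ) * p = 3) :
    0 < sonicLin γ p := by
  have ha : 0 < 4 - 3 * γ := by linarith
  have hp0 : 0 < p := pos_of_mul_pos_right (by linarith : 0 < (4 - 3 * γ) * p) ha.le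
  have : sonicLin γ p = (5 / 3 - γ) * p := by
    rw [sonicLin]; linear_combination (2 * (γ + 1) - 8 / 3) * hp
  rw [this]
  exact mul_pos (by linarith) hp0

lemma sonicLin_neg_of_eq (h₁ : 1 < γ) (h₂ : γ < 4 / 3) :
    sonicLin γ (1 / (2 - γ)) < 0 := by
  have h2γ : 0 < 2 - γ := by linarith
  have : sonicLin γ (1 / (2 - γ)) = (3 - 5 * γ) / (2 - γ) := by
    rw [sonicLin]; field_simp; ring
  rw [this]
  exact div_neg_of_neg_of_pos (by linarith) h2γ

/-- The range of parameters, as a trichotomy. -/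
lemma parameter_cases (hp : 1 / (2 - γ) ≤ p) (hp' : (4 - 3 * γ) * p ≤ 3) :
    p = 1 / (2 - γ) ∨ (4 - 3 * γ) * p = 3 ∨ (1 / (2 - γ) < p ∧ (4 - 3 * γ) * p < 3) := by
  rcases hp.eq_or_lt with h | h
  · exact Or.inl h.symm
  · rcases hp'.eq_or_lt with h' | h'
    · exact Or.inr (Or.inl h')
    · exact Or.inr (Or.inr ⟨h, h'⟩)

/-- In the interior the constant term is negative; at the endpoints it vanishes but the linear
coefficient does not. Hence the two slopes stay distinct on the whole closed range. -/
lemma sonicDisc_pos (h₁ : 1 < γ) (h₂ : γ < 4 / 3) (hp : 1 / (2 - γ) ≤ p)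
    (hp' : (4 - 3 * γ) * p ≤ 3) : 0 < sonicLin γ p ^ 2 - 4 * (γ + 1) * sonicConst γ p := by
  rcases parameter_cases hp hp' with h | h | ⟨h, h'⟩
  · rw [sonicConst_eq_zero h₂ (Or.inl h), h]
    have := sonicLin_neg_of_eq h₁ h₂
    nlinarith
  · rw [sonicConst_eq_zero h₂ (Or.inr h)]
    have := sonicLin_pos_of_eq h₁ h₂ h
    nlinarith
  · have := sonicConst_neg h₁ h₂ h h'
    nlinarith [sq_nonneg (sonicLin γ p)]

lemma sonicPolyDeriv_lowerRoot (h₁ : 1 < γ) : sonicPolyDeriv γ (lowerRoot γ p) p =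
    -Real.sqrt (sonicLin γ p ^ 2 - 4 * (γ + 1) * sonicConst γ p) := by
  have : 2 * (γ + 1) ≠ 0 := by linarith
  rw [sonicPolyDeriv_eq, lowerRoot]
  field_simp
  ring

lemma sonicPolyDeriv_lowerRoot_neg (h₁ : 1 < γ) (h₂ : γ < 4 / 3) (hp : 1 / (2 - γ) ≤ p)
    (hp' : (4 - 3 * γ) * p ≤ 3) : sonicPolyDeriv γ (lowerRoot γ p) p < 0 := by
  rw [sonicPolyDeriv_lowerRoot h₁]
  exact neg_lt_zero.2 (Real.sqrt_pos.2 (sonicDisc_pos h₁ h₂ hp hp'))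

lemma sonicPoly_lowerRoot (h₁ : 1 < γ) (h₂ : γ < 4 / 3) (hp : 1 / (2 - γ) ≤ p)
    (hp' : (4 - 3 * γ) * p ≤ 3) : sonicPoly γ (lowerRoot γ p) p = 0 := by
  have h0 : γ + 1 ≠ 0 := by linarith
  have hs := Real.sq_sqrt (sonicDisc_pos h₁ h₂ hp hp').le
  have hd := sonicPolyDeriv_lowerRoot (p := p) h₁
  rw [sonicPolyDeriv_eq] at hd
  rw [sonicPoly_eq]
  have : 4 * (γ + 1) * ((γ + 1) * lowerRoot γ p ^ 2 + sonicLin γ p * lowerRoot γ p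
      + sonicConst γ p) = 0 := by
    linear_combination (2 * (γ + 1) * lowerRoot γ p + sonicLin γ p - Real.sqrt (sonicLin γ p ^ 2
      - 4 * (γ + 1) * sonicConst γ p)) * hd + hs
  rcases mul_eq_zero.1 this with h | h
  · exact absurd h (mul_ne_zero four_ne_zero h0)
  · exact h

/-- In the interior the roots have opposite signs. At the Friedman end one root is `0` and the other
is negative, because the linear coefficient is positive. -/
lemma lowerRoot_neg (h₁ : 1 < γ) (h₂ : γ < 4 / 3) (hp : 1 / (2 - γ) < p)
    (hp' : (4 - 3 * γ) * p ≤ 3) : lowerRoot γ p < 0 := by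
  have h2γ : 0 < 2 - γ := by linarith
  refine div_neg_of_neg_of_pos ?_ (by linarith)
  rcases hp'.eq_or_lt with h | h
  · have := sonicLin_pos_of_eq h₁ h₂ h
    have := Real.sqrt_nonneg (sonicLin γ p ^ 2 - 4 * (γ + 1) * sonicConst γ p)
    linarith
  · have hc := sonicConst_neg h₁ h₂ hp h
    have : |sonicLin γ p| < Real.sqrt (sonicLin γ p ^ 2 - 4 * (γ + 1) * sonicConst γ p) := by
      rw [← Real.sqrt_sq_eq_abs]
      exact Real.sqrt_lt_sqrt (sq_nonneg _) (by nlinarith)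
    linarith [neg_abs_le (sonicLin γ p)]

lemma lowerRoot_eq_zero (h₁ : 1 < γ) (h₂ : γ < 4 / 3) : lowerRoot γ (1 / (2 - γ)) = 0 := by
  have hL := sonicLin_neg_of_eq h₁ h₂
  rw [lowerRoot, sonicConst_eq_zero h₂ (Or.inl rfl), mul_zero, sub_zero, Real.sqrt_sq_eq_abs,
    abs_of_neg hL, sub_self, zero_div]

/-- The bound is the value at the Friedman state, where `v = 0` and `(4 - 3γ) w = 3`. It forces `m`
to grow, which rules out a second sonic point while the curve remains in the region. -/
lemma machRate_le (h₁ : 1 < γ) {v w : ℝ} (hv : v ≤ 0) (hw : (4 - 3 * γ) * w ≤ 3) :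
    machRate γ v w ≤ -2 := by
  rw [machRate_eq]
  nlinarith [mul_nonneg (sub_nonneg.2 h₁.le) (sub_nonneg.2 hw)]

lemma machRate_lowerRoot_neg (h₁ : 1 < γ) (h₂ : γ < 4 / 3) (hp : 1 / (2 - γ) ≤ p)
    (hp' : (4 - 3 * γ) * p ≤ 3) : machRate γ (lowerRoot γ p) p < 0 := by
  refine (machRate_le h₁ ?_ hp').trans_lt (by norm_num)
  rcases hp.eq_or_lt with h | h
  · rw [← h, lowerRoot_eq_zero h₁ h₂]
  · exact (lowerRoot_neg h₁ h₂ h hp').le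

lemma IsSonicCurve.v_zero_eq {T : ℝ} {v w m : ℝ → ℝ} (h : IsSonicCurve γ p T v w m) (h₁ : 1 < γ)
    (h₂ : γ < 4 / 3) (hp : 1 / (2 - γ) ≤ p) (hp' : (4 - 3 * γ) * p ≤ 3) : v 0 = lowerRoot γ p :=
  sonicPoly_root_unique h.root (sonicPoly_lowerRoot h₁ h₂ hp hp') h.root_lt
    (sonicPolyDeriv_lowerRoot_neg h₁ h₂ hp hp')

end Parameter

/-! ### Monotonicity along curves and openness of the crossing condition. -/

lemma le_of_hasDerivAt_nonneg {f f' : ℝ → ℝ} {a b : ℝ} (hab : a ≤ b)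
    (hc : ContinuousOn f (Icc a b)) (hd : ∀ t ∈ Ioo a b, HasDerivAt f (f' t) t)
    (hf' : ∀ t ∈ Ioo a b, 0 ≤ f' t) : f a ≤ f b := by
  refine monotoneOn_of_deriv_nonneg (convex_Icc a b) hc (fun t ht => ?_) (fun t ht => ?_)
    (left_mem_Icc.2 hab) (right_mem_Icc.2 hab) hab
  · rw [interior_Icc] at ht
    exact (hd t ht).differentiableAt.differentiableWithinAt
  · rw [interior_Icc] at ht
    rw [(hd t ht).deriv]
    exact hf' t ht

lemma lt_of_hasDerivAt_pos {f f' : ℝ → ℝ} {a b : ℝ} (hab : a < b)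
    (hc : ContinuousOn f (Icc a b)) (hd : ∀ t ∈ Ioo a b, HasDerivAt f (f' t) t)
    (hf' : ∀ t ∈ Ioo a b, 0 < f' t) : f a < f b := by
  refine strictMonoOn_of_deriv_pos (convex_Icc a b) hc (fun t ht => ?_)
    (left_mem_Icc.2 hab.le) (right_mem_Icc.2 hab.le) hab
  rw [interior_Icc] at ht
  rw [(hd t ht).deriv]
  exact hf' t ht

/-- A solution of a scalar homogeneous linear equation which has a zero vanishes identically. -/
lemma eq_zero_of_linear {f k : ℝ → ℝ} {a b t₀ : ℝ} (ht₀ : t₀ ∈ Ioo a b)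
    (hk : ContinuousOn k (Ioo a b)) (hf : ∀ t ∈ Ioo a b, HasDerivAt f (k t * f t) t)
    (h0 : f t₀ = 0) : ∀ t ∈ Ioo a b, f t = 0 := by
  refine eqOn_Ioo_of_locally_lipschitz (F := fun t x => k t * x) (g := fun _ => 0) ht₀ hf
    (fun t _ => by simpa using hasDerivAt_const t (0 : ℝ)) (fun t ht => ?_) h0
  refine ⟨⟨|k t| + 1, by positivity⟩, univ, univ_mem, ?_⟩
  have hkc : ContinuousAt k t := hk.continuousAt (Ioo_mem_nhds ht.1 ht.2)
  filter_upwards [eventually_abs_le_add_one hkc] with s hs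
  refine LipschitzOnWith.of_dist_le_mul fun x _ y _ => ?_
  rw [Real.dist_eq, Real.dist_eq, ← mul_sub, abs_mul]
  exact mul_le_mul_of_nonneg_right hs (abs_nonneg _)

namespace IsSonicCurve

variable {γ p T : ℝ} {v w m : ℝ → ℝ}

lemma continuousAt_v (h : IsSonicCurve γ p T v w m) {τ : ℝ} (hτ : τ ∈ Ico 0 T) :
    ContinuousAt v τ := by
  rcases hτ.1.eq_or_lt with h0 | h0
  · rw [← h0]; exact h.analytic_v.continuousAt
  · exact (h.deriv_v τ ⟨h0, hτ.2⟩).continuousAt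

lemma continuousAt_w (h : IsSonicCurve γ p T v w m) {τ : ℝ} (hτ : τ ∈ Ico 0 T) :
    ContinuousAt w τ := by
  rcases hτ.1.eq_or_lt with h0 | h0
  · rw [← h0]; exact h.analytic_w.continuousAt
  · exact (h.deriv_w τ ⟨h0, hτ.2⟩).continuousAt

/-- The equation `ẇ = -v w` is linear in `w`, so a single zero would make `w` vanish identically. -/
lemma w_pos (h : IsSonicCurve γ p T v w m) (hp : 0 < p) : ∀ τ ∈ Ico 0 T, 0 < w τ := by
  intro τ hτ
  by_contra! hle
  have h0 : 0 < w 0 := by rw [h.w_zero]; exact hp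
  have hcont : ContinuousOn w (Icc 0 τ) := fun s hs =>
    (h.continuousAt_w ⟨hs.1, hs.2.trans_lt hτ.2⟩).continuousWithinAt
  obtain ⟨s, hs, hs0⟩ := intermediate_value_Icc' hτ.1 hcont ⟨hle, h0.le⟩
  have hs1 : 0 < s := hs.1.lt_of_ne (by rintro rfl; linarith)
  have hz := eq_zero_of_linear (f := w) (k := fun t => -v t) (a := 0) (b := T)
    ⟨hs1, hs.2.trans_lt hτ.2⟩
    (fun t ht => (h.deriv_v t ht).continuousAt.neg.continuousWithinAt)
    (fun t ht => by convert! h.deriv_w t ht using 1; ring) hs0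
  have hT : 0 < T := hs1.trans_le (hs.2.trans hτ.2.le)
  have hev : ∀ᶠ t in 𝓝[>] (0 : ℝ), 0 < w t :=
    nhdsWithin_le_nhds (h.analytic_w.continuousAt.eventually_const_lt h0)
  obtain ⟨t, ht, ht'⟩ := (hev.and (Ioo_mem_nhdsGT hT)).exists
  exact ht.ne' (hz t ht')

lemma lt_w (h : IsSonicCurve γ p T v w m) (hp : 0 < p) {t : ℝ} (ht : t ∈ Ioo 0 T)
    (hv : ∀ s ∈ Ioo 0 t, v s < 0) : p < w t := by
  rw [← h.w_zero]
  refine lt_of_hasDerivAt_pos ht.1 (fun s hs =>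
    (h.continuousAt_w ⟨hs.1, hs.2.trans_lt ht.2⟩).continuousWithinAt)
    (fun s hs => h.deriv_w s ⟨hs.1, hs.2.trans ht.2⟩) (fun s hs => ?_)
  have := mul_neg_of_pos_of_neg (h.w_pos hp s ⟨hs.1.le, hs.2.trans ht.2⟩) (hv s hs)
  linarith

end IsSonicCurve

/-- The sonic curve with parameter `p` has negative `v` until `1 / w` falls below the Friedman
value. -/
def Crosses (γ p : ℝ) : Prop :=
  ∃ T : ℝ, ∃ v w m : ℝ → ℝ, IsSonicCurve γ p T v w m ∧ (∀ τ ∈ Ioo 0 T, v τ < 0) ∧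
    ∃ τ ∈ Ioo 0 T, 3 < (4 - 3 * γ) * w τ

/-- On a compact interval `[0, T']` the maximum of `v` is strictly negative, the start included
because the lower root is negative away from the far-field value. Both defining inequalities
therefore survive small perturbations. -/
lemma eventually_crosses {γ p : ℝ} (h₁ : 1 < γ) (h₂ : γ < 4 / 3) (hp : 1 / (2 - γ) < p)
    (hp' : (4 - 3 * γ) * p ≤ 3) (h : Crosses γ p) : ∀ᶠ p' in 𝓝 p, Crosses γ p' := by
  obtain ⟨T, v, w, m, hs, hv, τ, hτ, hwτ⟩ := h
  have ha : 0 < 4 - 3 * γ := by linarith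
  have hv0 : v 0 < 0 := by
    rw [hs.v_zero_eq h₁ h₂ hp.le hp']; exact lowerRoot_neg h₁ h₂ hp hp'
  obtain ⟨T', hT', hT'T⟩ := exists_between hτ.2
  have hT0 : 0 < T' := hτ.1.trans hT'
  obtain ⟨s, hs', hmax⟩ := isCompact_Icc.exists_isMaxOn (nonempty_Icc.2 hT0.le) (f := v)
    (fun t ht => (hs.continuousAt_v ⟨ht.1, ht.2.trans_lt hT'T⟩).continuousWithinAt)
  have hvs : v s < 0 := by
    rcases hs'.1.eq_or_lt with h0 | h0
    · rw [← h0]; exact hv0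
    · exact hv s ⟨h0, hs'.2.trans_lt hT'T⟩
  have hε : 0 < min (-v s) (w τ - 3 / (4 - 3 * γ)) :=
    lt_min (by linarith) (by rw [sub_pos, div_lt_iff₀ ha]; linarith)
  filter_upwards [hs.eventually_exists_near hT0 hT'T hε] with p' ⟨T₁, hT₁, v', w', m', hc, hnear⟩
  refine ⟨T', v', w', m', hc.mono hT₁.le, fun t ht => ?_, τ, ⟨hτ.1, hT'⟩, ?_⟩
  · have h1 := ((hnear t ⟨ht.1, ht.2.le⟩).1.trans_le (min_le_left _ _))
    have h2 : v t ≤ v s := hmax ⟨ht.1.le, ht.2.le⟩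
    linarith [(abs_lt.1 h1).2]
  · have h1 := ((hnear τ ⟨hτ.1, hT'.le⟩).2.trans_le (min_le_right _ _))
    have h2 : 3 / (4 - 3 * γ) < w' τ := by linarith [(abs_lt.1 h1).1]
    rw [div_lt_iff₀ ha] at h2
    linarith

/-- Near the sonic point, the sonic curve exists and is close to its initial data. -/
lemma exists_sonicCurve {γ p ε : ℝ} (h₁ : 1 < γ) (h₂ : γ < 4 / 3) (hp : 1 / (2 - γ) ≤ p)
    (hp' : (4 - 3 * γ) * p ≤ 3) (hε : 0 < ε) : ∃ r > 0, ∃ v w m : ℝ → ℝ, IsSonicCurve γ p r v w m ∧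
      ∀ τ ∈ Ico 0 r, |v τ - lowerRoot γ p| < ε ∧ |w τ - p| < ε := by
  obtain ⟨r, hr, δ, hδ, C, V, W, M, h⟩ := exists_sonicCurve_family
    (sonicPoly_lowerRoot h₁ h₂ hp hp') (sonicPolyDeriv_lowerRoot_neg h₁ h₂ hp hp')
    (machRate_lowerRoot_neg h₁ h₂ hp hp') hε
  obtain ⟨h1, h2, -⟩ := h p (by simpa using hδ)
  exact ⟨r, hr, _, _, _, h1, h2⟩

/-- The LPH branch starts at the Friedman value with `v < 0`, so `w` exceeds that value immediately.
-/
lemma crosses_friedman {γ p : ℝ} (h₁ : 1 < γ) (h₂ : γ < 4 / 3) (hp : 1 / (2 - γ) < p)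
    (hp' : (4 - 3 * γ) * p = 3) : Crosses γ p := by
  have ha : 0 < 4 - 3 * γ := by linarith
  have hp0 : 0 < p := (one_div_pos.2 (by linarith)).trans hp
  have hneg := lowerRoot_neg h₁ h₂ hp hp'.le
  obtain ⟨r, hr, v, w, m, h, hnear⟩ := exists_sonicCurve h₁ h₂ hp.le hp'.le (neg_pos.2 hneg)
  have hv : ∀ τ ∈ Ioo 0 r, v τ < 0 := fun τ hτ => by
    have := (abs_lt.1 (hnear τ ⟨hτ.1.le, hτ.2⟩).1).2
    linarith
  have hmem : r / 2 ∈ Ioo 0 r := ⟨by linarith, by linarith⟩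
  refine ⟨r, v, w, m, h, hv, r / 2, hmem, ?_⟩
  have := h.lt_w hp0 hmem (fun s hs => hv s ⟨hs.1, hs.2.trans hmem.2⟩)
  nlinarith

/-! ### A priori bounds and continuation up to the exit from the region. -/

/-- On bounded ranges of `w`, away from `m = 0`, the derivative of `v` is bounded below. -/
lemma exists_sonicField_fst_ge {γ m₁ : ℝ} (h₁ : 1 < γ) (h₂ : γ < 4 / 3) (hm₁ : 0 < m₁) :
    ∃ C ≥ 0, ∀ v w m : ℝ, 0 ≤ w → (4 - 3 * γ) * w ≤ 3 → m₁ ≤ m →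
      -C ≤ sonicPoly γ v w / m - driftPoly γ v w := by
  have ha : 0 < 4 - 3 * γ := by linarith
  -- This is the minimum of `sonicPoly γ · w` over `v`, obtained by completing the square.
  set f : ℝ → ℝ := fun w => sonicConst γ w - sonicLin γ w ^ 2 / (4 * (γ + 1)) with hf
  have hfc : Continuous f := by
    rw [hf]; unfold sonicConst sonicLin; fun_prop
  obtain ⟨C, hC⟩ := isCompact_Icc.exists_bound_of_continuousOn
    (s := Icc 0 (3 / (4 - 3 * γ))) hfc.continuousOn
  have hC0 : 0 ≤ C := (norm_nonneg _).trans (hC 0 ⟨le_rfl, by positivity⟩)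
  -- The second summand is the maximum of `-(γ - 1) S² - S` over the slope `S`.
  refine ⟨C / m₁ + 1 / (4 * (γ - 1)), add_nonneg (by positivity)
    (one_div_nonneg.2 (by linarith)), fun v w m hw hw' hm => ?_⟩
  have hwm : w ≤ 3 / (4 - 3 * γ) := by rw [le_div_iff₀ ha]; linarith
  have hq : -C ≤ sonicPoly γ v w := by
    have h1 := (abs_le.1 (hC w ⟨hw, hwm⟩)).1
    have h2 : sonicPoly γ v w = f w + (γ + 1) * (v + sonicLin γ w / (2 * (γ + 1))) ^ 2 := by
      have : γ + 1 ≠ 0 := by linarith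
      rw [sonicPoly_eq, hf]
      field_simp
      ring
    have h3 : 0 ≤ (γ + 1) * (v + sonicLin γ w / (2 * (γ + 1))) ^ 2 :=
      mul_nonneg (by linarith) (sq_nonneg _)
    linarith
  have hqm : -(C / m₁) ≤ sonicPoly γ v w / m := by
    rw [le_div_iff₀ (hm₁.trans_le hm)]
    have : C ≤ C / m₁ * m := by
      rw [div_mul_eq_mul_div, le_div_iff₀ hm₁]
      exact mul_le_mul_of_nonneg_left hm hC0
    linarith
  have hB : driftPoly γ v w ≤ 1 / (4 * (γ - 1)) := by
    have hγ : 0 < γ - 1 := by linarith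
    rw [driftPoly_eq, le_div_iff₀ (by linarith)]
    have h1 : 0 ≤ (4 - 3 * γ) * w * (3 - (4 - 3 * γ) * w) :=
      mul_nonneg (mul_nonneg ha.le hw) (by linarith)
    nlinarith [sq_nonneg (2 * (γ - 1) * slope γ v w + 1), mul_nonneg hγ.le h1]
  linarith

/-- A priori bounds for solutions in the region `v ≤ 0`, `(4 - 3γ) w ≤ 3`. -/
lemma exists_apriori_bounds {γ m₁ : ℝ} (h₁ : 1 < γ) (h₂ : γ < 4 / 3) (hm₁ : 0 < m₁) (V₀ L : ℝ) :
    ∃ V M : ℝ, 0 < V ∧ m₁ < M ∧ ∀ (c t : ℝ) (x : ℝ → ℝ × ℝ × ℝ), c ≤ t → t - c ≤ L →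
      (∀ s ∈ Icc c t, HasDerivAt x (sonicField γ (x s)) s) →
      (∀ s ∈ Icc c t, (x s).1 ≤ 0 ∧ 0 ≤ (x s).2.1 ∧ (4 - 3 * γ) * (x s).2.1 ≤ 3 ∧ 0 < (x s).2.2) →
      (x c).1 = V₀ → (x c).2.2 = m₁ →
      -V < (x t).1 ∧ (x c).2.1 ≤ (x t).2.1 ∧ m₁ ≤ (x t).2.2 ∧ (x t).2.2 < M := by
  obtain ⟨C, hC0, hC⟩ := exists_sonicField_fst_ge h₁ h₂ hm₁
  set V := |V₀| + C * |L| + 1 with hV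
  have hV0 : 0 < V := by positivity
  set K := (γ + 1) * V + 3 * γ with hK
  have hK0 : 0 ≤ K := by rw [hK]; nlinarith
  have hexp : 1 ≤ Real.exp (K * |L|) := Real.one_le_exp (by positivity)
  refine ⟨V, (1 + m₁) * Real.exp (K * |L|), hV0, by nlinarith, ?_⟩
  intro c t x hct hL hx hreg hV₀ hmc
  have hd : ∀ s ∈ Icc c t, HasDerivAt (fun s => (x s).1) (sonicField γ (x s)).1 s ∧
      HasDerivAt (fun s => (x s).2.1) (sonicField γ (x s)).2.1 s ∧
      HasDerivAt (fun s => (x s).2.2) (sonicField γ (x s)).2.2 s := fun s hs => by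
    have h1 := hx s hs
    have h2 : HasDerivAt (fun t => (x t).2) (sonicField γ (x s)).2 s := h1.snd
    exact ⟨h1.fst, h2.fst, h2.snd⟩
  have hwmono : (x c).2.1 ≤ (x t).2.1 := by
    refine le_of_hasDerivAt_nonneg (f := fun s => (x s).2.1) hct
      (fun s hs => (hd s hs).2.1.continuousAt.continuousWithinAt)
      (fun s hs => (hd s (Ioo_subset_Icc_self hs)).2.1) (fun s hs => ?_)
    obtain ⟨r1, r2, -, -⟩ := hreg s (Ioo_subset_Icc_self hs)
    simp only [sonicField]
    nlinarith
  have hmmono : ∀ s ∈ Icc c t, m₁ ≤ (x s).2.2 := fun s hs => by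
    rw [← hmc]
    have hsub : ∀ u ∈ Icc c s, u ∈ Icc c t := fun u hu => ⟨hu.1, hu.2.trans hs.2⟩
    refine le_of_hasDerivAt_nonneg (f := fun s => (x s).2.2) hs.1
      (fun u hu => (hd u (hsub u hu)).2.2.continuousAt.continuousWithinAt)
      (fun u hu => (hd u (hsub u (Ioo_subset_Icc_self hu))).2.2) (fun u hu => ?_)
    obtain ⟨r1, -, r3, r4⟩ := hreg u (hsub u (Ioo_subset_Icc_self hu))
    have := machRate_le h₁ r1 r3
    simp only [sonicField]
    nlinarith
  have hvlow : ∀ s ∈ Icc c t, V₀ - C * (s - c) ≤ (x s).1 := fun s hs => by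
    have hsub : ∀ u ∈ Icc c s, u ∈ Icc c t := fun u hu => ⟨hu.1, hu.2.trans hs.2⟩
    have hd' : ∀ u ∈ Icc c s, HasDerivAt (fun u => (x u).1 + C * (u - c))
        ((sonicField γ (x u)).1 + C * 1) u := fun u hu =>
      (hd u (hsub u hu)).1.add (((hasDerivAt_id u).sub_const c).const_mul C)
    have := le_of_hasDerivAt_nonneg hs.1 (fun u hu => (hd' u hu).continuousAt.continuousWithinAt)
      (fun u hu => hd' u (Ioo_subset_Icc_self hu)) (fun u hu => ?_)
    · simp only [sub_self, mul_zero, add_zero, hV₀] at this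
      linarith
    · have hu' := hsub u (Ioo_subset_Icc_self hu)
      obtain ⟨-, r2, r3, -⟩ := hreg u hu'
      have := hC (x u).1 (x u).2.1 (x u).2.2 r2 r3 (hmmono u hu')
      simp only [sonicField]
      linarith
  have hVs : ∀ s ∈ Icc c t, -V < (x s).1 := fun s hs => by
    have h1 := hvlow s hs
    have h2 : C * (s - c) ≤ C * |L| :=
      mul_le_mul_of_nonneg_left (by linarith [hs.2, le_abs_self L]) hC0
    linarith [neg_abs_le V₀]
  refine ⟨hVs t ⟨hct, le_rfl⟩, hwmono, hmmono t ⟨hct, le_rfl⟩, ?_⟩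
  have hd' : ∀ u ∈ Icc c t, HasDerivAt (fun u => -((1 + (x u).2.2) * Real.exp (-(K * (u - c)))))
      (-((sonicField γ (x u)).2.2 * Real.exp (-(K * (u - c)))
        + (1 + (x u).2.2) * (Real.exp (-(K * (u - c))) * -(K * 1)))) u := fun u hu =>
    (((hd u hu).2.2.const_add 1).mul
      ((((hasDerivAt_id u).sub_const c).const_mul K).neg.exp)).neg
  have := le_of_hasDerivAt_nonneg hct (fun u hu => (hd' u hu).continuousAt.continuousWithinAt)
      (fun u hu => hd' u (Ioo_subset_Icc_self hu)) (fun u hu => ?_)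
  · simp only [sub_self, mul_zero, neg_zero, Real.exp_zero, mul_one, hmc, neg_le_neg_iff,
      Real.exp_neg] at this
    rw [← div_eq_mul_inv, div_le_iff₀ (Real.exp_pos _)] at this
    have hle : Real.exp (K * (t - c)) ≤ Real.exp (K * |L|) :=
      Real.exp_le_exp.2 (mul_le_mul_of_nonneg_left (hL.trans (le_abs_self L)) hK0)
    nlinarith
  · have hu' := Ioo_subset_Icc_self hu
    obtain ⟨-, r2, -, r4⟩ := hreg u hu'
    have hE : -machRate γ (x u).1 (x u).2.1 ≤ K := by
      rw [machRate_eq]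
      have := hVs u hu'
      have h3 : 0 ≤ (γ - 1) * ((4 - 3 * γ) * (x u).2.1) :=
        mul_nonneg (by linarith) (mul_nonneg (by linarith) r2)
      nlinarith
    have e : (-((sonicField γ (x u)).2.2 * Real.exp (-(K * (u - c)))
        + (1 + (x u).2.2) * (Real.exp (-(K * (u - c))) * -(K * 1)))) =
        (1 + (x u).2.2) * Real.exp (-(K * (u - c))) * (K + machRate γ (x u).1 (x u).2.1) := by
      simp only [sonicField]
      ring
    rw [e]
    exact mul_nonneg (mul_nonneg (by linarith) (Real.exp_pos _).le) (by linarith)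

/-- A curve which enters an open set leaves it for the first time at some time, or never. -/
lemma forall_mem_or_exists_first_exit {E : Type*} [TopologicalSpace E] {x : ℝ → E} {c T : ℝ}
    {U : Set E} (hU : IsOpen U) (hx : ContinuousOn x (Icc c T)) (hc : x c ∈ U) :
    (∀ t ∈ Icc c T, x t ∈ U) ∨ ∃ t ∈ Ioc c T, (∀ s ∈ Ico c t, x s ∈ U) ∧ x t ∉ U := by
  by_cases hall : ∀ t ∈ Icc c T, x t ∈ U
  · exact Or.inl hall
  right
  push Not at hall
  set Z := Icc c T ∩ x ⁻¹' Uᶜ with hZ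
  have hZne : Z.Nonempty := let ⟨t, ht, ht'⟩ := hall; ⟨t, ht, ht'⟩
  have hZc : IsClosed Z := hx.preimage_isClosed_of_isClosed isClosed_Icc hU.isClosed_compl
  have hZb : BddBelow Z := ⟨c, fun t ht => ht.1.1⟩
  have hmem : sInf Z ∈ Z := hZc.csInf_mem hZne hZb
  refine ⟨sInf Z, ⟨hmem.1.1.lt_of_ne fun h => hmem.2 (h ▸ hc), hmem.1.2⟩, fun s hs => ?_, hmem.2⟩
  by_contra hsU
  exact (csInf_le hZb ⟨⟨hs.1, hs.2.le.trans hmem.1.2⟩, hsU⟩).not_gt hs.2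

/-- A sonic curve extends until it leaves the region `v < 0`, `(4 - 3γ) w < 3`. -/
theorem exists_sonicCurve_or_exit {γ p : ℝ} (h₁ : 1 < γ) (h₂ : γ < 4 / 3) (hp : 1 / (2 - γ) < p)
    (hp' : (4 - 3 * γ) * p < 3) (T : ℝ) :
    ∃ T' : ℝ, ∃ v w m : ℝ → ℝ, IsSonicCurve γ p T' v w m ∧
      ((T ≤ T' ∧ ∀ τ ∈ Ioo 0 T', v τ < 0 ∧ (4 - 3 * γ) * w τ < 3) ∨
       ∃ t ∈ Ioo 0 T', (∀ τ ∈ Ioo 0 t, v τ < 0 ∧ (4 - 3 * γ) * w τ < 3) ∧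
        v t ≤ 0 ∧ (4 - 3 * γ) * w t ≤ 3 ∧ (v t = 0 ∨ (4 - 3 * γ) * w t = 3)) := by
  have ha : 0 < 4 - 3 * γ := by linarith
  have hp0 : 0 < p := (one_div_pos.2 (by linarith)).trans hp
  have hv₀ := lowerRoot_neg h₁ h₂ hp hp'.le
  have hgap : 0 < 3 / (4 - 3 * γ) - p := by rw [sub_pos, lt_div_iff₀ ha]; linarith
  set ε := min (-lowerRoot γ p) (min (p / 2) (3 / (4 - 3 * γ) - p)) with hε
  have hε0 : 0 < ε := lt_min (by linarith) (lt_min (half_pos hp0) hgap)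
  obtain ⟨r, hr, v, w, m, h, hnear⟩ := exists_sonicCurve h₁ h₂ hp.le hp'.le hε0
  have hloc : ∀ τ ∈ Ioo 0 r, v τ < 0 ∧ (4 - 3 * γ) * w τ < 3 ∧ p / 2 < w τ := fun τ hτ => by
    obtain ⟨n1, n2⟩ := hnear τ ⟨hτ.1.le, hτ.2⟩
    have n1' := n1.trans_le (min_le_left _ _)
    have n2' := n2.trans_le (min_le_right _ _)
    have n3 := (abs_lt.1 (n2'.trans_le (min_le_left _ _))).1
    have n4 : w τ < 3 / (4 - 3 * γ) := by
      linarith [(abs_lt.1 (n2'.trans_le (min_le_right _ _))).2]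
    rw [lt_div_iff₀ ha] at n4
    exact ⟨by linarith [(abs_lt.1 n1').2], by linarith, by linarith⟩
  set c := r / 2 with hc
  have hcmem : c ∈ Ioo 0 r := ⟨half_pos hr, half_lt_self hr⟩
  obtain ⟨hvc, hwc, hwc'⟩ := hloc c hcmem
  have hmc := h.m_pos c hcmem
  set T₁ := max T c + 2 with hT₁
  have hcT : c < T₁ := by linarith [le_max_right T c]
  -- The bounds depend only on the data at `c` and on the length of time, so the box can be fixed
  -- before the solution is constructed. It overlaps the faces `v = 0` and `w = 3 / (4 - 3γ)`, which
  -- lets the solution continue past an exit there.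
  obtain ⟨V, M, hV, hM, hbd⟩ := exists_apriori_bounds h₁ h₂ hmc (v c) (T₁ - c)
  set l : ℝ × ℝ × ℝ := (-V, p / 2, m c / 2) with hl
  set u : ℝ × ℝ × ℝ := (1, 3 / (4 - 3 * γ) + 1, M) with hu
  have hlu : l ≤ u := ⟨by simp only [hl, hu]; linarith, by simp only [hl, hu]; linarith,
    by simp only [hl, hu]; linarith⟩
  obtain ⟨K, L, hK, hL⟩ := exists_lipschitz_bounded_boxField γ hlu (half_pos hmc)
  obtain ⟨α, hα0, hα⟩ := exists_hasDerivAt_of_lipschitz_of_bounded hK hL (v c, w c, m c) c T₁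
  have hαc : ContinuousOn α (Icc c T₁) := fun t ht => (hα t ht).continuousAt.continuousWithinAt
  set U : Set (ℝ × ℝ × ℝ) := Ioo (-V) 0 ×ˢ (Ioo (p / 2) (3 / (4 - 3 * γ)) ×ˢ Ioo (m c / 2) M)
    with hU
  have hUo : IsOpen U := isOpen_Ioo.prod (isOpen_Ioo.prod isOpen_Ioo)
  have hVc : -V < v c := by
    have := (hbd c c (fun t => (v t, w t, m t)) le_rfl (by linarith)
      (fun s hs => by
        obtain rfl : s = c := le_antisymm hs.2 hs.1
        exact h.hasDerivAt hcmem)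
      (fun s hs => by
        obtain rfl : s = c := le_antisymm hs.2 hs.1
        exact ⟨hvc.le, by linarith, hwc.le, hmc⟩) rfl rfl).1
    exact this
  have hcU : α c ∈ U := by
    rw [hα0]
    exact ⟨⟨hVc, hvc⟩, ⟨hwc', by rw [lt_div_iff₀ ha]; linarith⟩, half_lt_self hmc, hM⟩
  have hUI : U ⊆ Ioo l.1 u.1 ×ˢ (Ioo l.2.1 u.2.1 ×ˢ Ioo l.2.2 u.2.2) := by
    rintro ⟨x, y, z⟩ ⟨hx, hy, hz⟩
    exact ⟨⟨hx.1, hx.2.trans one_pos⟩, ⟨hy.1, hy.2.trans (lt_add_one _)⟩, hz⟩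
  have hBI : Ioo l.1 u.1 ×ˢ (Ioo l.2.1 u.2.1 ×ˢ Ioo l.2.2 u.2.2) ⊆ Icc l u := by
    rintro ⟨x, y, z⟩ ⟨hx, hy, hz⟩
    exact ⟨⟨hx.1.le, hy.1.le, hz.1.le⟩, ⟨hx.2.le, hy.2.le, hz.2.le⟩⟩
  have hgen : ∀ t ∈ Icc c T₁, α t ∈ Icc l u → HasDerivAt α (sonicField γ (α t)) t :=
    fun t ht hm => by
      have := hα t ht
      rwa [boxProj_of_mem hlu hm] at this
  have hposm : ∀ x ∈ Icc l u, 0 < x.2.2 := fun x hx => (half_pos hmc).trans_le hx.1.2.2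
  have hUr : ∀ t, α t ∈ U → (α t).1 < 0 ∧ (4 - 3 * γ) * (α t).2.1 < 3 := fun t ht => by
    refine ⟨ht.1.2, ?_⟩
    have := ht.2.1.2
    rw [lt_div_iff₀ ha] at this
    linarith
  rcases forall_mem_or_exists_first_exit hUo hαc hcU with hall | ⟨t, ht, hbefore, hexit⟩
  · have hbox : ∀ t ∈ Ico c T₁, α t ∈ Icc l u := fun t ht =>
      hBI (hUI (hall t (Ico_subset_Icc_self ht)))
    refine ⟨T₁, _, _, _, h.glue hcmem (T := T₁) (α := α)
      (fun t ht => hgen t (Ico_subset_Icc_self ht) (hbox t ht))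
      (fun t ht => hposm _ (hbox t ht)) hα0,
      Or.inl ⟨by linarith [le_max_left T c], fun τ hτ => ?_⟩⟩
    by_cases hτc : τ ≤ c
    · simp only [if_pos hτc]
      obtain ⟨l1, l2, -⟩ := hloc τ ⟨hτ.1, hτc.trans_lt hcmem.2⟩
      exact ⟨l1, l2⟩
    · simp only [if_neg hτc]
      exact hUr τ (hall τ ⟨(not_le.1 hτc).le, hτ.2.le⟩)
  · have hcl : α t ∈ closure U := by
      have hct : Tendsto α (𝓝[<] t) (𝓝 (α t)) :=
        (hα t ⟨ht.1.le, ht.2⟩).continuousAt.tendsto.mono_left nhdsWithin_le_nhds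
      refine mem_closure_of_tendsto hct ?_
      filter_upwards [Ico_mem_nhdsLT ht.1] with s hs using hbefore s hs
    have hcl' : (α t).1 ∈ Icc (-V) 0 ∧ (α t).2.1 ∈ Icc (p / 2) (3 / (4 - 3 * γ)) ∧
        (α t).2.2 ∈ Icc (m c / 2) M := by
      have := closure_mono (Set.prod_mono Ioo_subset_Icc_self
        (Set.prod_mono Ioo_subset_Icc_self Ioo_subset_Icc_self)) hcl
      rw [(isClosed_Icc.prod (isClosed_Icc.prod isClosed_Icc)).closure_eq] at this
      exact this
    have hbt : α t ∈ Icc l u := ⟨⟨hcl'.1.1, hcl'.2.1.1, hcl'.2.2.1⟩,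
      ⟨hcl'.1.2.trans zero_le_one, hcl'.2.1.2.trans (by simp only [hu]; linarith), hcl'.2.2.2⟩⟩
    have hbox : ∀ s ∈ Icc c t, α s ∈ Icc l u := fun s hs => by
      rcases hs.2.eq_or_lt with rfl | hlt
      · exact hbt
      · exact hBI (hUI (hbefore s ⟨hs.1, hlt⟩))
    have hw3 : (4 - 3 * γ) * (α t).2.1 ≤ 3 := by
      have := hcl'.2.1.2
      rw [le_div_iff₀ ha] at this
      linarith
    obtain ⟨b1, b2, b3, b4⟩ := hbd c t α ht.1.le (by linarith [ht.2])
      (fun s hs => hgen s ⟨hs.1, hs.2.trans ht.2⟩ (hbox s hs))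
      (fun s hs => by
        have hb := hbox s hs
        refine ⟨?_, (half_pos hp0).le.trans hb.1.2.1, ?_, hposm _ hb⟩
        · rcases hs.2.eq_or_lt with rfl | hlt
          · exact hcl'.1.2
          · exact (hUr s (hbefore s ⟨hs.1, hlt⟩)).1.le
        · rcases hs.2.eq_or_lt with rfl | hlt
          · exact hw3
          · exact (hUr s (hbefore s ⟨hs.1, hlt⟩)).2.le)
      (by rw [hα0]) (by rw [hα0])
    rw [hα0] at b2
    -- The a priori bounds are strict on all other faces of `U`, leaving only these two for the
    -- exit.
    have hex : (α t).1 = 0 ∨ (4 - 3 * γ) * (α t).2.1 = 3 := by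
      by_contra! hne
      refine hexit ⟨⟨b1, hcl'.1.2.lt_of_ne hne.1⟩, ⟨hwc'.trans_le b2, ?_⟩, ?_, b4⟩
      · rw [lt_div_iff₀ ha, mul_comm]
        exact hw3.lt_of_ne hne.2
      · exact (half_lt_self hmc).trans_le b3
    have hpre : ∀ τ ∈ Ioo 0 t, c < τ → (α τ).1 < 0 ∧ (4 - 3 * γ) * (α τ).2.1 < 3 :=
      fun τ hτ hcτ => hUr τ (hbefore τ ⟨hcτ.le, hτ.2⟩)
    have hregion : ∀ τ ∈ Ioo 0 t, (if τ ≤ c then v τ else (α τ).1) < 0 ∧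
        (4 - 3 * γ) * (if τ ≤ c then w τ else (α τ).2.1) < 3 := fun τ hτ => by
      by_cases hτc : τ ≤ c
      · simp only [if_pos hτc]
        obtain ⟨l1, l2, -⟩ := hloc τ ⟨hτ.1, hτc.trans_lt hcmem.2⟩
        exact ⟨l1, l2⟩
      · simp only [if_neg hτc]
        exact hpre τ hτ (not_le.1 hτc)
    -- An exit exactly at `T₁` leaves no room beyond it; as `T < T₁`, the curve cut at `T₁` already
    -- satisfies the first alternative.
    rcases ht.2.eq_or_lt with heq | hlt
    · refine ⟨t, _, _, _, h.glue hcmem (T := t) (α := α)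
        (fun s hs => hgen s ⟨hs.1, hs.2.le.trans ht.2⟩ (hbox s (Ico_subset_Icc_self hs)))
        (fun s hs => hposm _ (hbox s (Ico_subset_Icc_self hs))) hα0,
        Or.inl ⟨by linarith [le_max_left T c], hregion⟩⟩
    · have hopen : Ioo l.1 u.1 ×ˢ (Ioo l.2.1 u.2.1 ×ˢ Ioo l.2.2 u.2.2) ∈ 𝓝 (α t) :=
        (isOpen_Ioo.prod (isOpen_Ioo.prod isOpen_Ioo)).mem_nhds
          ⟨⟨b1, hcl'.1.2.trans_lt one_pos⟩,
            ⟨hwc'.trans_le b2, hcl'.2.1.2.trans_lt (lt_add_one _)⟩,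
            (half_lt_self hmc).trans_le b3, b4⟩
      have hev := nhdsWithin_le_nhds (s := Ioi t)
        ((hα t ⟨ht.1.le, ht.2⟩).continuousAt.eventually_mem hopen)
      obtain ⟨t', ht', hsub⟩ := mem_nhdsGT_iff_exists_Ioo_subset.1
        (inter_mem hev (Ioo_mem_nhdsGT hlt))
      have htt' : t < t' := ht'
      have hbox' : ∀ s ∈ Ico c t', α s ∈ Icc l u ∧ s ∈ Icc c T₁ := fun s hs => by
        rcases le_or_gt s t with hst | hst
        · exact ⟨hbox s ⟨hs.1, hst⟩, hs.1, hst.trans ht.2⟩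
        · obtain ⟨i1, i2⟩ := hsub ⟨hst, hs.2⟩
          exact ⟨hBI i1, hs.1, i2.2.le⟩
      refine ⟨t', _, _, _, h.glue hcmem (T := t') (α := α)
        (fun s hs => hgen s (hbox' s hs).2 (hbox' s hs).1)
        (fun s hs => hposm _ (hbox' s hs).1) hα0,
        Or.inr ⟨t, ⟨hcmem.1.trans ht.1, htt'⟩, hregion, ?_⟩⟩
      simp only [if_neg (not_le.2 ht.1)]
      exact ⟨hcl'.1.2, hw3, hex⟩

/-! ### The possible exits from the region. -/

/-- A negative function vanishing at the right end has nonnegative derivative there. -/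
lemma nonneg_of_hasDerivAt_of_neg {f : ℝ → ℝ} {d t : ℝ} (hd : HasDerivAt f d t) (ht : f t = 0)
    (hf : ∀ᶠ s in 𝓝[<] t, f s < 0) : 0 ≤ d := by
  have h1 : Tendsto (_root_.slope f t) (𝓝[<] t) (𝓝 d) :=
    (hasDerivAt_iff_tendsto_slope.1 hd).mono_left
      (nhdsWithin_mono t (fun x (hx : x < t) => hx.ne))
  refine ge_of_tendsto h1 ?_
  filter_upwards [hf, self_mem_nhdsWithin] with s hs hst
  have hst' : s < t := hst
  rw [slope_def_field, ht, sub_zero]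
  exact (div_pos_of_neg_of_neg hs (by linarith)).le

lemma eventually_pos_of_hasDerivAt {f : ℝ → ℝ} {d t : ℝ} (hd : HasDerivAt f d t) (ht : f t = 0)
    (hd0 : 0 < d) : (∀ᶠ s in 𝓝[>] t, 0 < f s) ∧ ∀ᶠ s in 𝓝[<] t, f s < 0 := by
  have h := hasDerivAt_iff_tendsto_slope.1 hd
  have h1 := (h.mono_left
    (nhdsWithin_mono t (fun x (hx : t < x) => hx.ne'))).eventually_const_lt hd0
  have h2 := (h.mono_left (nhdsWithin_mono t (fun x (hx : x < t) => hx.ne))).eventually_const_lt hd0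
  constructor
  · filter_upwards [h1, self_mem_nhdsWithin] with s hs hst
    rw [slope_def_field, ht, sub_zero] at hs
    exact (div_pos_iff_of_pos_right (sub_pos.2 hst)).1 hs
  · filter_upwards [h2, self_mem_nhdsWithin] with s hs hst
    rw [slope_def_field, ht, sub_zero] at hs
    have hst' : s - t < 0 := sub_neg.2 hst
    by_contra! hle
    exact (div_nonpos_of_nonneg_of_nonpos hle hst'.le).not_gt hs

section Exit

variable {γ p T t : ℝ} {v w m : ℝ → ℝ}

/-- The curve cannot reach `v = 0` and the Friedman value at the same time. -/
lemma IsSonicCurve.not_v_eq_zero_and_friedman (h₂ : γ < 4 / 3) (h : IsSonicCurve γ p T v w m)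
    (ht : t ∈ Ioo 0 T) (hv : ∀ τ ∈ Ioo 0 t, v τ < 0) (hvt : v t = 0)
    (hwt : (4 - 3 * γ) * w t = 3) : False := by
  have ha : 4 - 3 * γ ≠ 0 := by linarith
  have hw : w t = 3 / (4 - 3 * γ) := by rw [eq_div_iff ha]; linarith
  have hmt := h.m_pos t ht
  -- This is the Friedman solution through the exit point: `E = -2` there, so `1 + m` grows like
  -- `exp (2 τ)`. Uniqueness would force `v = 0` already before `t`.
  set g : ℝ → ℝ × ℝ × ℝ := fun τ =>
    (0, 3 / (4 - 3 * γ), (1 + m t) * Real.exp (2 * (τ - t)) - 1) with hg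
  have hcont : Tendsto (fun τ => (1 + m t) * Real.exp (2 * (τ - t)) - 1) (𝓝 t) (𝓝 (m t)) := by
    have : Continuous (fun τ => (1 + m t) * Real.exp (2 * (τ - t)) - 1) := by fun_prop
    simpa using this.tendsto t
  have hev := nhdsWithin_le_nhds (s := Iio t) (hcont.eventually_const_lt hmt)
  obtain ⟨c, hc, hcs⟩ := mem_nhdsLT_iff_exists_Ioo_subset.1
    (inter_mem hev (Ioo_mem_nhdsLT ht.1))
  have hct : c < t := hc
  have hc0 : 0 ≤ c := by
    by_contra! hlt
    obtain ⟨-, h2⟩ := hcs (show c / 2 ∈ Ioo c t from ⟨by linarith, by linarith [ht.1]⟩)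
    linarith [h2.1]
  have hgpos : ∀ τ ∈ Ioo c T, 0 < (g τ).2.2 := fun τ hτ => by
    rcases lt_or_ge τ t with hlt | hge
    · exact (hcs ⟨hτ.1, hlt⟩).1
    · have : 1 ≤ Real.exp (2 * (τ - t)) := Real.one_le_exp (by linarith)
      simp only [hg]
      nlinarith
  have hgd : ∀ τ ∈ Ioo c T, HasDerivAt g (sonicField γ (g τ)) τ := fun τ hτ => by
    have e : sonicField γ (g τ) = (0, 0, (1 + m t) * (Real.exp (2 * (τ - t)) * (2 * 1))) := by
      have h1 : (4 - 3 * γ) * (3 / (4 - 3 * γ)) = 3 := mul_div_cancel₀ 3 ha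
      simp only [sonicField, hg, sonicPoly_eq, sonicConst, driftPoly_eq, machRate_eq, slope,
        smul_eq_mul, h1]
      refine Prod.ext ?_ (Prod.ext ?_ ?_) <;> simp only <;> ring
    rw [e]
    exact (hasDerivAt_const _ _).prodMk ((hasDerivAt_const _ _).prodMk
      (((((hasDerivAt_id τ).sub_const t).const_mul 2).exp.const_mul (1 + m t)).sub_const 1))
  have hsub : ∀ τ ∈ Ioo c T, τ ∈ Ioo 0 T := fun τ hτ => ⟨hc0.trans_lt hτ.1, hτ.2⟩
  have hEq := eqOn_Ioo_of_locally_lipschitz (F := fun _ => sonicField γ)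
    (f := fun τ => (v τ, w τ, m τ)) (g := g) (⟨hct, ht.2⟩ : t ∈ Ioo c T)
    (fun τ hτ => h.hasDerivAt (hsub τ hτ)) hgd (fun τ hτ => by
      obtain ⟨K, U, hU, hK⟩ := ((contDiffAt_sonicField γ (x := (v τ, w τ, m τ))
        (h.m_pos τ (hsub τ hτ)).ne').of_le one_le_two).exists_lipschitzOnWith
      exact ⟨K, U, hU, Eventually.of_forall fun _ => hK⟩)
    (by simp [hg, hvt, hw])
  have hmid : (c + t) / 2 ∈ Ioo c T := ⟨by linarith, by linarith [ht.2]⟩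
  have h1 : v ((c + t) / 2) = 0 := congrArg Prod.fst (hEq hmid)
  have h2 := hv ((c + t) / 2) ⟨by linarith, by linarith⟩
  linarith

/-- Since `v` rises to `0`, its derivative is at least `0`. If it were `0`, then `v̈ = -q ṁ / m²`,
which is positive because `q < 0 < ṁ`; so `v` would decrease to `0` just before `t`, against `v <
0`. -/
lemma IsSonicCurve.deriv_pos_of_exit (h₁ : 1 < γ) (h₂ : γ < 4 / 3) (hp : 1 / (2 - γ) < p)
    (h : IsSonicCurve γ p T v w m) (ht : t ∈ Ioo 0 T) (hv : ∀ τ ∈ Ioo 0 t, v τ < 0)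
    (hvt : v t = 0) (hwt : (4 - 3 * γ) * w t < 3) :
    0 < sonicPoly γ (v t) (w t) / m t - driftPoly γ (v t) (w t) := by
  have hp0 : 0 < p := (one_div_pos.2 (by linarith)).trans hp
  have hvneg : ∀ᶠ s in 𝓝[<] t, v s < 0 := by
    filter_upwards [Ioo_mem_nhdsLT ht.1] with s hs using hv s hs
  have hnn := nonneg_of_hasDerivAt_of_neg (h.deriv_v t ht) hvt hvneg
  refine hnn.lt_of_ne fun h0 => ?_
  have hv' := h.deriv_v t ht
  rw [← h0] at hv'
  have hw' := h.deriv_w t ht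
  rw [hvt, mul_zero, neg_zero] at hw'
  have hm' := h.deriv_m t ht
  have hmt := h.m_pos t ht
  have hq := hasDerivAt_sonicPoly γ hv' hw'
  have hB := hasDerivAt_driftPoly γ hv' hw'
  simp only [smul_zero, add_zero, mul_zero, zero_mul, sub_zero, neg_zero] at hq hB
  have hF := (hq.div hm' hmt.ne').sub hB
  simp only [zero_mul, zero_sub, sub_zero] at hF
  have hqneg : sonicPoly γ (v t) (w t) < 0 := by
    rw [hvt, sonicPoly_eq]
    have := sonicConst_neg h₁ h₂ (hp.trans (h.lt_w hp0 ht hv)) hwt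
    simpa using this
  have hE := machRate_le h₁ hvt.le hwt.le
  have hpos : 0 < -(sonicPoly γ (v t) (w t) *
      -((1 + m t) * machRate γ (v t) (w t))) / m t ^ 2 := by
    have : 0 < (1 + m t) * -machRate γ (v t) (w t) := mul_pos (by linarith) (by linarith)
    exact div_pos (by nlinarith) (by positivity)
  obtain ⟨-, hneg⟩ := eventually_pos_of_hasDerivAt hF h0.symm hpos
  obtain ⟨c, hc, hcs⟩ := mem_nhdsLT_iff_exists_Ioo_subset.1
    (inter_mem hneg (Ioo_mem_nhdsLT ht.1))
  have hct : c < t := hc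
  set e := (c + t) / 2 with he
  have hec : c < e := by linarith
  have het : e < t := by linarith
  have hcs' : ∀ s ∈ Ioo c t, sonicPoly γ (v s) (w s) / m s - driftPoly γ (v s) (w s) < 0 ∧
    s ∈ Ioo 0 t := fun s hs => hcs hs
  have he0 := (hcs' e ⟨hec, het⟩).2.1
  have := lt_of_hasDerivAt_pos (f := fun s => -v s) het (fun s hs =>
    (h.continuousAt_v ⟨he0.le.trans hs.1, hs.2.trans_lt ht.2⟩).neg.continuousWithinAt)
    (fun s hs => (h.deriv_v s ⟨he0.trans hs.1, hs.2.trans ht.2⟩).neg)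
    (fun s hs => neg_pos.2 (hcs' s ⟨hec.trans hs.1, hs.2⟩).1)
  linarith [hv e ⟨he0, het⟩]

/-- If the curve leaves the region through `v = 0`, nearby parameters do not cross. -/
lemma IsSonicCurve.eventually_not_crosses (h₁ : 1 < γ) (h₂ : γ < 4 / 3) (hp : 1 / (2 - γ) < p)
    (hp' : (4 - 3 * γ) * p < 3)
    (h : IsSonicCurve γ p T v w m) (ht : t ∈ Ioo 0 T) (hv : ∀ τ ∈ Ioo 0 t, v τ < 0)
    (hw : ∀ τ ∈ Ioo 0 t, (4 - 3 * γ) * w τ < 3)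
    (hvt : v t = 0) (hwt : (4 - 3 * γ) * w t < 3) : ∀ᶠ p' in 𝓝 p, ¬ Crosses γ p' := by
  have ha : 0 < 4 - 3 * γ := by linarith
  have hd := h.deriv_pos_of_exit h₁ h₂ hp ht hv hvt hwt
  have hpos := (eventually_pos_of_hasDerivAt (h.deriv_v t ht) hvt hd).1
  have hwc : ∀ᶠ s in 𝓝[>] t, (4 - 3 * γ) * w s < 3 := nhdsWithin_le_nhds
    (((h.deriv_w t ht).continuousAt.const_mul (4 - 3 * γ)).eventually_lt_const hwt)
  obtain ⟨t', ht', hs⟩ := mem_nhdsGT_iff_exists_Ioo_subset.1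
    (inter_mem (inter_mem hpos hwc) (Ioo_mem_nhdsGT ht.2))
  have htt' : t < t' := ht'
  -- A time just after the exit, with `v e > 0` and `w` below the Friedman value on all of `[0, e]`.
  set e := (t + t') / 2 with he
  have hte : t < e := by linarith
  have het' : e < t' := by linarith
  obtain ⟨⟨hve, -⟩, heT⟩ := hs ⟨hte, het'⟩
  have hve' : 0 < v e := hve
  have he0 : 0 < e := ht.1.trans hte
  have hwlt : ∀ s ∈ Icc 0 e, w s < 3 / (4 - 3 * γ) := fun s hs' => by
    rw [lt_div_iff₀ ha, mul_comm]
    rcases hs'.1.eq_or_lt with h0 | h0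
    · rw [← h0, h.w_zero]; exact hp'
    · rcases lt_trichotomy s t with hlt | rfl | hgt
      · exact hw s ⟨h0, hlt⟩
      · exact hwt
      · exact (hs ⟨hgt, hs'.2.trans_lt het'⟩).1.2
  obtain ⟨s, hsm, hmax⟩ := isCompact_Icc.exists_isMaxOn (nonempty_Icc.2 he0.le) (f := w)
    (fun s hs' => (h.continuousAt_w ⟨hs'.1, hs'.2.trans_lt heT.2⟩).continuousWithinAt)
  have hε : 0 < min (v e) (3 / (4 - 3 * γ) - w s) := lt_min hve' (by linarith [hwlt s hsm])
  filter_upwards [h.eventually_exists_near he0 heT.2 hε] with p' ⟨T₁, hT₁, v', w', m', hc, hnear⟩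
  rintro ⟨T₂, v₂, w₂, m₂, hc₂, hv₂, τ, hτ, hwτ⟩
  -- A crossing curve that lasts beyond `e` would need `v < 0` at `e`; one that ends by `e` would
  -- have to cross where neighbours still lie below the Friedman value.
  rcases lt_or_ge e T₂ with hlt | hge
  · have h1 := hc.eqOn hc₂ e ⟨he0, lt_min hT₁ hlt⟩
    have h2 := (abs_lt.1 ((hnear e ⟨he0, le_rfl⟩).1.trans_le (min_le_left _ _))).1
    have h3 := hv₂ e ⟨he0, hlt⟩
    linarith [h1.1]
  · have hτe : τ < e := hτ.2.trans_le hge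
    have h1 := hc.eqOn hc₂ τ ⟨hτ.1, lt_min (hτe.trans hT₁) hτ.2⟩
    have h2 := (abs_lt.1 ((hnear τ ⟨hτ.1, hτe.le⟩).2.trans_le (min_le_right _ _))).2
    have h3 : w τ ≤ w s := hmax ⟨hτ.1.le, hτe.le⟩
    have h4 : w' τ < 3 / (4 - 3 * γ) := by linarith
    rw [h1.2.1, lt_div_iff₀ ha] at h4
    linarith

/-- If the curve leaves the region through the Friedman value, the parameter crosses. -/
lemma IsSonicCurve.crosses_of_exit (h₂ : γ < 4 / 3) (hp0 : 0 < p)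
    (h : IsSonicCurve γ p T v w m) (ht : t ∈ Ioo 0 T) (hv : ∀ τ ∈ Ioo 0 t, v τ < 0)
    (hvt : v t < 0) (hwt : (4 - 3 * γ) * w t = 3) : Crosses γ p := by
  have ha : 0 < 4 - 3 * γ := by linarith
  have hvc : ∀ᶠ s in 𝓝[>] t, v s < 0 := nhdsWithin_le_nhds
    ((h.deriv_v t ht).continuousAt.eventually_lt_const hvt)
  obtain ⟨t', ht', hs⟩ := mem_nhdsGT_iff_exists_Ioo_subset.1
    (inter_mem hvc (Ioo_mem_nhdsGT ht.2))
  have htt' : t < t' := ht'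
  have hneg : ∀ s ∈ Ioo 0 t', v s < 0 := fun s hs' => by
    rcases lt_trichotomy s t with hlt | rfl | hgt
    · exact hv s ⟨hs'.1, hlt⟩
    · exact hvt
    · exact (hs ⟨hgt, hs'.2⟩).1
  have ht'T : t' ≤ T := by
    by_contra! hlt
    have := (hs ⟨ht.2, hlt⟩).2.2
    exact lt_irrefl _ this
  set e := (t + t') / 2 with he
  have hte : t < e := by linarith
  have het' : e < t' := by linarith
  refine ⟨t', v, w, m, h.mono ht'T, hneg, e, ⟨ht.1.trans hte, het'⟩, ?_⟩
  have := lt_of_hasDerivAt_pos hte (f := w)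
    (fun s hs' => (h.continuousAt_w ⟨ht.1.le.trans hs'.1,
      (hs'.2.trans_lt het').trans_le ht'T⟩).continuousWithinAt)
    (fun s hs' => h.deriv_w s ⟨ht.1.trans hs'.1, (hs'.2.trans het').trans_le ht'T⟩)
    (fun s hs' => ?_)
  · nlinarith
  · have h0 := ht.1.trans hs'.1
    have h1 := hneg s ⟨h0, hs'.2.trans het'⟩
    have h2 := h.w_pos hp0 s ⟨h0.le, (hs'.2.trans het').trans_le ht'T⟩
    nlinarith

end Exit

/-! ### The shooting argument. -/

/-- The sonic curve at the far-field value is explicit. -/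
lemma isSonicCurve_farField {γ : ℝ} (h₁ : 1 < γ) (h₂ : γ < 4 / 3) (T : ℝ) :
    IsSonicCurve γ (1 / (2 - γ)) T (fun _ => 0) (fun _ => 1 / (2 - γ))
      (fun τ => Real.exp (2 / (2 - γ) * τ) - 1) := by
  have h2γ : 0 < 2 - γ := by linarith
  have ha : 0 < 4 - 3 * γ := by linarith
  have hp' : (4 - 3 * γ) * (1 / (2 - γ)) ≤ 3 := by
    rw [mul_one_div, div_le_iff₀ h2γ]; linarith
  have hE : machRate γ 0 (1 / (2 - γ)) = -(2 / (2 - γ)) := by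
    rw [machRate_eq]; field_simp; ring
  have hq : sonicPoly γ 0 (1 / (2 - γ)) = 0 := by
    rw [sonicPoly_eq, sonicConst_eq_zero h₂ (Or.inl rfl)]; ring
  have hB : driftPoly γ 0 (1 / (2 - γ)) = 0 := by
    rw [driftPoly_eq]; simp only [slope, smul_eq_mul]; field_simp; ring
  refine ⟨analyticAt_const, analyticAt_const, by fun_prop, hq, ?_,
    by rw [hE]; exact neg_lt_zero.2 (by positivity),
    rfl, by simp, fun τ hτ => ?_, fun τ _ => ?_, fun τ _ => ?_, fun τ _ => ?_⟩
  · rw [sonicPolyDeriv_eq]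
    have := sonicLin_neg_of_eq h₁ h₂
    linarith
  · have := Real.one_lt_exp_iff.2 (mul_pos (div_pos two_pos h2γ) hτ.1)
    linarith
  · simpa only [hq, hB, zero_div, sub_zero] using hasDerivAt_const τ (0 : ℝ)
  · simpa only [mul_zero, neg_zero] using hasDerivAt_const τ (1 / (2 - γ))
  · convert! (((hasDerivAt_id τ).const_mul (2 / (2 - γ))).exp.sub_const 1) using 1
    rw [hE]
    simp only [id]
    ring

/-- The shooting argument: at the threshold parameter the sonic curve is global and stays below the
Friedman value. -/
theorem exists_critical_parameter {γ : ℝ} (h₁ : 1 < γ) (h₂ : γ < 4 / 3) :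
    ∃ p ∈ Ico (1 / (2 - γ)) (3 / (4 - 3 * γ)), (∀ p' ∈ Ioo p (3 / (4 - 3 * γ)), Crosses γ p') ∧
      ∀ T : ℝ, ∃ v w m : ℝ → ℝ, IsSonicCurve γ p T v w m ∧
        ∀ τ ∈ Ioo 0 T, (4 - 3 * γ) * w τ < 3 := by
  have h2γ : 0 < 2 - γ := by linarith
  have ha : 0 < 4 - 3 * γ := by linarith
  set pf := 1 / (2 - γ) with hpf
  set pF := 3 / (4 - 3 * γ) with hpF
  have hlt : pf < pF := by rw [hpf, hpF, div_lt_div_iff₀ h2γ ha]; linarith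
  have hpFa : (4 - 3 * γ) * pF = 3 := mul_div_cancel₀ 3 ha.ne'
  have hlt3 : ∀ {p}, p < pF ↔ (4 - 3 * γ) * p < 3 := fun {p} => by
    rw [hpF, lt_div_iff₀ ha, mul_comm]
  set S := {p | p ∈ Ico pf pF ∧ ∀ p' ∈ Ioo p pF, Crosses γ p'} with hS
  have hSb : BddBelow S := ⟨pf, fun p hp => hp.1.1⟩
  obtain ⟨p₁, hp₁, hp₁S⟩ : ∃ p₁ < pF, p₁ ∈ S := by
    have hev := eventually_crosses h₁ h₂ hlt hpFa.le (crosses_friedman h₁ h₂ hlt hpFa)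
    obtain ⟨c, hc, hcs⟩ := mem_nhdsLT_iff_exists_Ioo_subset.1
      (nhdsWithin_le_nhds (s := Iio pF) hev)
    have hcF : c < pF := hc
    exact ⟨max c pf, max_lt hcF hlt, ⟨le_max_right _ _, max_lt hcF hlt⟩, fun p' hp' =>
      hcs ⟨(le_max_left _ _).trans_lt hp'.1, hp'.2⟩⟩
  set p := sInf S with hp
  have hpp₁ : p ≤ p₁ := csInf_le hSb hp₁S
  have hpfp : pf ≤ p := le_csInf ⟨p₁, hp₁S⟩ fun q hq => hq.1.1
  have hppF : p < pF := hpp₁.trans_lt hp₁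
  have hcross : ∀ p' ∈ Ioo p pF, Crosses γ p' := fun p' hp' => by
    obtain ⟨q, hq, hqp'⟩ := exists_lt_of_csInf_lt ⟨p₁, hp₁S⟩ hp'.1
    exact hq.2 p' ⟨hqp', hp'.2⟩
  refine ⟨p, ⟨hpfp, hppF⟩, hcross, fun T => ?_⟩
  -- At the far-field endpoint the lower root is `0`, so the region `v < 0` is unavailable and the
  -- explicit curve is used instead.
  rcases hpfp.eq_or_lt with heq | hgt
  · rw [← heq]
    exact ⟨_, _, _, isSonicCurve_farField h₁ h₂ T, fun τ _ => hlt3.1 hlt⟩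
  have hp0 : 0 < p := (one_div_pos.2 h2γ).trans hgt
  -- By openness, crossing at `p` would put a smaller parameter into `S`.
  have hnc : ¬ Crosses γ p := fun hc => by
    have hev := eventually_crosses h₁ h₂ hgt (hlt3.1 hppF).le hc
    obtain ⟨c, hcp, hcs⟩ := mem_nhdsLT_iff_exists_Ioo_subset.1
      (nhdsWithin_le_nhds (s := Iio p) hev)
    have hcp' : c < p := hcp
    have hmax : max c pf < p := max_lt hcp' hgt
    have : max c pf ∈ S := ⟨⟨le_max_right _ _, hmax.trans hppF⟩, fun p' hp' => by
      rcases lt_trichotomy p' p with h | rfl | h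
      · exact hcs ⟨(le_max_left _ _).trans_lt hp'.1, h⟩
      · exact hc
      · exact hcross p' ⟨h, hp'.2⟩⟩
    exact (csInf_le hSb this).not_gt hmax
  obtain ⟨T', v, w, m, h, hT | ⟨t, ht, hreg, hvt, hwt, hexit⟩⟩ :=
    exists_sonicCurve_or_exit h₁ h₂ hgt (hlt3.1 hppF) T
  · exact ⟨v, w, m, h.mono hT.1, fun τ hτ => (hT.2 τ ⟨hτ.1, hτ.2.trans_le hT.1⟩).2⟩
  exfalso
  have hvneg : ∀ τ ∈ Ioo 0 t, v τ < 0 := fun τ hτ => (hreg τ hτ).1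
  rcases hvt.eq_or_lt with hv0 | hv0
  · rcases hwt.eq_or_lt with hw3 | hw3
    · exact h.not_v_eq_zero_and_friedman h₂ ht hvneg hv0 hw3
    -- Parameters slightly above `p` cross, whereas an exit through `v = 0` prevents all nearby
    -- parameters from crossing.
    · have hev := h.eventually_not_crosses h₁ h₂ hgt (hlt3.1 hppF) ht hvneg
        (fun τ hτ => (hreg τ hτ).2) hv0 hw3
      obtain ⟨p', hp', hp''⟩ := ((hev.filter_mono nhdsWithin_le_nhds).and
        (Ioo_mem_nhdsGT hppF)).exists
      exact hp' (hcross p' hp'')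
  · rcases hexit with h0 | h0
    · exact hv0.ne h0
    · exact hnc (h.crosses_of_exit h₂ hp0 ht hvneg hv0 h0)

/-! ### The sonic point as a function of the parameter. -/

/-- The density at the sonic point with `1 / ω = p`. -/
def sonicDensity (γ p : ℝ) : ℝ :=
  (4 - 3 * γ) / (4 * Real.pi) * (2 / p + (γ - 1) + (γ - 1) * (2 - γ) * p)

/-- The sonic point with `1 / ω = p`. -/
def sonicPoint (γ p : ℝ) : ℝ := p * Real.sqrt (γ * sonicDensity γ p ^ (γ - 1))

section SonicPoint

variable {γ p : ℝ}

lemma sonicDensity_pos (h₁ : 1 < γ) (h₂ : γ < 4 / 3) (hp : 0 < p) : 0 < sonicDensity γ p := by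
  have ha : 0 < 4 - 3 * γ := by linarith
  have h2γ : 0 < 2 - γ := by linarith
  have hγ : 0 < γ - 1 := by linarith
  unfold sonicDensity
  positivity

lemma sonicPoint_pos (h₁ : 1 < γ) (h₂ : γ < 4 / 3) (hp : 0 < p) : 0 < sonicPoint γ p := by
  have := sonicDensity_pos h₁ h₂ hp
  have hγ : 0 < γ := by linarith
  unfold sonicPoint
  positivity

lemma sonicPoint_sq (h₁ : 1 < γ) (h₂ : γ < 4 / 3) (hp : 0 < p) :
    sonicPoint γ p ^ 2 = p ^ 2 * (γ * sonicDensity γ p ^ (γ - 1)) := by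
  have := sonicDensity_pos h₁ h₂ hp
  have hγ : 0 < γ := by linarith
  rw [sonicPoint, mul_pow, Real.sq_sqrt (by positivity)]

/-- Moving a factor `p ^ (γ - 1)` into the density clears its decreasing term `2 / p`. Every
remaining factor is visibly increasing in `p`, which gives strict monotonicity. -/
lemma sonicPoint_sq_eq (h₁ : 1 < γ) (h₂ : γ < 4 / 3) (hp : 0 < p) :
    sonicPoint γ p ^ 2 = γ * ((4 - 3 * γ) / (4 * Real.pi) *
      (2 + (γ - 1) * p + (γ - 1) * (2 - γ) * p ^ 2)) ^ (γ - 1) * p ^ (3 - γ) := by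
  have hρ := sonicDensity_pos h₁ h₂ hp
  have e : (4 - 3 * γ) / (4 * Real.pi) * (2 + (γ - 1) * p + (γ - 1) * (2 - γ) * p ^ 2) =
      sonicDensity γ p * p := by
    have := Real.pi_pos
    rw [sonicDensity]; field_simp
  have e2 : p ^ 2 = p ^ (γ - 1) * p ^ (3 - γ) := by
    rw [← Real.rpow_add hp, ← Real.rpow_natCast]
    congr 1
    norm_num
  rw [sonicPoint_sq h₁ h₂ hp, e, Real.mul_rpow hρ.le hp.le, e2]
  ring

lemma sonicPoint_strictMonoOn (h₁ : 1 < γ) (h₂ : γ < 4 / 3) :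
    StrictMonoOn (sonicPoint γ) (Ioi 0) := by
  intro p hp q hq hpq
  have hp' : 0 < p := hp
  have hq' : 0 < q := hq
  have ha : 0 < 4 - 3 * γ := by linarith
  have h2γ : 0 < 2 - γ := by linarith
  have hγ : 0 < γ - 1 := by linarith
  have hγ0 : 0 < γ := by linarith
  have h3γ : 0 < 3 - γ := by linarith
  refine lt_of_pow_lt_pow_left₀ 2 (sonicPoint_pos h₁ h₂ hq').le ?_
  rw [sonicPoint_sq_eq h₁ h₂ hp', sonicPoint_sq_eq h₁ h₂ hq']
  gcongr

lemma continuousOn_sonicPoint (h₁ : 1 < γ) (h₂ : γ < 4 / 3) :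
    ContinuousOn (sonicPoint γ) (Ioi 0) := by
  intro p hp
  have hp0 : p ≠ 0 := ne_of_gt hp
  have hρ := (sonicDensity_pos h₁ h₂ hp).ne'
  refine ContinuousAt.continuousWithinAt ?_
  have h1 : ContinuousAt (sonicDensity γ) p := by
    unfold sonicDensity
    fun_prop (disch := assumption)
  have h2 : ContinuousAt (fun p => sonicDensity γ p ^ (γ - 1)) p := h1.rpow_const (Or.inl hρ)
  exact continuousAt_id.mul (Real.continuous_sqrt.continuousAt.comp (h2.const_mul γ))

lemma sonicPoint_farField (h₁ : 1 < γ) (h₂ : γ < 4 / 3) : sonicPoint γ (1 / (2 - γ)) = yf γ := by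
  have ha : 0 < 4 - 3 * γ := by linarith
  have h2γ : 0 < 2 - γ := by linarith
  have hπ := Real.pi_pos
  have e : sonicDensity γ (1 / (2 - γ)) = (4 - 3 * γ) / (2 * Real.pi) := by
    rw [sonicDensity]; field_simp; ring
  rw [sonicPoint, yf, e, Real.sqrt_mul (by linarith), Real.sqrt_eq_rpow (_ ^ (γ - 1)),
    ← Real.rpow_mul (by positivity)]
  ring_nf

lemma sonicPoint_friedman (h₂ : γ < 4 / 3) : sonicPoint γ (3 / (4 - 3 * γ)) = yF γ := by
  have ha : 0 < 4 - 3 * γ := by linarith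
  have hπ := Real.pi_pos
  have e : sonicDensity γ (3 / (4 - 3 * γ)) = (6 * Real.pi)⁻¹ := by
    rw [sonicDensity]; field_simp; ring
  rw [sonicPoint, yF, e, Real.inv_rpow (by positivity), div_eq_mul_inv γ]

/-- `h` is affine in `ρ`, with `sonicDensity` as its zero. -/
lemma h_inv (h₂ : γ < 4 / 3) (hp : 0 < p) (ρ : ℝ) :
    h γ ρ p⁻¹ = 4 * Real.pi / ((4 - 3 * γ) * p) * (sonicDensity γ p - ρ) := by
  have ha : 4 - 3 * γ ≠ 0 := by linarith
  have hπ := Real.pi_pos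
  rw [h, sonicDensity]
  generalize 4 - 3 * γ = a at *
  field_simp
  ring

end SonicPoint

/-- The slope at the sonic point is the coefficient of Larson-Penston-Hunter type. -/
lemma R₁_inv {γ p v : ℝ} (h₁ : 1 < γ) (hp : 0 < p) (hq : sonicPoly γ v p = 0)
    (hd : sonicPolyDeriv γ v p < 0) : R₁ γ p⁻¹ = slope γ v p := by
  have hγ : γ + 1 ≠ 0 := by linarith
  set K := sonicPolyDeriv γ v p with hK
  -- At a root of a quadratic the discriminant is the square of the derivative. As `K < 0`, the
  -- square root in `R₁` is `-p⁻¹ ^ 3 * K`, and the minus sign in `R₁` selects the root at hand.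
  have e : p⁻¹ ^ 3 * branchPoly γ p⁻¹ = (p⁻¹ ^ 3 * K) ^ 2 := by
    have h1 : K ^ 2 = (8 - (9 - 7 * γ) * p) ^ 2
        - 4 * (γ + 1) * ((3 - (4 - 3 * γ) * p) * (2 - (γ - 1) * (2 - γ) * p ^ 2)) := by
      simp only [sonicPoly, smul_eq_mul] at hq
      rw [hK, sonicPolyDeriv]
      linear_combination 4 * (γ + 1) * hq
    rw [mul_pow, h1, branchPoly]
    field_simp
    ring
  rw [R₁, e, Real.sqrt_sq_eq_abs, abs_of_neg (mul_neg_of_pos_of_neg (by positivity) hd)]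
  rw [hK, sonicPolyDeriv]
  field_simp
  ring

/-! ### From sonic curves to flows. -/

namespace IsSonicCurve

variable {γ p T : ℝ} {v w m : ℝ → ℝ}

/-- By analyticity the equations of a sonic curve hold on both sides of the sonic point. -/
lemma exists_two_sided (h : IsSonicCurve γ p T v w m) (hp : 0 < p) (hT : 0 < T) :
    ∃ δ > 0, ∀ τ ∈ Ioo (-δ) T, 0 < w τ ∧ 0 < 1 + m τ ∧ HasDerivAt v (deriv v τ) τ ∧
      m τ * deriv v τ = sonicPoly γ (v τ) (w τ) - m τ * driftPoly γ (v τ) (w τ) ∧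
      HasDerivAt w (-(w τ * v τ)) τ ∧
      HasDerivAt m (-((1 + m τ) * machRate γ (v τ) (w τ))) τ := by
  have hv := h.analytic_v
  have hw := h.analytic_w
  have hm := h.analytic_m
  have key : ∀ f : ℝ → ℝ, AnalyticAt ℝ f 0 → (∀ τ ∈ Ioo 0 T, f τ = 0) → ∀ᶠ τ in 𝓝 0, f τ = 0 :=
    fun f hf h0 => by
      rw [← hf.frequently_zero_iff_eventually_zero]
      have h1 : ∃ᶠ τ in 𝓝[>] (0 : ℝ), f τ = 0 :=
        ((show ∀ᶠ τ in 𝓝[>] (0 : ℝ), τ ∈ Ioo 0 T from Ioo_mem_nhdsGT hT).mono h0).frequently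
      exact h1.filter_mono (nhdsWithin_mono _ fun x (hx : 0 < x) => hx.ne')
  have k1 := key (fun τ => m τ * deriv v τ - (sonicPoly γ (v τ) (w τ)
      - m τ * driftPoly γ (v τ) (w τ))) (by
        have := hv.deriv
        simp only [sonicPoly, driftPoly, slope, smul_eq_mul]
        fun_prop) (fun τ hτ => by
        have := (h.m_pos τ hτ).ne'
        simp only [(h.deriv_v τ hτ).deriv]
        field_simp
        ring)
  have k2 := key (fun τ => deriv w τ - -(w τ * v τ)) (by
        have := hw.deriv
        fun_prop) (fun τ hτ => by simp only [(h.deriv_w τ hτ).deriv, sub_self])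
  have k3 := key (fun τ => deriv m τ - -((1 + m τ) * machRate γ (v τ) (w τ))) (by
        have := hm.deriv
        simp only [machRate, slope, smul_eq_mul]
        fun_prop) (fun τ hτ => by simp only [(h.deriv_m τ hτ).deriv, sub_self])
  have k4 : ∀ᶠ τ in 𝓝 0, 0 < w τ :=
    hw.continuousAt.eventually_const_lt (by rw [h.w_zero]; exact hp)
  have k5 : ∀ᶠ τ in 𝓝 0, 0 < 1 + m τ :=
    (hm.continuousAt.const_add 1).eventually_const_lt (by simp [h.m_zero])
  obtain ⟨δ, hδ, hball⟩ := Metric.eventually_nhds_iff_ball.1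
    (k1.and (k2.and (k3.and (k4.and (k5.and (hv.eventually_analyticAt.and
      (hw.eventually_analyticAt.and hm.eventually_analyticAt)))))))
  refine ⟨δ, hδ, fun τ hτ => ?_⟩
  rcases le_or_gt τ 0 with hle | hgt
  · obtain ⟨e1, e2, e3, e4, e5, e6, e7, e8⟩ := hball τ (by
      rw [Metric.mem_ball, Real.dist_eq, sub_zero, abs_lt]
      exact ⟨hτ.1, hle.trans_lt hδ⟩)
    refine ⟨e4, e5, e6.differentiableAt.hasDerivAt, sub_eq_zero.1 e1, ?_, ?_⟩
    · rw [← sub_eq_zero.1 e2]; exact e7.differentiableAt.hasDerivAt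
    · rw [← sub_eq_zero.1 e3]; exact e8.differentiableAt.hasDerivAt
  · have hm0 := h.m_pos τ ⟨hgt, hτ.2⟩
    have hdv := h.deriv_v τ ⟨hgt, hτ.2⟩
    refine ⟨h.w_pos hp τ ⟨hgt.le, hτ.2⟩, by linarith, hdv.differentiableAt.hasDerivAt, ?_,
      h.deriv_w τ ⟨hgt, hτ.2⟩, h.deriv_m τ ⟨hgt, hτ.2⟩⟩
    rw [hdv.deriv]
    field_simp

end IsSonicCurve

/-- The relative velocity at `y` of the flow described by a curve in the variable `log (ys / y)`. -/
def curveVelocity (ys : ℝ) (w : ℝ → ℝ) (y : ℝ) : ℝ := (w (Real.log (ys / y)))⁻¹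

/-- The density at `y` of the flow described by a curve in the variable `log (ys / y)`. -/
def curveDensity (γ ys : ℝ) (w m : ℝ → ℝ) (y : ℝ) : ℝ :=
  ((1 + m (Real.log (ys / y))) * y ^ 2 / (γ * w (Real.log (ys / y)) ^ 2)) ^ (γ - 1)⁻¹

lemma hasDerivAt_log_div {ys y : ℝ} (hys : 0 < ys) (hy : 0 < y) :
    HasDerivAt (fun y => Real.log (ys / y)) (-y⁻¹) y := by
  have h1 : HasDerivAt (fun y => Real.log ys - Real.log y) (0 - y⁻¹) y :=
    (hasDerivAt_const y _).sub (Real.hasDerivAt_log hy.ne')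
  rw [zero_sub] at h1
  refine h1.congr_of_eventuallyEq ?_
  filter_upwards [eventually_gt_nhds hy] with z hz
  rw [Real.log_div hys.ne' hz.ne']

/-- The flow described by a curve: derivatives and sonic function at a point. -/
lemma curve_flow_derivatives {γ ys y : ℝ} {v w m : ℝ → ℝ} (h₁ : 1 < γ) (hys : 0 < ys) (hy : 0 < y)
    (hw : 0 < w (Real.log (ys / y))) (hm : 0 < 1 + m (Real.log (ys / y)))
    (hdw : HasDerivAt w (-(w (Real.log (ys / y)) * v (Real.log (ys / y)))) (Real.log (ys / y)))
    (hdm : HasDerivAt m (-((1 + m (Real.log (ys / y))) *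
      machRate γ (v (Real.log (ys / y))) (w (Real.log (ys / y))))) (Real.log (ys / y))) :
    0 < curveDensity γ ys w m y ∧
    G γ y (curveDensity γ ys w m y) (curveVelocity ys w y) =
      m (Real.log (ys / y)) * (y * curveVelocity ys w y) ^ 2 ∧
    HasDerivAt (curveVelocity ys w) (-(curveVelocity ys w y * v (Real.log (ys / y)) / y)) y ∧
    HasDerivAt (curveDensity γ ys w m) (curveDensity γ ys w m y *
      slope γ (v (Real.log (ys / y))) (w (Real.log (ys / y))) / y) y := by
  have hγ : 0 < γ - 1 := by linarith
  have hγ0 : 0 < γ := by linarith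
  have hτ := hasDerivAt_log_div hys hy
  have hcw := hdw.comp y hτ
  have hcm := hdm.comp y hτ
  set τ := Real.log (ys / y) with hτdef
  have hX : 0 < (1 + m τ) * y ^ 2 / (γ * w τ ^ 2) := by positivity
  refine ⟨Real.rpow_pos_of_pos hX _, ?_, ?_, ?_⟩
  · have e : curveDensity γ ys w m y ^ (γ - 1) = (1 + m τ) * y ^ 2 / (γ * w τ ^ 2) := by
      rw [curveDensity, ← hτdef, ← Real.rpow_mul hX.le, inv_mul_cancel₀ hγ.ne', Real.rpow_one]
    rw [G, e, curveVelocity, ← hτdef]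
    field_simp
    ring
  · have := hcw.inv hw.ne'
    convert! this using 1
    simp only [curveVelocity, ← hτdef, Function.comp_apply]
    field_simp
  · have hnum := (hcm.const_add 1).mul (hasDerivAt_pow 2 y)
    have hden := (hcw.pow 2).const_mul γ
    have hq := (hnum.div hden (by
      simp only [Function.comp_apply, Pi.pow_apply]
      positivity)).rpow_const (p := (γ - 1)⁻¹) (Or.inl hX.ne')
    convert! hq using 1
    have e : curveDensity γ ys w m y = ((1 + m τ) * y ^ 2 / (γ * w τ ^ 2)) ^ (γ - 1)⁻¹ := rfl
    simp only [Function.comp_apply, Pi.mul_apply, Pi.pow_apply, Pi.div_apply, ← hτdef]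
    rw [e, Real.rpow_sub_one hX.ne', machRate, slope]
    simp only [smul_eq_mul]
    field_simp
    push_cast
    ring

/-- Along a curve, the function `h` is determined by the slope. -/
lemma hasDerivAt_h_defect {γ y : ℝ} {ρ ω V W M : ℝ → ℝ} {dv : ℝ} (h₂ : γ < 4 / 3) (hy : 0 < y)
    (hW : W y ≠ 0) (hωW : ω y = (W y)⁻¹) (hω : HasDerivAt ω (-(ω y * V y / y)) y)
    (hρ : HasDerivAt ρ (ρ y * slope γ (V y) (W y) / y) y)
    (hV : HasDerivAt V (dv * -y⁻¹) y) (hWd : HasDerivAt W (W y * V y / y) y)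
    (hM : HasDerivAt M ((1 + M y) * machRate γ (V y) (W y) / y) y)
    (hdv : M y * dv = sonicPoly γ (V y) (W y) - M y * driftPoly γ (V y) (W y)) :
    HasDerivAt (fun y => h γ (ρ y) (ω y) - M y * slope γ (V y) (W y) * ω y ^ 2)
      (((4 - 3 * γ) * W y - 3) / y *
        (h γ (ρ y) (ω y) - M y * slope γ (V y) (W y) * ω y ^ 2)) y := by
  have ha : 4 - 3 * γ ≠ 0 := by linarith
  have hS := hasDerivAt_slope γ hV hWd
  have hh := (((((hω.pow 2).const_mul 2).add (hω.const_mul (γ - 1))).sub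
    (((hρ.const_mul (4 * Real.pi)).mul hω).div_const (4 - 3 * γ))).add_const
      ((γ - 1) * (2 - γ))).sub ((hM.mul hS).mul (hω.pow 2))
  convert! hh using 1
  simp only [Pi.pow_apply, Pi.mul_apply, smul_eq_mul, h, hωW]
  simp only [sonicPoly, driftPoly, machRate, slope, smul_eq_mul] at hdv ⊢
  push_cast
  field_simp
  linear_combination (-(4 - 3 * γ)) * hdv

namespace IsSonicCurve

variable {γ p T : ℝ} {v w m : ℝ → ℝ}

/-- A sonic curve describes a solution of Larson-Penston-Hunter type. -/
theorem isLPHSolutionOn (h : IsSonicCurve γ p T v w m) (h₁ : 1 < γ) (h₂ : γ < 4 / 3) (hp : 0 < p)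
    (hT : 0 < T) : IsLPHSolutionOn γ (sonicPoint γ p) (sonicPoint γ p * Real.exp (-T))
      (curveDensity γ (sonicPoint γ p) w m) (curveVelocity (sonicPoint γ p) w) := by
  have ha : 0 < 4 - 3 * γ := by linarith
  have hγ : 0 < γ - 1 := by linarith
  have hγ0 : 0 < γ := by linarith
  have hys := sonicPoint_pos h₁ h₂ hp
  have hys2 := sonicPoint_sq h₁ h₂ hp
  have hρs := sonicDensity_pos h₁ h₂ hp
  set ys := sonicPoint γ p with hysdef
  obtain ⟨δ, hδ, hcurve⟩ := h.exists_two_sided hp hT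
  set ρ := curveDensity γ ys w m with hρ
  set ω := curveVelocity ys w with hω
  set τ : ℝ → ℝ := fun y => Real.log (ys / y) with hτ
  set I := Ioo (ys * Real.exp (-T)) (ys * Real.exp δ) with hI
  have hIpos : ∀ y ∈ I, 0 < y := fun y hy => (mul_pos hys (Real.exp_pos _)).trans hy.1
  have hIτ : ∀ y ∈ I, τ y ∈ Ioo (-δ) T := fun y hy => by
    have hy0 := hIpos y hy
    constructor
    · rw [hτ, Real.lt_log_iff_exp_lt (by positivity), lt_div_iff₀ hy0, Real.exp_neg,
        inv_mul_lt_iff₀ (Real.exp_pos _), mul_comm]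
      exact hy.2
    · rw [hτ, Real.log_lt_iff_lt_exp (by positivity), div_lt_iff₀ hy0]
      have := hy.1
      rwa [Real.exp_neg, ← div_eq_mul_inv, div_lt_iff₀ (Real.exp_pos _), mul_comm] at this
  have hysI : ys ∈ I := ⟨by
      have : Real.exp (-T) < 1 := by simpa using hT
      nlinarith, by
      have := Real.one_lt_exp_iff.2 hδ; nlinarith⟩
  have hτs : τ ys = 0 := by simp [hτ]
  have hflow := fun y hy => curve_flow_derivatives (v := v) h₁ hys (hIpos y hy)
    (hcurve (τ y) (hIτ y hy)).1 (hcurve (τ y) (hIτ y hy)).2.1 (hcurve (τ y) (hIτ y hy)).2.2.2.2.1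
    (hcurve (τ y) (hIτ y hy)).2.2.2.2.2
  have hV : ∀ y ∈ I, HasDerivAt (fun y => v (τ y)) (deriv v (τ y) * -y⁻¹) y := fun y hy =>
    (hcurve (τ y) (hIτ y hy)).2.2.1.comp y (hasDerivAt_log_div hys (hIpos y hy))
  have hW : ∀ y ∈ I, HasDerivAt (fun y => w (τ y)) (w (τ y) * v (τ y) / y) y := fun y hy => by
    have := (hcurve (τ y) (hIτ y hy)).2.2.2.2.1.comp y (hasDerivAt_log_div hys (hIpos y hy))
    convert! this using 1
    ring
  have hM : ∀ y ∈ I, HasDerivAt (fun y => m (τ y))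
      ((1 + m (τ y)) * machRate γ (v (τ y)) (w (τ y)) / y) y := fun y hy => by
    have := (hcurve (τ y) (hIτ y hy)).2.2.2.2.2.comp y (hasDerivAt_log_div hys (hIpos y hy))
    convert! this using 1
    ring
  have hωs : ω ys = p⁻¹ := by
    have : ω ys = (w (τ ys))⁻¹ := rfl
    rw [this, hτs, h.w_zero]
  have hρys : ρ ys = sonicDensity γ p := by
    have : ρ ys = ((1 + m (τ ys)) * ys ^ 2 / (γ * w (τ ys) ^ 2)) ^ (γ - 1)⁻¹ := rfl
    rw [this, hτs, h.w_zero, h.m_zero, hys2, add_zero, one_mul,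
      show p ^ 2 * (γ * sonicDensity γ p ^ (γ - 1)) / (γ * p ^ 2) = sonicDensity γ p ^ (γ - 1) by
        field_simp,
      ← Real.rpow_mul hρs.le, mul_inv_cancel₀ hγ.ne', Real.rpow_one]
  have hhs : SelfSimilarEP.h γ (ρ ys) (ω ys) = 0 := by
    rw [hωs, hρys, h_inv h₂ hp, sub_self, mul_zero]
  -- The equation of `v` is a differentiated form of the flow equations. The defect `h - m S ω²`
  -- solves a homogeneous linear equation and vanishes at the sonic point, where `h = m = 0`, so the
  -- original equations are recovered.
  have hdef : ∀ y ∈ I, SelfSimilarEP.h γ (ρ y) (ω y) =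
      m (τ y) * slope γ (v (τ y)) (w (τ y)) * ω y ^ 2 := fun y hy => by
    refine sub_eq_zero.1 (eq_zero_of_linear (k := fun y => ((4 - 3 * γ) * w (τ y) - 3) / y) hysI
      (f := fun y => SelfSimilarEP.h γ (ρ y) (ω y)
        - m (τ y) * slope γ (v (τ y)) (w (τ y)) * ω y ^ 2)
      (fun y hy => ?_) (fun y hy => ?_) ?_ y hy)
    · refine ContinuousAt.continuousWithinAt ?_
      exact (((hW y hy).continuousAt.const_mul (4 - 3 * γ)).sub continuousAt_const).div
        continuousAt_id (hIpos y hy).ne'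
    · obtain ⟨f1, f2, f3, f4⟩ := hflow y hy
      obtain ⟨c1, c2, c3, c4, c5, c6⟩ := hcurve (τ y) (hIτ y hy)
      exact hasDerivAt_h_defect h₂ (hIpos y hy) c1.ne' rfl f3 f4 (hV y hy) (hW y hy) (hM y hy) c4
    · rw [hhs, hτs, h.m_zero]; ring
  have hInhds : I ∈ 𝓝 ys := Ioo_mem_nhds hysI.1 hysI.2
  have han : ∀ {f : ℝ → ℝ}, AnalyticAt ℝ f 0 → AnalyticAt ℝ (fun y => f (τ y)) ys :=
      fun {f} hf => by
    have h1 : AnalyticAt ℝ τ ys := by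
      have : AnalyticAt ℝ (fun y => ys / y) ys := by fun_prop (disch := exact hys.ne')
      exact this.log (by rw [div_self hys.ne']; exact one_pos)
    exact AnalyticAt.fun_comp (by rw [hτs]; exact hf) h1
  have hwan := han h.analytic_w
  have hman := han h.analytic_m
  have hG : ∀ y ∈ I, G γ y (ρ y) (ω y) = m (τ y) * (y * ω y) ^ 2 := fun y hy => (hflow y hy).2.1
  have hωpos : ∀ y ∈ I, 0 < ω y := fun y hy => inv_pos.2 (hcurve (τ y) (hIτ y hy)).1
  have hωeq : ∀ y ∈ I, -(ω y * v (τ y) / y) =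
      (4 - 3 * γ - 3 * ω y) / y - ω y * slope γ (v (τ y)) (w (τ y)) / y := fun y hy => by
    have hw0 := (hcurve (τ y) (hIτ y hy)).1.ne'
    have hy0 := (hIpos y hy).ne'
    have e : ω y * w (τ y) = 1 := inv_mul_cancel₀ hw0
    simp only [slope, smul_eq_mul]
    field_simp
    linear_combination (4 - 3 * γ) * e
  have hsub : ∀ y ∈ Ioo (ys * Real.exp (-T)) ys, y ∈ I ∧ 0 < m (τ y) := fun y hy => by
    have hyI : y ∈ I := ⟨hy.1, hy.2.trans hysI.2⟩
    refine ⟨hyI, h.m_pos _ ⟨?_, (hIτ y hyI).2⟩⟩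
    exact Real.log_pos ((one_lt_div (hIpos y hyI)).2 hy.2)
  refine { analytic_rho := ?_, analytic_omega := ?_, rho_pos := ?_, sonic := ?_, h_eq_zero := hhs,
           rho_one := ?_, omega_one := ?_, eq_rho := ?_, eq_omega := ?_, hasDeriv_rho := ?_,
           hasDeriv_omega := ?_, subsonic := ?_ }
  · have hX : 0 < (1 + m (τ ys)) * ys ^ 2 / (γ * w (τ ys) ^ 2) := by
      rw [hτs, h.m_zero, h.w_zero]; positivity
    have hden : γ * w (τ ys) ^ 2 ≠ 0 := by rw [hτs, h.w_zero]; positivity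
    have h1 : AnalyticAt ℝ (fun y => (1 + m (τ y)) * y ^ 2 / (γ * w (τ y) ^ 2)) ys :=
      ((analyticAt_const.add hman).mul (analyticAt_id.pow 2)).div
        (analyticAt_const.mul (hwan.pow 2)) hden
    -- The real power is written as `exp (log · * c)` to obtain analyticity at a positive base.
    have h2 : AnalyticAt ℝ (fun y => Real.exp (Real.log
        ((1 + m (τ y)) * y ^ 2 / (γ * w (τ y) ^ 2)) * (γ - 1)⁻¹)) ys :=
      ((h1.log hX).mul analyticAt_const).rexp
    refine h2.congr ?_
    filter_upwards [h1.continuousAt.eventually_const_lt hX] with y hy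
    exact (Real.rpow_def_of_pos hy _).symm
  · exact hwan.inv (by rw [hτs, h.w_zero]; exact hp.ne')
  · rw [hρys]; exact hρs
  · rw [hG ys hysI, hτs, h.m_zero, zero_mul]
  · have := (hflow ys hysI).2.2.2.deriv
    change deriv ρ ys = ρ ys * slope γ (v (τ ys)) (w (τ ys)) / ys at this
    rw [this, hωs, R₁_inv h₁ hp h.root h.root_lt, hτs, h.w_zero]
  · have := (hflow ys hysI).2.2.1.deriv
    change deriv ω ys = -(ω ys * v (τ ys) / ys) at this
    rw [this, hωeq ys hysI, W₁, hωs, R₁_inv h₁ hp h.root h.root_lt, hτs, h.w_zero]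
    ring
  · filter_upwards [hInhds] with y hy
    have hd : deriv ρ y = ρ y * slope γ (v (τ y)) (w (τ y)) / y := (hflow y hy).2.2.2.deriv
    have := (hIpos y hy).ne'
    rw [hd, hG y hy, hdef y hy]
    field_simp
  · filter_upwards [hInhds] with y hy
    have hd : deriv ω y = -(ω y * v (τ y) / y) := (hflow y hy).2.2.1.deriv
    have := (hIpos y hy).ne'
    rw [hd, hωeq y hy, hG y hy, hdef y hy]
    field_simp
  · intro y hy
    obtain ⟨hyI, hm0⟩ := hsub y hy
    have h0 := (hIpos y hyI)
    have h1 := (hωpos y hyI)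
    convert! (hflow y hyI).2.2.2 using 1
    rw [hG y hyI, hdef y hyI]
    field_simp
    rfl
  · intro y hy
    obtain ⟨hyI, hm0⟩ := hsub y hy
    have h0 := (hIpos y hyI)
    have h1 := (hωpos y hyI)
    have hd : HasDerivAt ω (-(ω y * v (τ y) / y)) y := (hflow y hyI).2.2.1
    convert! hd using 1
    rw [hωeq y hyI, hG y hyI, hdef y hyI]
    field_simp
  · intro y hy
    obtain ⟨hyI, hm0⟩ := hsub y hy
    rw [hG y hyI]
    exact mul_pos hm0 (pow_pos (mul_pos (hIpos y hyI) (hωpos y hyI)) 2)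

end IsSonicCurve

/-! ### From flows to sonic curves. -/

/-- The quotient `G / (y ω)²` along a flow. -/
def machExcess (γ y ρ ω : ℝ) : ℝ := G γ y ρ ω / (y * ω) ^ 2

section FlowDerivatives

variable {γ y S V : ℝ} {ρ ω : ℝ → ℝ}

/-- Since `1 + machExcess = γ ρ ^ (γ - 1) / (y ω)²`, its logarithmic derivative is linear in the
slopes of `ρ` and `ω`. -/
lemma hasDerivAt_machExcess (hy : 0 < y) (hρ0 : 0 < ρ y) (hω0 : 0 < ω y)
    (hV : V = S + 3 - (4 - 3 * γ) * (ω y)⁻¹)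
    (hρ : HasDerivAt ρ (ρ y * S / y) y) (hω : HasDerivAt ω (-(ω y * V / y)) y) :
    HasDerivAt (fun y => machExcess γ y (ρ y) (ω y))
      ((1 + machExcess γ y (ρ y) (ω y)) * machRate γ V (ω y)⁻¹ / y) y := by
  have hG := ((hρ.rpow_const (p := γ - 1) (Or.inl hρ0.ne')).const_mul γ).sub
    ((hasDerivAt_pow 2 y).mul (hω.pow 2))
  have hd := (((hasDerivAt_id y).mul hω).pow 2)
  have hne : (y * ω y) ^ 2 ≠ 0 := by positivity
  convert! hG.div hd hne using 1
  simp only [machExcess, G, Pi.mul_apply, Pi.pow_apply, Pi.sub_apply, id,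
    Real.rpow_sub_one hρ0.ne']
  simp only [machRate, slope, smul_eq_mul, hV]
  generalize ρ y ^ (γ - 1) = X
  push_cast
  field_simp
  ring

lemma hasDerivAt_h (h₂ : γ < 4 / 3) (hρ : HasDerivAt ρ (ρ y * S / y) y)
    (hω : HasDerivAt ω (-(ω y * V / y)) y) :
    HasDerivAt (fun y => h γ (ρ y) (ω y)) ((-(4 * ω y ^ 2 + (γ - 1) * ω y) * V
      - (2 * ω y ^ 2 + (γ - 1) * ω y + (γ - 1) * (2 - γ) - h γ (ρ y) (ω y)) * (S - V)) / y) y := by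
  have ha : 4 - 3 * γ ≠ 0 := by linarith
  have hh := ((((hω.pow 2).const_mul 2).add (hω.const_mul (γ - 1))).sub
    (((hρ.const_mul (4 * Real.pi)).mul hω).div_const (4 - 3 * γ))).add_const
      ((γ - 1) * (2 - γ))
  convert! hh using 1
  simp only [h]
  push_cast
  generalize 4 - 3 * γ = a at *
  field_simp
  ring

/-- Along a flow the differentiated quotient is `y² h / G`, the slope `y ρ' / ρ` itself. This
computation is the source of the equation of `v`. -/
lemma hasDerivAt_flow_slope (h₂ : γ < 4 / 3) (hy : 0 < y) (hρ0 : 0 < ρ y) (hω0 : 0 < ω y)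
    (hG : 0 < G γ y (ρ y) (ω y)) (hV : V = S + 3 - (4 - 3 * γ) * (ω y)⁻¹)
    (hS : S = y ^ 2 * h γ (ρ y) (ω y) / G γ y (ρ y) (ω y))
    (hρ : HasDerivAt ρ (ρ y * S / y) y) (hω : HasDerivAt ω (-(ω y * V / y)) y) :
    HasDerivAt (fun y => h γ (ρ y) (ω y) / (machExcess γ y (ρ y) (ω y) * ω y ^ 2))
      ((driftPoly γ V (ω y)⁻¹ - sonicPoly γ V (ω y)⁻¹ / machExcess γ y (ρ y) (ω y)
        + (4 - 3 * γ) * ((ω y)⁻¹ * V)) / y) y := by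
  have hM0 : 0 < machExcess γ y (ρ y) (ω y) := by unfold machExcess; positivity
  have hhS : h γ (ρ y) (ω y) = machExcess γ y (ρ y) (ω y) * S * ω y ^ 2 := by
    rw [hS, machExcess]; field_simp
  have hM := hasDerivAt_machExcess hy hρ0 hω0 hV hρ hω
  have hh := hasDerivAt_h h₂ hρ hω
  have := hh.div (hM.mul (hω.pow 2)) (by simp only [Pi.mul_apply, Pi.pow_apply]; positivity)
  convert! this using 1
  simp only [Pi.mul_apply, Pi.pow_apply, hhS]
  clear hhS this hh hM hS
  generalize machExcess γ y (ρ y) (ω y) = M at *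
  simp only [driftPoly, sonicPoly, machRate, slope, smul_eq_mul, hV]
  push_cast
  field_simp
  ring

end FlowDerivatives

/-- The values at the sonic point are determined by its position. -/
lemma IsLPHAt.sonic_values {γ p : ℝ} {ρ ω : ℝ → ℝ} (h₁ : 1 < γ) (h₂ : γ < 4 / 3) (hp : 0 < p)
    (hs : IsLPHAt γ (sonicPoint γ p) ρ ω) :
    ω (sonicPoint γ p) = p⁻¹ ∧ ρ (sonicPoint γ p) = sonicDensity γ p := by
  have ha : 0 < 4 - 3 * γ := by linarith
  have hγ0 : 0 < γ := by linarith
  have hys := sonicPoint_pos h₁ h₂ hp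
  have hinj := (sonicPoint_strictMonoOn h₁ h₂).injOn
  have hG := hs.sonic
  have hh := hs.h_eq_zero
  have hρ := hs.rho_pos
  set ys := sonicPoint γ p with hysdef
  set r := ρ ys
  set o := ω ys
  have hX : 0 < γ * r ^ (γ - 1) := by positivity
  have ho : 0 < o := by
    by_contra! hle
    have h0 : o ≠ 0 := by
      rintro h0
      rw [G, h0] at hG
      linarith
    have hlt : o < 0 := hle.lt_of_ne h0
    have hterm : 4 * Real.pi * r * o / (4 - 3 * γ) < 0 :=
      div_neg_of_neg_of_pos (mul_neg_of_pos_of_neg (by have := Real.pi_pos; positivity) hlt) ha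
    rw [h] at hh
    -- The quadratic part of `h` has discriminant `-(γ - 1)(17 - 9γ) < 0`, so for `o < 0` every
    -- contribution to `h` is positive and `h = 0` is impossible.
    nlinarith [sq_nonneg (4 * o + (γ - 1)), mul_pos (sub_pos.2 h₁) (by linarith : 0 < 17 - 9 * γ)]
  have hr : r = sonicDensity γ o⁻¹ := by
    have hk := h_inv h₂ (inv_pos.2 ho) r
    rw [inv_inv, hh] at hk
    have hc : 4 * Real.pi / ((4 - 3 * γ) * o⁻¹) ≠ 0 := by
      have := Real.pi_pos
      positivity
    have := (mul_eq_zero.1 hk.symm).resolve_left hc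
    linarith
  have hys' : ys = sonicPoint γ o⁻¹ := by
    have h1 : ys ^ 2 = sonicPoint γ o⁻¹ ^ 2 := by
      rw [sonicPoint_sq h₁ h₂ (inv_pos.2 ho), ← hr]
      rw [G] at hG
      field_simp
      linarith
    exact (pow_left_inj₀ hys.le (sonicPoint_pos h₁ h₂ (inv_pos.2 ho)).le two_ne_zero).1 h1
  have hpo : p = o⁻¹ := hinj hp (inv_pos.2 ho) hys'
  exact ⟨by rw [hpo, inv_inv], by rw [hr, hpo]⟩

/-- A solution of Larson-Penston-Hunter type is, near its sonic point, described by a sonic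
curve. -/
lemma IsLPHSolutionOn.exists_sonicCurve {γ p a₀ : ℝ} {ρ ω : ℝ → ℝ} (h₁ : 1 < γ) (h₂ : γ < 4 / 3)
    (hp : 1 / (2 - γ) ≤ p) (hp' : (4 - 3 * γ) * p ≤ 3)
    (hs : IsLPHSolutionOn γ (sonicPoint γ p) a₀ ρ ω) (ha₀ : a₀ < sonicPoint γ p) :
    ∃ η > 0, ∃ v w m : ℝ → ℝ, IsSonicCurve γ p η v w m ∧
      ∀ᶠ y in 𝓝[<] sonicPoint γ p, ω y = curveVelocity (sonicPoint γ p) w y ∧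
        ρ y = curveDensity γ (sonicPoint γ p) w m y := by
  have hp0 : 0 < p := (one_div_pos.2 (by linarith)).trans_le hp
  have hγ : 0 < γ - 1 := by linarith
  have hγ0 : 0 < γ := by linarith
  have hys := sonicPoint_pos h₁ h₂ hp0
  obtain ⟨hω, hρ⟩ := hs.toIsLPHAt.sonic_values h₁ h₂ hp0
  have hG0 := hs.sonic
  set ys := sonicPoint γ p with hysdef
  set a := 4 - 3 * γ with hadef
  have hωc := hs.analytic_omega.continuousAt
  have hρc := hs.analytic_rho.continuousAt
  have hev : ∀ᶠ y in 𝓝 ys, 0 < y ∧ 0 < ω y ∧ 0 < ρ y :=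
    (eventually_gt_nhds hys).and ((hωc.eventually_const_lt (by rw [hω]; positivity)).and
      (hρc.eventually_const_lt hs.rho_pos))
  obtain ⟨b, hb, hbs⟩ := mem_nhdsLT_iff_exists_Ioo_subset.1
    (inter_mem (nhdsWithin_le_nhds (s := Iio ys) hev) (Ioo_mem_nhdsLT ha₀))
  have hbys : b < ys := hb
  have hprop : ∀ y ∈ Ioo b ys, (0 < y ∧ 0 < ω y ∧ 0 < ρ y) ∧ y ∈ Ioo a₀ ys := fun y hy => hbs hy
  set S : ℝ → ℝ := fun y => y * deriv ρ y / ρ y with hS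
  -- The inverse of `y ↦ log (ys / y)`.
  set Y : ℝ → ℝ := fun τ => ys * Real.exp (-τ) with hY
  have hYd : ∀ τ, HasDerivAt Y (-(Y τ)) τ := fun τ => by
    convert! ((hasDerivAt_id τ).neg.exp).const_mul ys using 1
    simp only [hY, Pi.neg_apply, id]
    ring
  have hY0 : Y 0 = ys := by simp [hY]
  have hYan : AnalyticAt ℝ Y 0 := by rw [hY]; fun_prop
  have hcomp : ∀ {f : ℝ → ℝ}, AnalyticAt ℝ f ys → AnalyticAt ℝ (fun τ => f (Y τ)) 0 :=
    fun {f} hf => AnalyticAt.fun_comp (by rw [hY0]; exact hf) hYan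
  have hωan := hcomp hs.analytic_omega
  have hρan := hcomp hs.analytic_rho
  have hdρan := hcomp hs.analytic_rho.deriv
  have hω0 : ω (Y 0) ≠ 0 := by rw [hY0, hω]; positivity
  have hρ0 : 0 < ρ (Y 0) := by rw [hY0]; exact hs.rho_pos
  have hSs : S ys = slope γ (lowerRoot γ p) p := by
    have hρne := hs.rho_pos.ne'
    rw [hS]
    simp only
    rw [hs.rho_one, hω, R₁_inv h₁ hp0 (sonicPoly_lowerRoot h₁ h₂ hp hp')
      (sonicPolyDeriv_lowerRoot_neg h₁ h₂ hp hp')]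
    field_simp
  have hv0 : S (Y 0) + 3 - a * (ω (Y 0))⁻¹ = lowerRoot γ p := by
    rw [hY0, hSs, hω, inv_inv, slope, smul_eq_mul]; ring
  have hlog : ∃ η > 0, ∀ τ ∈ Ioo 0 η, Y τ ∈ Ioo b ys := by
    have : ∀ᶠ τ in 𝓝[>] (0 : ℝ), b < Y τ := nhdsWithin_le_nhds
      ((hYd 0).continuousAt.eventually_const_lt (by rw [hY0]; exact hbys))
    obtain ⟨η, hη, hηs⟩ := mem_nhdsGT_iff_exists_Ioo_subset.1 this
    refine ⟨η, hη, fun τ hτ => ⟨hηs hτ, ?_⟩⟩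
    have : Real.exp (-τ) < 1 := by simpa using hτ.1
    simp only [hY]
    nlinarith
  obtain ⟨η, hη, hηY⟩ := hlog
  have hSfun : ∀ y ∈ Ioo b ys, S y = y ^ 2 * h γ (ρ y) (ω y) / G γ y (ρ y) (ω y) := fun y hy => by
    obtain ⟨⟨hy0, -, hρy⟩, hya⟩ := hprop y hy
    have := (hs.subsonic y hya).ne'
    simp only [hS, (hs.hasDeriv_rho y hya).deriv]
    field_simp
  have hdρ : ∀ y ∈ Ioo b ys, HasDerivAt ρ (ρ y * S y / y) y := fun y hy => by
    obtain ⟨⟨hy0, -, hρy⟩, hya⟩ := hprop y hy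
    have := (hs.subsonic y hya).ne'
    convert! hs.hasDeriv_rho y hya using 1
    rw [hSfun y hy]
    field_simp
  have hdω : ∀ y ∈ Ioo b ys, HasDerivAt ω (-(ω y * (S y + 3 - a * (ω y)⁻¹) / y)) y :=
    fun y hy => by
      obtain ⟨⟨hy0, hωy, hρy⟩, hya⟩ := hprop y hy
      have := (hs.subsonic y hya).ne'
      convert! hs.hasDeriv_omega y hya using 1
      rw [hSfun y hy]
      field_simp
      ring
  have hSd : ∀ y ∈ Ioo b ys, HasDerivAt S ((driftPoly γ (S y + 3 - a * (ω y)⁻¹) (ω y)⁻¹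
      - sonicPoly γ (S y + 3 - a * (ω y)⁻¹) (ω y)⁻¹ / machExcess γ y (ρ y) (ω y)
      + a * ((ω y)⁻¹ * (S y + 3 - a * (ω y)⁻¹))) / y) y := fun y hy => by
    obtain ⟨⟨hy0, hωy, hρy⟩, hya⟩ := hprop y hy
    refine (hasDerivAt_flow_slope h₂ hy0 hρy hωy (hs.subsonic y hya) rfl (hSfun y hy) (hdρ y hy)
      (hdω y hy)).congr_of_eventuallyEq ?_
    filter_upwards [Ioo_mem_nhds hy.1 hy.2] with z hz
    obtain ⟨⟨hz0, hωz, hρz⟩, hza⟩ := hprop z hz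
    have := (hs.subsonic z hza).ne'
    rw [hSfun z hz, machExcess]
    field_simp
  refine ⟨η, hη, fun τ => S (Y τ) + 3 - a * (ω (Y τ))⁻¹, fun τ => (ω (Y τ))⁻¹,
    fun τ => machExcess γ (Y τ) (ρ (Y τ)) (ω (Y τ)), ⟨?_, ?_, ?_, ?_, ?_, ?_, ?_, ?_, ?_, ?_, ?_,
      ?_⟩, ?_⟩
  · exact ((((hYan.mul hdρan).div hρan hρ0.ne').add analyticAt_const).sub
      (analyticAt_const.mul (hωan.inv hω0)))
  · exact hωan.inv hω0
  · have hexp : AnalyticAt ℝ (fun τ => (γ * Real.exp (Real.log (ρ (Y τ)) * (γ - 1))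
        - Y τ ^ 2 * ω (Y τ) ^ 2) / (Y τ * ω (Y τ)) ^ 2) 0 :=
      ((analyticAt_const.mul ((hρan.log hρ0).mul analyticAt_const).rexp).sub
        ((hYan.pow 2).mul (hωan.pow 2))).div ((hYan.mul hωan).pow 2)
          (pow_ne_zero 2 (mul_ne_zero (by rw [hY0]; exact hys.ne') hω0))
    refine hexp.congr ?_
    filter_upwards [hρan.continuousAt.eventually_const_lt hρ0] with τ hτ
    rw [machExcess, G, Real.rpow_def_of_pos hτ]
  · simp only [hv0]; exact sonicPoly_lowerRoot h₁ h₂ hp hp'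
  · simp only [hv0]; exact sonicPolyDeriv_lowerRoot_neg h₁ h₂ hp hp'
  · simp only [hv0]; exact machRate_lowerRoot_neg h₁ h₂ hp hp'
  · simp only [hY0, hω, inv_inv]
  · simp only [hY0, machExcess, hG0, zero_div]
  · intro τ hτ
    obtain ⟨⟨hy0, hωy, hρy⟩, hya⟩ := hprop _ (hηY τ hτ)
    exact div_pos (hs.subsonic _ hya) (by positivity)
  · intro τ hτ
    obtain ⟨⟨hy0, hωy, hρy⟩, hya⟩ := hprop _ (hηY τ hτ)
    have h1 := (hSd _ (hηY τ hτ)).comp τ (hYd τ)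
    have h2 := ((hdω _ (hηY τ hτ)).comp τ (hYd τ)).inv hωy.ne'
    convert! (h1.add_const 3).sub (h2.const_mul a) using 1
    simp only [Function.comp_apply]
    field_simp
    ring
  · intro τ hτ
    obtain ⟨⟨hy0, hωy, hρy⟩, hya⟩ := hprop _ (hηY τ hτ)
    convert! ((hdω _ (hηY τ hτ)).comp τ (hYd τ)).inv hωy.ne' using 1
    simp only [Function.comp_apply]
    field_simp
  · intro τ hτ
    obtain ⟨⟨hy0, hωy, hρy⟩, hya⟩ := hprop _ (hηY τ hτ)
    convert! (hasDerivAt_machExcess hy0 hρy hωy rfl (hdρ _ (hηY τ hτ))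
      (hdω _ (hηY τ hτ))).comp τ (hYd τ) using 1
    simp only [← hadef]
    field_simp
  · filter_upwards [Ioo_mem_nhdsLT hbys] with y hy
    obtain ⟨⟨hy0, hωy, hρy⟩, hya⟩ := hprop y hy
    have hYy : Y (Real.log (ys / y)) = y := by
      simp only [hY]
      rw [Real.exp_neg, Real.exp_log (by positivity)]
      field_simp
    simp only [curveVelocity, curveDensity, hYy, inv_inv, true_and]
    have e : (1 + machExcess γ y (ρ y) (ω y)) * y ^ 2 / (γ * (ω y)⁻¹ ^ 2) = ρ y ^ (γ - 1) := by
      rw [machExcess, G]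
      field_simp
      ring
    rw [e, ← Real.rpow_mul hρy.le, mul_inv_cancel₀ hγ.ne', Real.rpow_one]

lemma log_div_mem_Ioo {ys y T : ℝ} (hys : 0 < ys) (hy : y ∈ Ioo (ys * Real.exp (-T)) ys) :
    Real.log (ys / y) ∈ Ioo 0 T := by
  have hy0 : 0 < y := (mul_pos hys (Real.exp_pos _)).trans hy.1
  refine ⟨Real.log_pos ((one_lt_div hy0).2 hy.2), ?_⟩
  rw [Real.log_lt_iff_lt_exp (by positivity), div_lt_iff₀ hy0]
  have := hy.1
  rwa [Real.exp_neg, ← div_eq_mul_inv, div_lt_iff₀ (Real.exp_pos _), mul_comm] at this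

lemma mul_exp_neg_lt {ys T : ℝ} (hys : 0 < ys) (hT : 0 < T) : ys * Real.exp (-T) < ys := by
  have : Real.exp (-T) < 1 := by simpa using hT
  nlinarith

/-! ### Uniqueness and maximal extension of LPH-type flows. -/

/-- The vector field of the self-similar Euler-Poisson system. -/
def flowField (γ y : ℝ) (x : ℝ × ℝ) : ℝ × ℝ :=
  (y * x.1 * h γ x.1 x.2 / G γ y x.1 x.2,
    (4 - 3 * γ - 3 * x.2) / y - y * x.2 * h γ x.1 x.2 / G γ y x.1 x.2)

lemma exists_lipschitzOnWith_flowField {γ y : ℝ} {x : ℝ × ℝ} (hy : y ≠ 0) (hx : x.1 ≠ 0)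
    (hG : G γ y x.1 x.2 ≠ 0) :
    ∃ K, ∃ U ∈ 𝓝 x, ∀ᶠ t in 𝓝 y, LipschitzOnWith K (flowField γ t) U := by
  have hr : ContDiffAt ℝ 1 (fun z : ℝ × ℝ × ℝ => z.2.1 ^ (γ - 1)) (y, x) :=
    (contDiffAt_snd.fst).rpow_const_of_ne hx
  have hGc : ContDiffAt ℝ 1 (fun z : ℝ × ℝ × ℝ => G γ z.1 z.2.1 z.2.2) (y, x) := by
    unfold G; fun_prop
  have hhc : ContDiffAt ℝ 1 (fun z : ℝ × ℝ × ℝ => h γ z.2.1 z.2.2) (y, x) := by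
    unfold h; fun_prop
  have hF : ContDiffAt ℝ 1 (fun z : ℝ × ℝ × ℝ => flowField γ z.1 z.2) (y, x) := by
    unfold flowField
    fun_prop (disch := assumption)
  obtain ⟨K, U, hU, hK⟩ := hF.exists_lipschitzOnWith
  obtain ⟨A, hA, B, hB, hAB⟩ := mem_nhds_prod_iff.1 hU
  refine ⟨K, B, hB, ?_⟩
  filter_upwards [hA] with t ht
  refine LipschitzOnWith.of_dist_le_mul fun x₁ h₁ x₂ h₂ => ?_
  simpa [Prod.dist_eq] using hK.dist_le_mul (t, x₁) (hAB ⟨ht, h₁⟩) (t, x₂) (hAB ⟨ht, h₂⟩)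

lemma IsLPHAt.congr {γ ys : ℝ} {ρ ω ρ' ω' : ℝ → ℝ} (hs : IsLPHAt γ ys ρ ω)
    (hρ : ρ =ᶠ[𝓝 ys] ρ') (hω : ω =ᶠ[𝓝 ys] ω') : IsLPHAt γ ys ρ' ω' where
  analytic_rho := hs.analytic_rho.congr hρ
  analytic_omega := hs.analytic_omega.congr hω
  rho_pos := hρ.eq_of_nhds ▸ hs.rho_pos
  sonic := by rw [← hρ.eq_of_nhds, ← hω.eq_of_nhds]; exact hs.sonic
  h_eq_zero := by rw [← hρ.eq_of_nhds, ← hω.eq_of_nhds]; exact hs.h_eq_zero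
  rho_one := by rw [← hρ.deriv_eq, ← hρ.eq_of_nhds, ← hω.eq_of_nhds]; exact hs.rho_one
  omega_one := by rw [← hω.deriv_eq, ← hω.eq_of_nhds]; exact hs.omega_one
  eq_rho := by
    filter_upwards [hs.eq_rho, hρ, hω, hρ.deriv] with y h1 h2 h3 h4
    rw [← h2, ← h3, ← h4]; exact h1
  eq_omega := by
    filter_upwards [hs.eq_omega, hρ, hω, hω.deriv] with y h1 h2 h3 h4
    rw [← h2, ← h3, ← h4]; exact h1

namespace IsLPHSolutionOn

variable {γ p ys a₀ a₁ : ℝ} {ρ ω ρ' ω' : ℝ → ℝ}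

/-- The density solves `ρ' = k ρ` with `k` continuous, so a zero would propagate up to the sonic
point, where `ρ > 0`. Positivity keeps the flow field Lipschitz, as the real power is smooth away
from `0`. -/
lemma rho_pos_of_mem (h₁ : 1 < γ) (hs : IsLPHSolutionOn γ ys a₀ ρ ω) :
    ∀ y ∈ Ioo a₀ ys, 0 < ρ y := by
  intro y hy
  by_contra! hle
  have hρc : ∀ z ∈ Ioo a₀ ys, ContinuousAt ρ z := fun z hz => (hs.hasDeriv_rho z hz).continuousAt
  have hωc : ∀ z ∈ Ioo a₀ ys, ContinuousAt ω z := fun z hz => (hs.hasDeriv_omega z hz).continuousAt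
  have hcont : ContinuousOn ρ (Icc y ys) := fun z hz => by
    rcases hz.2.eq_or_lt with rfl | hlt
    · exact hs.analytic_rho.continuousAt.continuousWithinAt
    · exact (hρc z ⟨hy.1.trans_le hz.1, hlt⟩).continuousWithinAt
  obtain ⟨z, hz, hz0⟩ := intermediate_value_Icc hy.2.le hcont ⟨hle, hs.rho_pos.le⟩
  have hzys : z < ys := hz.2.lt_of_ne (by rintro rfl; exact hs.rho_pos.ne' hz0)
  have hzero := eq_zero_of_linear (f := ρ) (a := a₀) (b := ys)
    (k := fun y => y * h γ (ρ y) (ω y) / G γ y (ρ y) (ω y))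
    ⟨hy.1.trans_le hz.1, hzys⟩ (fun z hz => by
      have h1 := hρc z hz
      have h2 := hωc z hz
      have h3 : ContinuousAt (fun y => ρ y ^ (γ - 1)) z := h1.rpow_const (Or.inr (by linarith))
      have h4 : ContinuousAt (fun y => G γ y (ρ y) (ω y)) z := by unfold G; fun_prop
      have h5 : ContinuousAt (fun y => h γ (ρ y) (ω y)) z := by unfold h; fun_prop
      exact ((continuousAt_id.mul h5).div h4 (hs.subsonic z hz).ne').continuousWithinAt)
    (fun z hz => by convert! hs.hasDeriv_rho z hz using 1; ring) hz0
  have hev : ∀ᶠ t in 𝓝[<] ys, 0 < ρ t := nhdsWithin_le_nhds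
    (hs.analytic_rho.continuousAt.eventually_const_lt hs.rho_pos)
  obtain ⟨t, ht, ht'⟩ := (hev.and (Ioo_mem_nhdsLT (hy.1.trans hy.2))).exists
  exact ht.ne' (hzero t ht')

/-- Uniqueness of solutions of Larson-Penston-Hunter type. -/
theorem unique (h₁ : 1 < γ) (h₂ : γ < 4 / 3) (hp : 1 / (2 - γ) ≤ p) (hp' : (4 - 3 * γ) * p ≤ 3)
    (ha₀ : 0 ≤ a₀)
    (hs : IsLPHSolutionOn γ (sonicPoint γ p) a₀ ρ ω)
    (hs' : IsLPHSolutionOn γ (sonicPoint γ p) a₁ ρ' ω') :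
    ∀ y ∈ Ioo (max a₀ a₁) (sonicPoint γ p), ρ y = ρ' y ∧ ω y = ω' y := by
  intro y hy
  have hp0 : 0 < p := (one_div_pos.2 (by linarith)).trans_le hp
  have hys := sonicPoint_pos h₁ h₂ hp0
  have hlt : max a₀ a₁ < sonicPoint γ p := hy.1.trans hy.2
  obtain ⟨η, hη, v, w, m, hc, hev⟩ :=
    hs.exists_sonicCurve h₁ h₂ hp hp' ((le_max_left _ _).trans_lt hlt)
  obtain ⟨η', hη', v', w', m', hc', hev'⟩ :=
    hs'.exists_sonicCurve h₁ h₂ hp hp' ((le_max_right _ _).trans_lt hlt)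
  -- Uniqueness of sonic curves gives agreement at one point `y₀` near the sonic point; regular
  -- uniqueness for the flow field carries it to the whole common interval.
  have hmin : 0 < min η η' := lt_min hη hη'
  obtain ⟨y₀, ⟨⟨⟨e1, e2⟩, e3, e4⟩, hy₀⟩, hy₀'⟩ := (((hev.and hev').and
    (Ioo_mem_nhdsLT hlt)).and (Ioo_mem_nhdsLT (mul_exp_neg_lt hys hmin))).exists
  obtain ⟨-, u2, u3⟩ := hc.eqOn hc' _ (log_div_mem_Ioo hys hy₀')
  have hsub : ∀ y ∈ Ioo (max a₀ a₁) (sonicPoint γ p), y ∈ Ioo a₀ (sonicPoint γ p) ∧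
      y ∈ Ioo a₁ (sonicPoint γ p) := fun y hy =>
    ⟨⟨(le_max_left _ _).trans_lt hy.1, hy.2⟩, (le_max_right _ _).trans_lt hy.1, hy.2⟩
  have := eqOn_Ioo_of_locally_lipschitz (F := flowField γ) (f := fun y => (ρ y, ω y))
    (g := fun y => (ρ' y, ω' y)) hy₀
    (fun y hy => (hs.hasDeriv_rho y (hsub y hy).1).prodMk (hs.hasDeriv_omega y (hsub y hy).1))
    (fun y hy => (hs'.hasDeriv_rho y (hsub y hy).2).prodMk (hs'.hasDeriv_omega y (hsub y hy).2))
    (fun y hy => exists_lipschitzOnWith_flowField (ha₀.trans_lt (hsub y hy).1.1).ne'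
      (hs.rho_pos_of_mem h₁ y (hsub y hy).1).ne' (hs.subsonic y (hsub y hy).1).ne')
    (by simp only [e1, e2, e3, e4, curveVelocity, curveDensity, u2, u3]) hy
  simpa using this

/-- Solutions on arbitrary intervals combine to a maximal solution. -/
theorem exists_maximal (h₁ : 1 < γ) (h₂ : γ < 4 / 3) (hp : 1 / (2 - γ) ≤ p)
    (hp' : (4 - 3 * γ) * p ≤ 3) (ha₀ : a₀ ∈ Ioo 0 (sonicPoint γ p))
    (hs : IsLPHSolutionOn γ (sonicPoint γ p) a₀ ρ ω) :
    ∃ r o : ℝ → ℝ, IsMaximalLPHSolution γ (sonicPoint γ p) r o := by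
  set ys := sonicPoint γ p with hysdef
  set S := {a : ℝ | a ∈ Ioo 0 ys ∧ ∃ ρ ω : ℝ → ℝ, IsLPHSolutionOn γ ys a ρ ω} with hS
  have ha₀S : a₀ ∈ S := ⟨ha₀, ρ, ω, hs⟩
  have hex : ∀ y ∈ Ioo (sonicTime γ ys) ys, ∃ a r o, 0 < a ∧ a < y ∧
      IsLPHSolutionOn γ ys a r o := fun y hy => by
    obtain ⟨a, ⟨ha, r, o, hro⟩, hay⟩ := exists_lt_of_csInf_lt ⟨a₀, ha₀S⟩ hy.1
    exact ⟨a, r, o, ha.1, hay, hro⟩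
  have hle : sonicTime γ ys ≤ a₀ := csInf_le ⟨0, fun a ha => ha.1.1.le⟩ ha₀S
  choose! A R O hA0 hAy hsol using hex
  classical
  -- At `y` the value comes from a chosen solution that reaches below `y`; uniqueness makes the
  -- choices compatible. At and beyond `ys` the given solution is kept, which preserves analyticity
  -- at the sonic point.
  set r : ℝ → ℝ := fun y => if y ∈ Ioo (sonicTime γ ys) ys then R y y else ρ y with hr
  set o : ℝ → ℝ := fun y => if y ∈ Ioo (sonicTime γ ys) ys then O y y else ω y with ho
  have hkey : ∀ (a : ℝ) (ρ' ω' : ℝ → ℝ), IsLPHSolutionOn γ ys a ρ' ω' →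
      ∀ y ∈ Ioo a ys, y ∈ Ioo (sonicTime γ ys) ys → r y = ρ' y ∧ o y = ω' y := by
    intro a ρ' ω' h y hy hy'
    simp only [hr, ho, if_pos hy']
    exact (hsol y hy').unique h₁ h₂ hp hp' (hA0 y hy').le h y ⟨max_lt (hAy y hy') hy.1, hy.2⟩
  have hnhds : ∀ y ∈ Ioo (sonicTime γ ys) ys, r =ᶠ[𝓝 y] R y ∧ o =ᶠ[𝓝 y] O y := fun y hy => by
    have : ∀ᶠ z in 𝓝 y, r z = R y z ∧ o z = O y z := by
      filter_upwards [Ioo_mem_nhds (hAy y hy) hy.2, Ioo_mem_nhds hy.1 hy.2] with z hz hz'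
      exact hkey _ _ _ (hsol y hy) z hz hz'
    exact ⟨this.mono fun _ h => h.1, this.mono fun _ h => h.2⟩
  have hat : ∀ᶠ z in 𝓝 ys, ρ z = r z ∧ ω z = o z := by
    filter_upwards [eventually_gt_nhds ha₀.2] with z hz
    by_cases hzs : z < ys
    · have := hkey _ _ _ hs z ⟨hz, hzs⟩ ⟨hle.trans_lt hz, hzs⟩
      exact ⟨this.1.symm, this.2.symm⟩
    · have : z ∉ Ioo (sonicTime γ ys) ys := fun h => hzs h.2
      simp only [hr, ho, if_neg this, and_self]
  refine ⟨r, o, { toIsLPHAt := hs.toIsLPHAt.congr (hat.mono fun _ h => h.1)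
                    (hat.mono fun _ h => h.2), hasDeriv_rho := fun y hy => ?_,
                  hasDeriv_omega := fun y hy => ?_, subsonic := fun y hy => ?_ }⟩
  · obtain ⟨e1, e2⟩ := hnhds y hy
    rw [e1.eq_of_nhds, e2.eq_of_nhds]
    exact ((hsol y hy).hasDeriv_rho y ⟨hAy y hy, hy.2⟩).congr_of_eventuallyEq e1
  · obtain ⟨e1, e2⟩ := hnhds y hy
    rw [e1.eq_of_nhds, e2.eq_of_nhds]
    exact ((hsol y hy).hasDeriv_omega y ⟨hAy y hy, hy.2⟩).congr_of_eventuallyEq e2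
  · obtain ⟨e1, e2⟩ := hnhds y hy
    rw [e1.eq_of_nhds, e2.eq_of_nhds]
    exact (hsol y hy).subsonic y ⟨hAy y hy, hy.2⟩

end IsLPHSolutionOn

lemma sonicTime_nonneg (γ ys : ℝ) : 0 ≤ sonicTime γ ys :=
  Real.sInf_nonneg fun _ ha => ha.1.1.le

/-! ### Crossing flows and the critical sonic point. -/

/-- If the sonic curve crosses the Friedman value, so does the flow. -/
lemma exists_maximal_of_crosses {γ p : ℝ} (h₁ : 1 < γ) (h₂ : γ < 4 / 3) (hp : 1 / (2 - γ) ≤ p)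
    (hp' : (4 - 3 * γ) * p < 3) (hc : Crosses γ p) :
    ∃ ρ ω : ℝ → ℝ, IsMaximalLPHSolution γ (sonicPoint γ p) ρ ω ∧
      ∃ y ∈ Ioo (sonicTime γ (sonicPoint γ p)) (sonicPoint γ p), ω y = omegaF γ := by
  have ha : 0 < 4 - 3 * γ := by linarith
  have hp0 : 0 < p := (one_div_pos.2 (by linarith)).trans_le hp
  have hys := sonicPoint_pos h₁ h₂ hp0
  obtain ⟨T, v, w, m, hcur, hv, τ, hτ, hwτ⟩ := hc
  have hT : 0 < T := hτ.1.trans hτ.2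
  have hsol := hcur.isLPHSolutionOn h₁ h₂ hp0 hT
  set ys := sonicPoint γ p with hysdef
  have hb : ys * Real.exp (-T) ∈ Ioo 0 ys :=
    ⟨mul_pos hys (Real.exp_pos _), mul_exp_neg_lt hys hT⟩
  obtain ⟨t, ht, hwt⟩ := intermediate_value_Ioo hτ.1.le
    (f := fun t => (4 - 3 * γ) * w t) (fun t ht => ((hcur.continuousAt_w
      ⟨ht.1, ht.2.trans_lt hτ.2⟩).const_mul (4 - 3 * γ)).continuousWithinAt)
    (show (3 : ℝ) ∈ _ from ⟨by simpa [hcur.w_zero] using hp', hwτ⟩)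
  have htT : t < T := ht.2.trans hτ.2
  set y := ys * Real.exp (-t) with hy
  have hyt : Real.log (ys / y) = t := by
    rw [hy, Real.exp_neg, ← div_eq_mul_inv, div_div_cancel₀ hys.ne', Real.log_exp]
  have hyb : y ∈ Ioo (ys * Real.exp (-T)) ys :=
    ⟨mul_lt_mul_of_pos_left (Real.exp_lt_exp.2 (by linarith)) hys, mul_exp_neg_lt hys ht.1⟩
  obtain ⟨r, o, hro⟩ := hsol.exists_maximal h₁ h₂ hp hp'.le hb
  have hle : sonicTime γ ys ≤ ys * Real.exp (-T) :=
    csInf_le ⟨0, fun a ha => ha.1.1.le⟩ ⟨hb, _, _, hsol⟩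
  refine ⟨r, o, hro, y, ⟨hle.trans_lt hyb.1, hyb.2⟩, ?_⟩
  rw [(IsLPHSolutionOn.unique h₁ h₂ hp hp'.le (sonicTime_nonneg γ ys) hro hsol y
    ⟨max_lt (hle.trans_lt hyb.1) hyb.1, hyb.2⟩).2, curveVelocity, hyt, omegaF, inv_eq_iff_eq_inv,
    inv_div, eq_div_iff ha.ne', mul_comm]
  exact hwt

end SelfSimilarEP

end

open SelfSimilarEP

theorem proposition4 (γ : ℝ) (hγ₁ : 1 < γ) (hγ₂ : γ < 4 / 3) :
    (SelfSimilarEP.fundamentalSet γ).Nonempty ∧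
    SelfSimilarEP.sonicTime γ (SelfSimilarEP.criticalValue γ) = 0 ∧
    SelfSimilarEP.criticalTime γ (SelfSimilarEP.criticalValue γ) = 0 ∧
    ∃ ρ ω : ℝ → ℝ,
      SelfSimilarEP.IsLPHSolutionOn γ (SelfSimilarEP.criticalValue γ) 0 ρ ω ∧
      ∀ y ∈ Set.Ioo 0 (SelfSimilarEP.criticalValue γ), SelfSimilarEP.omegaF γ < ω y := by
  have h2γ : 0 < 2 - γ := by linarith
  have ha : 0 < 4 - 3 * γ := by linarith
  obtain ⟨p, ⟨hp, hpF⟩, hcross, hglob⟩ := exists_critical_parameter hγ₁ hγ₂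
  have hlt3 : ∀ {q}, q < 3 / (4 - 3 * γ) ↔ (4 - 3 * γ) * q < 3 := fun {q} => by
    rw [lt_div_iff₀ ha, mul_comm]
  have hp' := (hlt3.1 hpF).le
  have hpf : 0 < 1 / (2 - γ) := one_div_pos.2 h2γ
  have hp0 : 0 < p := hpf.trans_le hp
  have hys := sonicPoint_pos hγ₁ hγ₂ hp0
  have hmono := sonicPoint_strictMonoOn hγ₁ hγ₂
  have hyf : yf γ ≤ sonicPoint γ p := by
    rw [← sonicPoint_farField hγ₁ hγ₂]; exact hmono.monotoneOn hpf hp0 hp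
  have hyF : sonicPoint γ p < yF γ := by
    rw [← sonicPoint_friedman hγ₂]; exact hmono hp0 (hp0.trans hpF) hpF
  -- The time `log (ys / b)` is the one at which the curve reaches `b`. The solution may depend on
  -- `b` here; uniqueness removes this dependence in `habove`.
  have hsol : ∀ b ∈ Ioo 0 (sonicPoint γ p), ∃ ρ ω : ℝ → ℝ,
      IsLPHSolutionOn γ (sonicPoint γ p) b ρ ω ∧ ∀ y ∈ Ioo b (sonicPoint γ p), omegaF γ < ω y := by
    intro b hb
    have hT : 0 < Real.log (sonicPoint γ p / b) := Real.log_pos ((one_lt_div hb.1).2 hb.2)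
    obtain ⟨v, w, m, hc, hw⟩ := hglob (Real.log (sonicPoint γ p / b))
    have hs := hc.isLPHSolutionOn hγ₁ hγ₂ hp0 hT
    have e : sonicPoint γ p * Real.exp (-Real.log (sonicPoint γ p / b)) = b := by
      rw [Real.exp_neg, Real.exp_log (div_pos hys hb.1), inv_div, mul_div_cancel₀ _ hys.ne']
    refine ⟨_, _, e ▸ hs, fun y hy => ?_⟩
    have hτ := log_div_mem_Ioo hys (e.symm ▸ hy)
    have hw0 := hc.w_pos hp0 _ ⟨hτ.1.le, hτ.2⟩
    rw [curveVelocity, omegaF, lt_inv_comm₀ (by positivity) hw0, inv_div]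
    exact hlt3.2 (hw _ hτ)
  have htime : sonicTime γ (sonicPoint γ p) = 0 := by
    have : {a : ℝ | a ∈ Ioo 0 (sonicPoint γ p) ∧ ∃ ρ ω : ℝ → ℝ,
        IsLPHSolutionOn γ (sonicPoint γ p) a ρ ω} = Ioo 0 (sonicPoint γ p) :=
      Set.ext fun b => ⟨fun hb => hb.1, fun hb => by
        obtain ⟨ρ, ω, hρω, -⟩ := hsol b hb
        exact ⟨hb, ρ, ω, hρω⟩⟩
    rw [sonicTime, this, csInf_Ioo hys]
  have habove : ∀ ρ ω : ℝ → ℝ, IsMaximalLPHSolution γ (sonicPoint γ p) ρ ω →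
      ∀ y ∈ Ioo 0 (sonicPoint γ p), omegaF γ < ω y := by
    intro ρ ω hmax y hy
    obtain ⟨r, o, hro, ho⟩ := hsol (y / 2) ⟨by linarith [hy.1], by linarith [hy.1, hy.2]⟩
    rw [(IsLPHSolutionOn.unique hγ₁ hγ₂ hp hp' (sonicTime_nonneg _ _) hmax hro y
      ⟨max_lt (htime ▸ hy.1) (by linarith [hy.1]), hy.2⟩).2]
    exact ho y ⟨by linarith [hy.1], hy.2⟩
  -- Every sonic point up to `yF` is `sonicPoint γ q` with `q` above the threshold, by the
  -- intermediate value theorem, and all such `q` cross.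
  have hsub : Ioo (sonicPoint γ p) (yF γ) ⊆ fundamentalSet γ := by
    intro ys hy
    refine ⟨⟨hyf.trans hy.1.le, hy.2⟩, fun yt hyt => ?_⟩
    have hcont : ContinuousOn (sonicPoint γ) (Icc p (3 / (4 - 3 * γ))) :=
      (continuousOn_sonicPoint hγ₁ hγ₂).mono fun q hq => hp0.trans_le hq.1
    obtain ⟨q, hq, rfl⟩ := intermediate_value_Ioo hpF.le hcont
      ⟨hy.1.trans_le hyt.1, by rw [sonicPoint_friedman hγ₂]; exact hyt.2⟩
    exact exists_maximal_of_crosses hγ₁ hγ₂ (hp.trans hq.1.le) (hlt3.1 hq.2) (hcross q hq)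
  -- Membership of any `ys ≤ sonicPoint γ p` would require the flow at `sonicPoint γ p` itself to
  -- attain the Friedman value, contrary to `habove`. So the infimum of the fundamental set is not
  -- attained.
  have hsup : fundamentalSet γ ⊆ Ioi (sonicPoint γ p) := by
    intro ys hy
    by_contra hle
    obtain ⟨ρ, ω, hmax, y, hymem, hω⟩ := hy.2 (sonicPoint γ p) ⟨not_lt.1 hle, hyF⟩
    rw [htime] at hymem
    exact (habove ρ ω hmax y hymem).ne' hω
  have hne : (fundamentalSet γ).Nonempty := (nonempty_Ioo.2 hyF).mono hsub
  have hcrit : criticalValue γ = sonicPoint γ p := by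
    refine le_antisymm ?_ (le_csInf hne fun ys hy => (hsup hy).le)
    rw [← csInf_Ioo hyF]
    exact csInf_le_csInf ⟨_, fun ys hy => (hsup hy).le⟩ (nonempty_Ioo.2 hyF) hsub
  obtain ⟨ρ, ω, hmax⟩ : ∃ ρ ω, IsMaximalLPHSolution γ (sonicPoint γ p) ρ ω := by
    have hb : sonicPoint γ p / 2 ∈ Ioo 0 (sonicPoint γ p) := ⟨by linarith, by linarith⟩
    obtain ⟨ρ, ω, hρω, -⟩ := hsol _ hb
    exact hρω.exists_maximal hγ₁ hγ₂ hp hp' hb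
  have hω := habove ρ ω hmax
  rw [hcrit]
  refine ⟨hne, htime, ?_, ρ, ω, htime ▸ hmax, hω⟩
  have : {y : ℝ | y ∈ Ioo (sonicTime γ (sonicPoint γ p)) (sonicPoint γ p) ∧
      ∃ ρ ω : ℝ → ℝ, IsMaximalLPHSolution γ (sonicPoint γ p) ρ ω ∧
        ∀ z ∈ Ioo y (sonicPoint γ p), omegaF γ < ω z} = Ioo 0 (sonicPoint γ p) :=
    Set.ext fun b => ⟨fun hb => htime ▸ hb.1, fun hb => ⟨by rw [htime]; exact hb, ρ, ω, hmax,
      fun z hz => hω z ⟨hb.1.trans hz.1, hz.2⟩⟩⟩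
  rw [criticalTime, this, csInf_Ioo hys]
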